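/- **Setting.** Let $b\ge 2$, $s\ge 1$, $s_0,s_1\ge 0$ be integers with $s_0+bs_1\le s+1$, and let $\mathcal V=(V_1,\dots,V_b)$ be a random vector with $V_i\ge 0$. We assume one of the following. *Split tree:* $\sum_i V_i=1$ almost surely, $P(\max_i V_i=1)<1$ and $P(\min_i V_i>0)>0$. *Fractional split tree:* $\sum_i V_i\le 1$ almost surely and $\sum_i P(V_i>0)>1$. Nodes are the finite words over $\{1,\dots,b\}$. Give each node $v$ an independent copy $\mathcal V^{(v)}$ of $\mathcal V$. The random tree $T_n$ with $n\ge 0$ balls is described by the numbers $n_v$ of balls in the subtrees rooted at the nodes $v$: the root has $n$ balls in its subtree; if $n_v\le s$, then $n_{vi}=0$ for all $i$; if $n_v>s$, then, given $n_v$ and $\mathcal V^{(v)}=(V_1,\dots,V_b)$, the vector $(n_{v1},\dots,n_{vb})$ consists of the first $b$ entries of $\mathrm{Mult}\bigl(n_v-s_0-bs_1;\,V_1,\dots,V_b,\,1-\sum_i V_i\bigr)+(s_1,\dots,s_1,0)$, independently for different nodes. The nodes of $T_n$ are the $v$ with $n_v>0$, and the fringe subtree $T_n^v$ is $v$ with all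 its descendants, described by the numbers $(n_{vu})_u$. Let $\beta\in(0,1]$ be the Malthusian parameter, defined by $E\sum_{i=1}^b V_i^\beta=1$. The lattice case is that there is a $d>0$ such that, for each $i$, almost surely $V_i=0$ or $\ln V_i\in d\mathbb Z$; then $d$ denotes the largest such number. Otherwise (nonlattice case) put $d=0$. A toll function $\phi$ is a real function of trees with balls, with $E|\phi(T_n)|<\infty$ for all $n\ge1$. Write $\phi_n=E\,\phi(T_n)$ and $X_n(\phi)=\sum_{v\in T_n}\phi(T_n^v)$. **Theorem.** Let $\phi$ be a toll function with $\phi_n=O(n^{\beta-\delta})$ for some $\delta>0$. (This holds, for example, for the toll functions that count leaves, count nodes, or count fringe subtrees with a fixed number of balls.) Then $X_n(\phi)$ is integrable for every $n$, and there is a bounded, continuous, $d$-periodic function $\varpi:\mathbb R\to\mathbb R$ such that, as $n\to\infty$, $$E\,X_n(\phi)=\varpi(\ln n)\,n^\beta+o(n^\beta).$$ In the nonlattice case, $\varpi$ is constant. If $\phi_n\ge 0$ for all $n\ge 1$ and $\phi_n>0$ for some $n\ge\max\{1,s_1\}$, then $\varpi$ is bounded away from $0$, that is, $\varpi\ge c$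 for some constant $c>0$. For split trees, $\beta=1$. -/

import Mathlib

open MeasureTheory Filter Asymptotics

namespace SplitTree

/-- A tree with balls inside the infinite `b`-ary tree: the nodes are the finite words over
`Fin b`, and `t u` is the number of balls in the subtree rooted at `u`.
The nodes of the tree itself are the words `u` with `0 < t u`. -/
abbrev BallTree (b : ℕ) : Type := List (Fin b) → ℕ

/-- The fringe subtree rooted at `v`. -/
def fringe {b : ℕ} (t : BallTree b) (v : List (Fin b)) : BallTree b := fun u => t (v ++ u)

/-- The additive functional `∑_{v ∈ t} φ(t^v)` of the toll function `φ`
(a finite sum for a tree with finitely many nodes). -/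
noncomputable def additive {b : ℕ} (φ : BallTree b → ℝ) (t : BallTree b) : ℝ :=
  ∑' v : List (Fin b), if 0 < t v then φ (fringe t v) else 0

/-- `ν` is the law of a vector of nonnegative entries whose sum is at most `1`. -/
def IsSubstochastic {b : ℕ} (ν : Measure (Fin b → ℝ)) : Prop :=
  ∀ᵐ v ∂ν, (∀ i, 0 ≤ v i) ∧ ∑ i, v i ≤ 1

/-- `ν` is the law of the split vector of a split tree: the entries are nonnegative and sum up
to `1`, the largest is not almost surely `1`, and the smallest is not almost surely `0`. -/
def IsSplitVector {b : ℕ} (ν : Measure (Fin b → ℝ)) : Prop :=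
  IsSubstochastic ν ∧ (∀ᵐ v ∂ν, ∑ i, v i = 1) ∧
    ν {v | ∃ i, v i = 1} < 1 ∧ 0 < ν {v | ∀ i, 0 < v i}

/-- `ν` is the law of the split vector of a fractional split tree: the entries are nonnegative,
their sum is at most `1`, and `∑ i, P(V_i > 0) > 1`. -/
def IsFractionalSplitVector {b : ℕ} (ν : Measure (Fin b → ℝ)) : Prop :=
  IsSubstochastic ν ∧ 1 < ∑ i, ν {v | 0 < v i}

/-- `β ∈ (0, 1]` is the Malthusian parameter: `E ∑ i, V_i ^ β = 1`. -/
def IsMalthusian {b : ℕ} (ν : Measure (Fin b → ℝ)) (β : ℝ) : Prop :=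
  0 < β ∧ β ≤ 1 ∧ ∫ v, ∑ i, v i ^ β ∂ν = 1

/-- The numbers `d > 0` such that almost surely `ln V ∈ dℤ` for a uniformly chosen entry `V` of
the split vector. Vanishing entries, which have `ln V = -∞`, impose no condition. -/
def latticeSpans {b : ℕ} (ν : Measure (Fin b → ℝ)) : Set ℝ :=
  {d | 0 < d ∧ ∀ i, ∀ᵐ v ∂ν, v i ≠ 0 → ∃ k : ℤ, Real.log (v i) = k * d}

/-- The lattice case. -/
def IsLattice {b : ℕ} (ν : Measure (Fin b → ℝ)) : Prop := (latticeSpans ν).Nonempty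

/-- The span `d`: the largest element of `latticeSpans ν` in the lattice case, and `sSup ∅ = 0` in
the nonlattice case. When some entry lies in `(0, 1)` with positive probability, the set is bounded
and its supremum, if the set is nonempty, is attained. -/
noncomputable def span {b : ℕ} (ν : Measure (Fin b → ℝ)) : ℝ := sSup (latticeSpans ν)

/-- The randomness attached to one node: a split vector, and one uniform variable for each ball
that has to be sent to a child. -/
abbrev NodeData (b : ℕ) : Type := (Fin b → ℝ) × (ℕ → unitInterval)

/-- The law of the randomness of all nodes: independent over the nodes; at each node a split
vector with law `ν` and an independent i.i.d. sequence of uniform variables on `[0, 1]`. -/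
noncomputable def driving {b : ℕ} (ν : Measure (Fin b → ℝ)) [IsProbabilityMeasure ν] :
    Measure (List (Fin b) → NodeData b) :=
  Measure.infinitePi fun _ : List (Fin b) =>
    ν.prod (Measure.infinitePi fun _ : ℕ => (volume : Measure unitInterval))

/-- A ball with uniform variable `x` at a node with split vector `v` goes to child `i`. Given `v`,
this has probability `v i`; with probability `1 - ∑ i, v i` the ball goes to no child. -/
def GoesTo {b : ℕ} (v : Fin b → ℝ) (x : unitInterval) (i : Fin b) : Prop :=
  ∑ j ∈ Finset.Iio i, v j ≤ x ∧ (x : ℝ) < ∑ j ∈ Finset.Iic i, v j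

open Classical in
/-- The number of balls in the subtree of child `i` of a node with `n` balls in its subtree.
If `n ≤ s`, the node is not split. If `n > s`, then `s₀` balls are retained, each child receives
`s₁` balls, and the other `n - s₀ - b s₁` balls are distributed independently according to the
split vector, so that, given the split vector `v`, the vector of these numbers is given by the
first `b` entries of `Mult(n - s₀ - b s₁; v 1, …, v b, 1 - ∑ i, v i) + (s₁, …, s₁, 0)`. -/
noncomputable def childCount {b : ℕ} (s s₀ s₁ : ℕ) (n : ℕ) (x : NodeData b) (i : Fin b) : ℕ :=
  if n ≤ s then 0
  else ((Finset.range (n - s₀ - b * s₁)).filter fun k => GoesTo x.1 (x.2 k) i).card + s₁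

/-- The (fractional) split tree with `n` balls: the root has `n` balls in its subtree, and the
subtree of child `i` is the tree grown from the balls sent there, with the randomness of the nodes
below `i`. -/
noncomputable def tree {b : ℕ} (s s₀ s₁ : ℕ) :
    ℕ → (List (Fin b) → NodeData b) → BallTree b
  | n, _, [] => n
  | n, ω, i :: u => tree s s₀ s₁ (childCount s s₀ s₁ n (ω []) i) (fun w => ω (i :: w)) u

/-- The same recursion read from the root downwards: `n_{vi}` is obtained from `n_v` and the
randomness at the node `v`. -/
theorem tree_append_singleton {b : ℕ} (s s₀ s₁ : ℕ) (n : ℕ) (ω : List (Fin b) → NodeData b)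
    (v : List (Fin b)) (i : Fin b) :
    tree s s₀ s₁ n ω (v ++ [i]) = childCount s s₀ s₁ (tree s s₀ s₁ n ω v) (ω v) i := by
  induction v generalizing n ω with
  | nil => simp [tree]
  | cons j v ih => simp [tree, ih]

/-- `φ_n = E φ(T_n)`. -/
noncomputable def tollMean {b : ℕ} (s s₀ s₁ : ℕ) (ν : Measure (Fin b → ℝ))
    [IsProbabilityMeasure ν] (φ : BallTree b → ℝ) (n : ℕ) : ℝ :=
  ∫ ω, φ (tree s s₀ s₁ n ω) ∂(driving ν)

/-- `E X_n(φ)`. -/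
noncomputable def additiveMean {b : ℕ} (s s₀ s₁ : ℕ) (ν : Measure (Fin b → ℝ))
    [IsProbabilityMeasure ν] (φ : BallTree b → ℝ) (n : ℕ) : ℝ :=
  ∫ ω, additive φ (tree s s₀ s₁ n ω) ∂(driving ν)

/-- The expectations `φ_n`, `n ≥ 1`, exist, and `φ_n = O(n^(β - δ))` for some `δ > 0`. -/
def IsSmallToll {b : ℕ} (s s₀ s₁ : ℕ) (ν : Measure (Fin b → ℝ)) [IsProbabilityMeasure ν]
    (β : ℝ) (φ : BallTree b → ℝ) : Prop :=
  (∀ n, 1 ≤ n → Integrable (fun ω => φ (tree s s₀ s₁ n ω)) (driving ν)) ∧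
    ∃ δ : ℝ, 0 < δ ∧
      (fun n : ℕ => tollMean s s₀ s₁ ν φ n) =O[atTop] fun n : ℕ => (n : ℝ) ^ (β - δ)

/-- The toll function counting nodes. -/
def nodeToll {b : ℕ} : BallTree b → ℝ := fun _ => 1

open Classical in
/-- The toll function counting leaves: the indicator that the tree is a single leaf. -/
noncomputable def leafToll {b : ℕ} : BallTree b → ℝ :=
  fun t => if 0 < t [] ∧ ∀ u, u ≠ [] → t u = 0 then 1 else 0

/-- The toll function counting fringe subtrees with `k` balls. -/
def sizeToll {b : ℕ} (k : ℕ) : BallTree b → ℝ := fun t => if t [] = k then 1 else 0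

end SplitTree

/-! Conditioning on the root shows that the means f(n) = E X_n(φ) satisfy a linear recursion driven
by the toll means a(n): f(n) = a(n) for 1 ≤ n ≤ s, and f(n) = a(n) + E ∑ f(N_i) for n > s, where N_i
- s₁ is binomial given the split vector (`isSolution_additiveMean`). Everything else is analysis of
this recursion. As N_i is n V_i up to an error of order √n, the function n^γ is almost an
eigenfunction of the averaging operator, with eigenvalue E ∑ V_i^γ. This eigenvalue decreases
strictly in γ and equals 1 at γ = β.

A comparison principle (`nonpos_of_le_offspringMean`) turns super- and subsolutions of the form n^β
∓ n^γ, γ < β, into upper and lower bounds of order n^β (`exists_solution_bound`,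
`exists_lower_bound`).

For finitely supported tolls, a coupling of binomial variables makes f Hölder continuous with
exponent β (`exists_holder`). Extended to the line, F(x) = exp(-βx) f(exp x) is bounded and
uniformly continuous, and it agrees with the mean of F(x - W) up to an exponentially small defect,
where W is -ln V_i weighted by V_i^β (`exists_isAlmostHarmonic`). The renewal step is an energy
argument: the mean of (F(x) - F(x - W))² has bounded integrals, hence tends to 0 (`tendsto_energy`),
so each point of the support of W is an asymptotic period of F (`support_subset`). Asymptotic
periods form a closed subgroup. If it is all of ℝ, a conserved quantity forces F to converge
(`exists_tendsto`); in the lattice case the same argument along x + dℤ gives a d-periodic limit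
(`exists_periodic`).

A general small toll is truncated at K. The error is at most e_K n^β with e_K → 0, so the
fluctuations of the truncations converge uniformly (`exists_fluctuation`). -/

namespace SplitTree

/-! ### Independence at a node and the law of the child counts -/

/-- In an i.i.d. family, one coordinate and a family of other coordinates are independent. -/
theorem measurePreserving_infinitePi_prodMk {ι κ X : Type*} [MeasurableSpace X] (P : Measure X)
    [IsProbabilityMeasure P] (a : ι) (e : κ → ι) (he : Function.Injective e)
    (ha : ∀ k, e k ≠ a) :
    MeasurePreserving (fun ω : ι → X => (ω a, fun k => ω (e k)))
      (Measure.infinitePi fun _ : ι => P) (P.prod (Measure.infinitePi fun _ : κ => P)) := by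
  refine ⟨by fun_prop, ?_⟩
  have h1 : ProbabilityTheory.iIndepFun (fun i (ω : ι → X) => ω i)
      (Measure.infinitePi fun _ : ι => P) :=
    ProbabilityTheory.iIndepFun_infinitePi (X := fun _ x => x) (fun _ => measurable_id)
  have h2 : ProbabilityTheory.IndepFun (fun ω : ι → X => ω a) (fun ω k => ω (e k))
      (Measure.infinitePi fun _ : ι => P) := by
    have hd : Disjoint ({a} : Set ι) (Set.range e) := by
      rw [Set.disjoint_singleton_left]; rintro ⟨k, hk⟩; exact ha k hk
    have h3 := ProbabilityTheory.indep_iSup_of_disjoint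
      (m := fun i => MeasurableSpace.comap (fun ω : ι → X => ω i) inferInstance)
      (fun i => (measurable_pi_apply i).comap_le) h1 hd
    refine ProbabilityTheory.indep_of_indep_of_le_left
      (ProbabilityTheory.indep_of_indep_of_le_right h3 ?_) ?_
    · refine Measurable.comap_le (@measurable_pi_iff _ _ _ (_) _ _ |>.2 fun k => ?_)
      exact measurable_iff_comap_le.2 (le_iSup₂_of_le (e k) ⟨k, rfl⟩ le_rfl)
    · exact le_iSup₂_of_le a rfl le_rfl
  rw [h2.map_prod_eq_prod_map_map (measurable_pi_apply a).aemeasurable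
    (measurable_pi_lambda _ fun k => measurable_pi_apply (e k)).aemeasurable,
    Measure.infinitePi_map_eval, Measure.map_infinitePi_infinitePi_of_inj he]

theorem integrable_comp_nat_of_le {Ω : Type*} [MeasurableSpace Ω] {P : Measure Ω}
    [IsFiniteMeasure P] {N : Ω → ℕ} (hN : Measurable N) {n : ℕ} (h : ∀ ω, N ω ≤ n) (g : ℕ → ℝ) :
    Integrable (fun ω => g (N ω)) P := by
  refine Integrable.of_bound ((measurable_from_nat (f := g)).comp hN).aestronglyMeasurable
    (∑ k ∈ Finset.range (n + 1), |g k|) (Eventually.of_forall fun ω => ?_)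
  exact Finset.single_le_sum (f := fun k => |g k|) (fun k _ => abs_nonneg _)
    (Finset.mem_range.2 (Nat.lt_succ_of_le (h ω)))

/-- The mean of `g` under the binomial distribution with `m` trials and success probability `p`. -/
def binomMean : ℕ → ℝ → (ℕ → ℝ) → ℝ
  | 0, _, g => g 0
  | m + 1, p, g => p * binomMean m p (fun j => g (j + 1)) + (1 - p) * binomMean m p g

section law

variable {b : ℕ}

theorem measurableSet_goesTo (i : Fin b) :
    MeasurableSet {q : (Fin b → ℝ) × unitInterval | GoesTo q.1 q.2 i} := by
  have h1 (S : Finset (Fin b)) :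
      Measurable fun q : (Fin b → ℝ) × unitInterval => ∑ j ∈ S, q.1 j :=
    Finset.measurable_fun_sum _ fun j _ => (measurable_pi_apply j).comp measurable_fst
  have h2 : Measurable fun q : (Fin b → ℝ) × unitInterval => (q.2 : ℝ) :=
    measurable_subtype_coe.comp measurable_snd
  exact (measurableSet_le (h1 _) h2).inter (measurableSet_lt h2 (h1 _))

theorem volume_goesTo {v : Fin b → ℝ} (h0 : ∀ i, 0 ≤ v i) (h1 : ∑ i, v i ≤ 1) (i : Fin b) :
    volume.real {x : unitInterval | GoesTo v x i} = v i := by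
  set p := ∑ j ∈ Finset.Iio i, v j with hp
  have hq : ∑ j ∈ Finset.Iic i, v j = p + v i := by
    rw [← Finset.Iio_insert, Finset.sum_insert (by simp), add_comm]
  have hp0 : 0 ≤ p := Finset.sum_nonneg fun j _ => h0 j
  have hq1 : p + v i ≤ 1 := by
    rw [← hq]; exact (Finset.sum_le_univ_sum_of_nonneg h0).trans h1
  have hset : {x : unitInterval | GoesTo v x i} = Subtype.val ⁻¹' (Set.Ico p (p + v i)) := by
    ext x; simp [GoesTo, hq, hp]
  have hsub : Set.Ico p (p + v i) ⊆ unitInterval := fun x hx =>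
    ⟨hp0.trans hx.1, hx.2.le.trans hq1⟩
  rw [hset, measureReal_def, unitInterval.volume_apply, Subtype.image_preimage_coe,
    Set.inter_eq_right.2 hsub, Real.volume_Ico,
    add_sub_cancel_left, ENNReal.toReal_ofReal (h0 i)]

open Classical in
/-- The number of the first `m` balls that go to child `i`. -/
noncomputable def sentCount (m : ℕ) (q : NodeData b) (i : Fin b) : ℕ :=
  ((Finset.range m).filter fun k => GoesTo q.1 (q.2 k) i).card

theorem sentCount_le (m : ℕ) (q : NodeData b) (i : Fin b) : sentCount m q i ≤ m := by
  classical
  unfold sentCount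
  exact (Finset.card_filter_le _ _).trans (by simp)

theorem sentCount_eq_sum (m : ℕ) (q : NodeData b) (i : Fin b) : sentCount m q i =
    ∑ k ∈ Finset.range m, Set.indicator {q : (Fin b → ℝ) × unitInterval | GoesTo q.1 q.2 i}
      (fun _ => 1) (q.1, q.2 k) := by
  classical
  rw [sentCount, Finset.card_filter]
  refine Finset.sum_congr rfl fun k _ => ?_
  simp [Set.indicator_apply]

theorem measurable_sentCount (m : ℕ) (i : Fin b) :
    Measurable fun q : NodeData b => sentCount m q i := by
  simp_rw [sentCount_eq_sum]
  refine Finset.measurable_fun_sum _ fun k _ => ?_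
  exact (measurable_const.indicator (measurableSet_goesTo i)).comp
    (measurable_fst.prodMk ((measurable_pi_apply k).comp measurable_snd))

theorem sentCount_succ (m : ℕ) (v : Fin b → ℝ) (x : ℕ → unitInterval) (i : Fin b) :
    sentCount (m + 1) (v, x) i =
      sentCount m (v, fun k => x (k + 1)) i +
        Set.indicator {y : unitInterval | GoesTo v y i} (fun _ => 1) (x 0) := by
  rw [sentCount_eq_sum, sentCount_eq_sum, Finset.sum_range_succ']
  rfl

theorem childCount_of_lt {s s₀ s₁ n : ℕ} (h : s < n) (q : NodeData b) (i : Fin b) :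
    childCount s s₀ s₁ n q i = sentCount (n - s₀ - b * s₁) q i + s₁ := by
  simp [childCount, h.not_ge, sentCount]

theorem childCount_of_le {s s₀ s₁ n : ℕ} (h : n ≤ s) (q : NodeData b) (i : Fin b) :
    childCount s s₀ s₁ n q i = 0 := by
  simp [childCount, h]

theorem measurable_childCount (s s₀ s₁ n : ℕ) (i : Fin b) :
    Measurable fun q : NodeData b => childCount s s₀ s₁ n q i := by
  rcases le_or_gt n s with h | h
  · simp_rw [childCount_of_le h]; exact measurable_const
  · simp_rw [childCount_of_lt h]; exact (measurable_sentCount _ i).add_const _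

/-- Induction on the number of balls: ball 0 is independent of the shifted sequence that drives the
others, which is how `binomMean` peels off one trial. -/
theorem integral_sentCount {v : Fin b → ℝ} (h0 : ∀ i, 0 ≤ v i) (h1 : ∑ i, v i ≤ 1) (i : Fin b)
    (m : ℕ) (g : ℕ → ℝ) :
    ∫ x, g (sentCount m (v, x) i)
      ∂(Measure.infinitePi fun _ : ℕ => (volume : Measure unitInterval)) =
      binomMean m (v i) g := by
  induction m generalizing g with
  | zero => simp [sentCount, binomMean]
  | succ m ih =>
    set U := Measure.infinitePi fun _ : ℕ => (volume : Measure unitInterval)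
    have hmp := measurePreserving_infinitePi_prodMk (volume : Measure unitInterval) 0
      (fun k : ℕ => k + 1) (fun _ _ h => by simpa using h) (fun k => by simp)
    have hN : Measurable fun x : ℕ → unitInterval => sentCount m (v, x) i :=
      (measurable_sentCount m i).comp (measurable_const.prodMk measurable_id)
    have hS : MeasurableSet {y : unitInterval | GoesTo v y i} :=
      (measurableSet_goesTo i).preimage (measurable_const.prodMk measurable_id)
    have hI : Measurable (Set.indicator {y : unitInterval | GoesTo v y i} (fun _ => (1 : ℕ))) :=
      measurable_const.indicator hS
    have hle (y : unitInterval) :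
        Set.indicator {y : unitInterval | GoesTo v y i} (fun _ => (1 : ℕ)) y ≤ 1 :=
      Set.indicator_le_self _ _ _
    have hM : Measurable fun q : unitInterval × (ℕ → unitInterval) =>
        sentCount m (v, q.2) i +
          Set.indicator {y : unitInterval | GoesTo v y i} (fun _ => (1 : ℕ)) q.1 :=
      (hN.comp measurable_snd).add (hI.comp measurable_fst)
    have hMle (q : unitInterval × (ℕ → unitInterval)) : sentCount m (v, q.2) i +
        Set.indicator {y : unitInterval | GoesTo v y i} (fun _ => (1 : ℕ)) q.1 ≤ m + 1 :=
      add_le_add (sentCount_le _ _ _) (hle _)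
    calc ∫ x, g (sentCount (m + 1) (v, x) i) ∂U
        = ∫ x, (fun q : unitInterval × (ℕ → unitInterval) => g (sentCount m (v, q.2) i +
            Set.indicator {y : unitInterval | GoesTo v y i} (fun _ => (1 : ℕ)) q.1))
              (x 0, fun k => x (k + 1)) ∂U := by simp_rw [sentCount_succ]
      _ = ∫ q, g (sentCount m (v, q.2) i +
            Set.indicator {y : unitInterval | GoesTo v y i} (fun _ => (1 : ℕ)) q.1)
              ∂((volume : Measure unitInterval).prod U) := by
          rw [← hmp.map_eq, integral_map hmp.measurable.aemeasurable]
          exact ((measurable_from_nat (f := g)).comp hM).aestronglyMeasurable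
      _ = ∫ y, ∫ x, g (sentCount m (v, x) i +
            Set.indicator {y : unitInterval | GoesTo v y i} (fun _ => (1 : ℕ)) y) ∂U := by
          rw [integral_prod]
          exact integrable_comp_nat_of_le hM hMle g
      _ = ∫ y, (binomMean m (v i) g + Set.indicator {y : unitInterval | GoesTo v y i}
            (fun _ => binomMean m (v i) (fun j => g (j + 1)) - binomMean m (v i) g) y) := by
          congr 1 with y
          rw [ih fun j => g (j + _)]
          by_cases hy : GoesTo v y i <;> simp [hy]
      _ = _ := by
          rw [integral_add (integrable_const _) ((integrable_const _).indicator hS),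
            integral_indicator_const _ hS, volume_goesTo h0 h1]
          simp [binomMean]; ring

/-- The mean of `g` over the number of balls sent to child `i`, at a node that is split. -/
theorem integral_childCount {ν : Measure (Fin b → ℝ)} [IsProbabilityMeasure ν]
    (hν : IsSubstochastic ν) {s s₀ s₁ n : ℕ} (h : s < n) (i : Fin b) (g : ℕ → ℝ) :
    ∫ q, g (childCount s s₀ s₁ n q i)
      ∂(ν.prod (Measure.infinitePi fun _ : ℕ => (volume : Measure unitInterval))) =
      ∫ v, binomMean (n - s₀ - b * s₁) (v i) (fun j => g (j + s₁)) ∂ν := by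
  simp_rw [childCount_of_lt h]
  rw [integral_prod _ (integrable_comp_nat_of_le (measurable_sentCount _ i)
    (fun q => sentCount_le _ q i) fun j => g (j + s₁))]
  refine integral_congr_ae ?_
  filter_upwards [hν] with v hv
  exact integral_sentCount hv.1 hv.2 i _ fun j => g (j + s₁)

end law

end SplitTree

/-! ### Binomial means -/

namespace SplitTree

section binomial

variable {m k : ℕ} {p : ℝ} {g h : ℕ → ℝ}

theorem binomMean_add (m : ℕ) (p : ℝ) (g h : ℕ → ℝ) :
    binomMean m p (fun j => g j + h j) = binomMean m p g + binomMean m p h := by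
  induction m generalizing g h with
  | zero => rfl
  | succ m ih => simp only [binomMean, ih]; ring

theorem binomMean_const_mul (m : ℕ) (p c : ℝ) (g : ℕ → ℝ) :
    binomMean m p (fun j => c * g j) = c * binomMean m p g := by
  induction m generalizing g with
  | zero => rfl
  | succ m ih => simp only [binomMean, ih]; ring

theorem binomMean_const (m : ℕ) (p c : ℝ) : binomMean m p (fun _ => c) = c := by
  induction m with
  | zero => rfl
  | succ m ih => simp only [binomMean, ih]; ring

theorem binomMean_sub (m : ℕ) (p : ℝ) (g h : ℕ → ℝ) :
    binomMean m p (fun j => g j - h j) = binomMean m p g - binomMean m p h := by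
  have := binomMean_add m p g (fun j => -1 * h j)
  rw [binomMean_const_mul] at this
  simpa [sub_eq_add_neg] using this

theorem binomMean_mono (hp : 0 ≤ p) (hp1 : p ≤ 1) (hgh : ∀ j ≤ m, g j ≤ h j) :
    binomMean m p g ≤ binomMean m p h := by
  induction m generalizing g h with
  | zero => exact hgh 0 le_rfl
  | succ m ih =>
    simp only [binomMean]
    exact add_le_add
      (mul_le_mul_of_nonneg_left (ih fun j hj => hgh _ (by omega)) hp)
      (mul_le_mul_of_nonneg_left (ih fun j hj => hgh _ (by omega)) (by linarith))

theorem binomMean_nonneg (hp : 0 ≤ p) (hp1 : p ≤ 1) (hg : ∀ j ≤ m, 0 ≤ g j) :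
    0 ≤ binomMean m p g := by
  simpa [binomMean_const] using binomMean_mono hp hp1 (g := fun _ => 0) hg

theorem abs_binomMean_le (hp : 0 ≤ p) (hp1 : p ≤ 1) :
    |binomMean m p g| ≤ binomMean m p (fun j => |g j|) := by
  refine abs_le.2 ⟨?_, binomMean_mono hp hp1 fun j _ => le_abs_self _⟩
  have := binomMean_mono (m := m) hp hp1 (g := fun j => -1 * |g j|) (h := g)
    fun j _ => by linarith [neg_abs_le (g j)]
  rw [binomMean_const_mul] at this
  linarith

theorem abs_binomMean_le_sum (hp : 0 ≤ p) (hp1 : p ≤ 1) :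
    |binomMean m p g| ≤ ∑ j ∈ Finset.range (m + 1), |g j| := by
  refine (abs_binomMean_le hp hp1).trans ?_
  rw [← binomMean_const m p (∑ j ∈ Finset.range (m + 1), |g j|)]
  exact binomMean_mono hp hp1 fun j hj => Finset.single_le_sum (f := fun j => |g j|)
    (fun _ _ => abs_nonneg _) (Finset.mem_range.2 (by omega))

theorem binomMean_zero (m : ℕ) (g : ℕ → ℝ) : binomMean m 0 g = g 0 := by
  induction m with
  | zero => rfl
  | succ m ih => simp [binomMean, ih]

theorem binomMean_id (m : ℕ) (p : ℝ) : binomMean m p (fun j => (j : ℝ)) = m * p := by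
  induction m with
  | zero => simp [binomMean]
  | succ m ih =>
    simp only [binomMean, Nat.cast_add, Nat.cast_one]
    rw [binomMean_add, ih, binomMean_const]; ring

theorem binomMean_sq_sub (m : ℕ) (p a : ℝ) :
    binomMean m p (fun j => ((j : ℝ) - a) ^ 2) = m * p * (1 - p) + (m * p - a) ^ 2 := by
  induction m generalizing a with
  | zero => simp [binomMean]
  | succ m ih =>
    have h1 : (fun j : ℕ => (((j + 1 : ℕ) : ℝ) - a) ^ 2) =
        fun j : ℕ => ((j : ℝ) - (a - 1)) ^ 2 := by
      ext j; push_cast; ring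
    simp only [binomMean]
    rw [h1, ih, ih]; push_cast; ring

/-- A binomial variable with `m + k` trials is the sum of two independent binomial variables. -/
theorem binomMean_add_trials (m k : ℕ) (p : ℝ) (g : ℕ → ℝ) :
    binomMean (m + k) p g = binomMean m p fun j => binomMean k p fun l => g (j + l) := by
  induction m generalizing g with
  | zero => simp [binomMean]
  | succ m ih =>
    rw [show m + 1 + k = m + k + 1 by ring]
    simp only [binomMean]
    rw [ih, ih]
    simp only [add_right_comm]

/-- Only the event that all trials succeed can contribute positively. The bound keeps that top term
exact, as is needed when a child may inherit every ball. -/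
theorem binomMean_le_pow_mul (hp : 0 ≤ p) (hp1 : p ≤ 1) (hg : ∀ j < m, g j ≤ 0) :
    binomMean m p g ≤ p ^ m * g m := by
  induction m generalizing g with
  | zero => simp [binomMean]
  | succ m ih =>
    have h1 := ih (g := fun j => g (j + 1)) fun j hj => hg _ (by omega)
    have h2 : binomMean m p g ≤ 0 := by
      simpa [binomMean_const] using
        binomMean_mono hp hp1 (g := g) (h := fun _ => 0) fun j hj => hg j (by omega)
    have h3 := mul_le_mul_of_nonneg_left h1 hp
    have h4 := mul_nonneg_of_nonpos_of_nonpos h2 (show p - 1 ≤ 0 by linarith)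
    simp only [binomMean, pow_succ]
    nlinarith

theorem binomMean_pos (hp : 0 < p) (hp1 : p < 1) (hg : ∀ j, 0 ≤ g j) {j : ℕ} (hj : j ≤ m)
    (hgj : 0 < g j) : 0 < binomMean m p g := by
  induction m generalizing g j with
  | zero => obtain rfl : j = 0 := by omega
            exact hgj
  | succ m ih =>
    have hq : 0 < 1 - p := by linarith
    have h1 := binomMean_nonneg (m := m) hp.le hp1.le (fun j _ => hg (j + 1))
    have h2 := binomMean_nonneg (m := m) hp.le hp1.le (fun j _ => hg j)
    simp only [binomMean]
    rcases j with _ | j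
    · have := mul_pos hq (ih hg (j := 0) (by omega) hgj)
      have := mul_nonneg hp.le h1
      linarith
    · have := mul_pos hp (ih (g := fun j => g (j + 1)) (fun j => hg _) (j := j) (by omega) hgj)
      have := mul_nonneg hq.le h2
      linarith

theorem continuous_binomMean (m : ℕ) (g : ℕ → ℝ) : Continuous fun p => binomMean m p g := by
  induction m generalizing g with
  | zero => exact continuous_const
  | succ m ih =>
    simp only [binomMean]
    exact (continuous_id.mul (ih _)).add ((continuous_const.sub continuous_id).mul (ih _))

/-- Concavity, in the form of Bernoulli's inequality at x / y. -/
theorem rpow_le_tangent {γ x y : ℝ} (h0 : 0 < γ) (h1 : γ ≤ 1) (hx : 0 ≤ x) (hy : 0 < y) :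
    x ^ γ ≤ y ^ γ + γ * y ^ (γ - 1) * (x - y) := by
  have h2 := rpow_one_add_le_one_add_mul_self (s := x / y - 1)
    (by have := div_nonneg hx hy.le; linarith) h0.le h1
  rw [add_sub_cancel, Real.div_rpow hx hy.le, div_le_iff₀ (Real.rpow_pos_of_pos hy _)] at h2
  refine h2.trans_eq ?_
  rw [Real.rpow_sub_one hy.ne']
  field_simp

/-- Jensen's inequality for the power function. -/
theorem binomMean_rpow_le {γ y : ℝ} (h0 : 0 < γ) (h1 : γ ≤ 1) (hp : 0 ≤ p) (hp1 : p ≤ 1)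
    (hg : ∀ j ≤ m, 0 ≤ g j) (hy : 0 < y) (hgy : binomMean m p g ≤ y) :
    binomMean m p (fun j => g j ^ γ) ≤ y ^ γ := by
  have h2 : binomMean m p (fun j => g j ^ γ) ≤
      binomMean m p fun j => y ^ γ + γ * y ^ (γ - 1) * (g j - y) :=
    binomMean_mono hp hp1 fun j hj => rpow_le_tangent h0 h1 (hg j hj) hy
  rw [binomMean_add, binomMean_const_mul, binomMean_sub, binomMean_const, binomMean_const] at h2
  have h3 : 0 ≤ γ * y ^ (γ - 1) := by positivity
  nlinarith

theorem binomMean_natCast_rpow_le {γ : ℝ} (h0 : 0 < γ) (h1 : γ ≤ 1) (hp : 0 ≤ p) (hp1 : p ≤ 1) :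
    binomMean m p (fun j => (j : ℝ) ^ γ) ≤ (m : ℝ) ^ γ * p ^ γ := by
  rw [← Real.mul_rpow (Nat.cast_nonneg m) hp]
  rcases hp.eq_or_lt with rfl | hp'
  · simp [binomMean_zero]
  rcases Nat.eq_zero_or_pos m with rfl | hm
  · simp [binomMean]
  · exact binomMean_rpow_le h0 h1 hp hp1 (fun j _ => Nat.cast_nonneg j) (by positivity)
      (binomMean_id m p).le

/-- Jensen with exponent γ / 2 applied to the squared deviation, which is variance plus squared
bias. This is the source of all error terms n^(γ/2) below. -/
theorem binomMean_abs_sub_rpow_le {γ a y : ℝ} (h0 : 0 < γ) (h1 : γ ≤ 1) (hp : 0 ≤ p)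
    (hp1 : p ≤ 1) (hy : 0 < y) (hay : m * p * (1 - p) + (m * p - a) ^ 2 ≤ y) :
    binomMean m p (fun j => |(j : ℝ) - a| ^ γ) ≤ y ^ (γ / 2) := by
  have h2 := binomMean_rpow_le (m := m) (g := fun j => ((j : ℝ) - a) ^ 2) (half_pos h0)
    (by linarith) hp hp1 (fun j _ => sq_nonneg _) hy ((binomMean_sq_sub m p a).trans_le hay)
  convert h2 using 3 with j
  rw [← sq_abs, ← Real.rpow_natCast, ← Real.rpow_mul (abs_nonneg _)]
  congr 1; push_cast; ring

end binomial

end SplitTree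

/-! ### Moments of the split vector -/

namespace SplitTree

section moments

variable {b : ℕ} {ν : Measure (Fin b → ℝ)} [IsProbabilityMeasure ν]

/-- The split vector has an entry in `(0, 1)` with positive probability. -/
def IsNondegenerate (ν : Measure (Fin b → ℝ)) : Prop :=
  ¬ ∀ᵐ v ∂ν, ∀ i, v i = 0 ∨ v i = 1

theorem IsSubstochastic.le_one {v : Fin b → ℝ} (hv : (∀ i, 0 ≤ v i) ∧ ∑ i, v i ≤ 1) (i : Fin b) :
    v i ≤ 1 :=
  (Finset.single_le_sum (fun j _ => hv.1 j) (Finset.mem_univ i)).trans hv.2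

/-- If all entries were 0 or 1 and summed to 1, some entry would equal 1 almost surely. -/
theorem IsSplitVector.isNondegenerate (hν : IsSplitVector ν) : IsNondegenerate ν := by
  intro h
  refine hν.2.2.1.not_ge ?_
  rw [← measure_univ (μ := ν)]
  refine measure_mono_ae ?_
  filter_upwards [h, hν.2.1] with v hv hv1 _
  by_contra! hne
  have h0 : ∀ i, v i = 0 := fun i => (hv i).resolve_right fun h => hne ⟨i, h⟩
  simp [h0] at hv1

/-- For entries in {0, 1}, P(V_i > 0) = E V_i, so the probabilities would sum to at most 1. -/
theorem IsFractionalSplitVector.isNondegenerate (hν : IsFractionalSplitVector ν) :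
    IsNondegenerate ν := by
  intro h
  have h1 (i : Fin b) : ν {v | 0 < v i} = ENNReal.ofReal (∫ v, v i ∂ν) := by
    have h2 : ∫ v, v i ∂ν = ν.real {v | 0 < v i} := by
      rw [← integral_indicator_one (measurableSet_lt measurable_const (measurable_pi_apply i))]
      refine integral_congr_ae ?_
      filter_upwards [h] with v hv
      rcases hv i with h | h <;> simp [h]
    rw [h2, ofReal_measureReal]
  have h3 (i : Fin b) : Integrable (fun v => v i) ν := by
    refine Integrable.of_bound (measurable_pi_apply i).aestronglyMeasurable 1 ?_
    filter_upwards [hν.1] with v hv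
    rw [Real.norm_of_nonneg (hv.1 i)]; exact IsSubstochastic.le_one hv i
  have h4 : ∑ i, ∫ v, v i ∂ν ≤ 1 := by
    rw [← integral_finsetSum _ fun i _ => h3 i]
    calc _ ≤ ∫ _, (1 : ℝ) ∂ν := integral_mono_ae (integrable_finsetSum _ fun i _ => h3 i)
            (integrable_const _) (by filter_upwards [hν.1] with v hv using hv.2)
      _ = 1 := by simp
  refine hν.2.not_ge ?_
  simp_rw [h1]
  rw [← ENNReal.ofReal_sum_of_nonneg]
  · simpa using h4
  · intro i _
    exact integral_nonneg_of_ae (by filter_upwards [hν.1] with v hv using hv.1 i)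

/-- `E ∑ i, V_i ^ γ`. -/
noncomputable def moment (ν : Measure (Fin b → ℝ)) (γ : ℝ) : ℝ := ∫ v, ∑ i, v i ^ γ ∂ν

theorem integrable_rpow (hν : IsSubstochastic ν) {γ : ℝ} (hγ : 0 ≤ γ) (i : Fin b) :
    Integrable (fun v => v i ^ γ) ν := by
  refine Integrable.of_bound ((measurable_pi_apply i).pow_const γ).aestronglyMeasurable 1 ?_
  filter_upwards [hν] with v hv
  rw [Real.norm_of_nonneg (Real.rpow_nonneg (hv.1 i) _)]
  exact Real.rpow_le_one (hv.1 i) (IsSubstochastic.le_one hv i) hγ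

theorem integrable_sum_rpow (hν : IsSubstochastic ν) {γ : ℝ} (hγ : 0 ≤ γ) :
    Integrable (fun v => ∑ i, v i ^ γ) ν :=
  integrable_finsetSum _ fun i _ => integrable_rpow hν hγ i

/-- On [0, 1] one has x^γ' ≤ x^γ, with equality only at 0 and 1; nondegeneracy excludes almost sure
equality. Positivity of γ makes the powers agree at 0. -/
theorem moment_lt (hν : IsSubstochastic ν) (hd : IsNondegenerate ν) {γ γ' : ℝ} (h0 : 0 < γ)
    (h : γ < γ') : moment ν γ' < moment ν γ := by
  by_contra! hle
  refine hd ?_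
  have hle' {v : Fin b → ℝ} (hv : (∀ i, 0 ≤ v i) ∧ ∑ i, v i ≤ 1) (i : Fin b) :
      v i ^ γ' ≤ v i ^ γ :=
    Real.rpow_le_rpow_of_exponent_ge_of_imp (hv.1 i) (IsSubstochastic.le_one hv i) h.le
      (fun _ h' => absurd h' (h0.trans h).ne')
  have h1 := integrable_sum_rpow hν h0.le
  have h2 := integrable_sum_rpow hν (h0.trans h).le
  have hnn : 0 ≤ᵐ[ν] fun v => ∑ i, v i ^ γ - ∑ i, v i ^ γ' := by
    filter_upwards [hν] with v hv
    exact sub_nonneg.2 (Finset.sum_le_sum fun i _ => hle' hv i)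
  have hz : ∫ v, (∑ i, v i ^ γ - ∑ i, v i ^ γ') ∂ν = 0 := by
    refine le_antisymm ?_ (integral_nonneg_of_ae hnn)
    rw [integral_sub h1 h2]
    exact sub_nonpos.2 hle
  filter_upwards [(integral_eq_zero_iff_of_nonneg_ae hnn (h1.sub h2)).1 hz, hν] with v hv hv' i
  have hi := (Finset.sum_eq_sum_iff_of_le fun i _ => hle' hv' i).1
    (sub_eq_zero.1 hv).symm i (Finset.mem_univ i)
  by_contra! hne
  have h1 := (hv'.1 i).lt_of_ne' hne.1
  exact (Real.rpow_lt_rpow_of_exponent_gt h1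
    ((IsSubstochastic.le_one hv' i).lt_of_ne hne.2) h).ne hi

/-- The mean of `∑ i, g (N_i)`, where given the split vector `N_i` is binomial with `m` trials and
success probability `V_i`. -/
noncomputable def splitMean (ν : Measure (Fin b → ℝ)) (m : ℕ) (g : ℕ → ℝ) : ℝ :=
  ∫ v, ∑ i, binomMean m (v i) g ∂ν

variable {m : ℕ} {g h : ℕ → ℝ}

theorem integrable_binomMean (hν : IsSubstochastic ν) (m : ℕ) (g : ℕ → ℝ) (i : Fin b) :
    Integrable (fun v => binomMean m (v i) g) ν := by
  refine Integrable.of_bound ((continuous_binomMean m g).measurable.comp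
    (measurable_pi_apply i)).aestronglyMeasurable (∑ j ∈ Finset.range (m + 1), |g j|) ?_
  filter_upwards [hν] with v hv
  exact abs_binomMean_le_sum (hv.1 i) (IsSubstochastic.le_one hv i)

theorem integrable_sum_binomMean (hν : IsSubstochastic ν) (m : ℕ) (g : ℕ → ℝ) :
    Integrable (fun v => ∑ i, binomMean m (v i) g) ν :=
  integrable_finsetSum _ fun i _ => integrable_binomMean hν m g i

theorem splitMean_add (hν : IsSubstochastic ν) (m : ℕ) (g h : ℕ → ℝ) :
    splitMean ν m (fun j => g j + h j) = splitMean ν m g + splitMean ν m h := by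
  simp only [splitMean, binomMean_add, Finset.sum_add_distrib]
  exact integral_add (integrable_sum_binomMean hν m g) (integrable_sum_binomMean hν m h)

theorem splitMean_sub (hν : IsSubstochastic ν) (m : ℕ) (g h : ℕ → ℝ) :
    splitMean ν m (fun j => g j - h j) = splitMean ν m g - splitMean ν m h := by
  simp only [splitMean, binomMean_sub, Finset.sum_sub_distrib]
  exact integral_sub (integrable_sum_binomMean hν m g) (integrable_sum_binomMean hν m h)

theorem splitMean_const_mul (ν : Measure (Fin b → ℝ)) (m : ℕ) (c : ℝ) (g : ℕ → ℝ) :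
    splitMean ν m (fun j => c * g j) = c * splitMean ν m g := by
  simp only [splitMean, binomMean_const_mul, ← Finset.mul_sum]
  exact integral_const_mul c _

theorem splitMean_mono (hν : IsSubstochastic ν) (hgh : ∀ j ≤ m, g j ≤ h j) :
    splitMean ν m g ≤ splitMean ν m h := by
  refine integral_mono_ae (integrable_sum_binomMean hν m g) (integrable_sum_binomMean hν m h) ?_
  filter_upwards [hν] with v hv
  exact Finset.sum_le_sum fun i _ =>
    binomMean_mono (hv.1 i) (IsSubstochastic.le_one hv i) hgh

theorem splitMean_const (ν : Measure (Fin b → ℝ)) [IsProbabilityMeasure ν] (m : ℕ) (c : ℝ) :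
    splitMean ν m (fun _ => c) = b * c := by
  simp [splitMean, binomMean_const]

/-- `moment ν m` is the expected number of children that receive all m distributed balls. -/
theorem splitMean_le_moment_mul (hν : IsSubstochastic ν) (hg : ∀ j < m, g j ≤ 0) :
    splitMean ν m g ≤ moment ν m * g m := by
  rw [moment, ← integral_mul_const]
  refine integral_mono_ae (integrable_sum_binomMean hν m g)
    ((integrable_sum_rpow hν (Nat.cast_nonneg m)).mul_const _) ?_
  filter_upwards [hν] with v hv
  simp only [Finset.sum_mul, Real.rpow_natCast]
  exact Finset.sum_le_sum fun i _ =>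
    binomMean_le_pow_mul (hv.1 i) (IsSubstochastic.le_one hv i) hg

end moments

theorem abs_rpow_sub_rpow_le {γ x y : ℝ} (h0 : 0 < γ) (h1 : γ ≤ 1) (hx : 0 ≤ x) (hy : 0 ≤ y) :
    |x ^ γ - y ^ γ| ≤ |x - y| ^ γ := by
  wlog hxy : y ≤ x generalizing x y
  · rw [abs_sub_comm, abs_sub_comm x]; exact this hy hx (le_of_not_ge hxy)
  have h2 := Real.rpow_add_le_add_rpow (sub_nonneg.2 hxy) hy h0.le h1
  rw [sub_add_cancel] at h2
  rw [abs_of_nonneg (sub_nonneg.2 (Real.rpow_le_rpow hy hxy h0.le)),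
    abs_of_nonneg (sub_nonneg.2 hxy)]
  linarith

end SplitTree

/-! ### The recursion: comparison principle and growth of solutions -/

namespace SplitTree

theorem eventually_mul_rpow_le (C : ℝ) {x y ε : ℝ} (h : x < y) (hε : 0 < ε) :
    ∀ᶠ n : ℕ in atTop, C * (n : ℝ) ^ x ≤ ε * (n : ℝ) ^ y := by
  have h1 := ((tendsto_rpow_neg_atTop (sub_pos.2 h)).const_mul C).comp
    (tendsto_natCast_atTop_atTop (R := ℝ))
  rw [mul_zero] at h1
  filter_upwards [h1.eventually_lt_const hε, eventually_ge_atTop 1] with n hn h1n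
  have hn0 : (0 : ℝ) < n := by exact_mod_cast h1n
  have h2 : (n : ℝ) ^ x = (n : ℝ) ^ (-(y - x)) * (n : ℝ) ^ y := by
    rw [← Real.rpow_add hn0]; ring_nf
  rw [h2, ← mul_assoc]
  exact mul_le_mul_of_nonneg_right hn.le (by positivity)

variable {b : ℕ} {s s₀ s₁ : ℕ} {ν : Measure (Fin b → ℝ)} [IsProbabilityMeasure ν] {β : ℝ}

/-- The assumptions on the parameters of a (fractional) split tree that the analysis uses. -/
structure IsAdmissible (s s₀ s₁ : ℕ) (ν : Measure (Fin b → ℝ)) (β : ℝ) : Prop where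
  two_le : 2 ≤ b
  one_le : 1 ≤ s
  le_succ : b * s₁ + s₀ ≤ s + 1
  sub : IsSubstochastic ν
  nondeg : IsNondegenerate ν
  pos : 0 < β
  le_one : β ≤ 1
  moment_eq : moment ν β = 1

/-- The mean of `∑ i, g (N_i)`, where the `N_i` are the numbers of balls of the children of a node
with `n > s` balls. -/
noncomputable def offspringMean (s₀ s₁ : ℕ) (ν : Measure (Fin b → ℝ)) (g : ℕ → ℝ) (n : ℕ) : ℝ :=
  splitMean ν (n - s₀ - b * s₁) fun j => g (j + s₁)

/-- The recursion satisfied by the means of an additive functional with toll means `a`. -/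
structure IsSolution (s s₀ s₁ : ℕ) (ν : Measure (Fin b → ℝ)) (a f : ℕ → ℝ) : Prop where
  zero : f 0 = 0
  of_le : ∀ n, 1 ≤ n → n ≤ s → f n = a n
  of_lt : ∀ n, s < n → f n = a n + offspringMean s₀ s₁ ν f n

namespace IsAdmissible

variable {g h : ℕ → ℝ} {n : ℕ}

/-- A child has fewer balls than its parent unless s₀ = s₁ = 0, because b ≥ 2 and no subtraction is
truncated. In the exceptional case the recursion has a diagonal term and is not explicit. -/
theorem trials_add (H : IsAdmissible s s₀ s₁ ν β) (hn : s < n) :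
    n - s₀ - b * s₁ + s₁ < n ∨ n - s₀ - b * s₁ = n ∧ s₁ = 0 := by
  have h1 := H.le_succ
  have h2 := Nat.mul_le_mul_right s₁ H.two_le
  generalize b * s₁ = q at *
  omega

theorem trials_add_le (H : IsAdmissible s s₀ s₁ ν β) (hn : s < n) :
    n - s₀ - b * s₁ + s₁ ≤ n := by
  rcases H.trials_add hn with h | h <;> omega

theorem cast_trials (H : IsAdmissible s s₀ s₁ ν β) (hn : s < n) :
    ((n - s₀ - b * s₁ : ℕ) : ℝ) = n - (s₀ + b * s₁) := by
  have h1 := H.le_succ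
  rw [Nat.sub_sub, Nat.cast_sub (by omega)]
  push_cast; ring

/-- The coefficient of the diagonal term. Since s ≥ 1, a split node has n ≥ 2 > β balls. -/
theorem moment_natCast_lt_one (H : IsAdmissible s s₀ s₁ ν β) (hn : s < n) : moment ν n < 1 := by
  rw [← H.moment_eq]
  refine moment_lt H.sub H.nondeg H.pos (H.le_one.trans_lt ?_)
  have := H.one_le
  exact_mod_cast (by omega : 1 < n)

theorem offspringMean_mono (H : IsAdmissible s s₀ s₁ ν β) (hgh : ∀ k, g k ≤ h k) :
    offspringMean s₀ s₁ ν g n ≤ offspringMean s₀ s₁ ν h n :=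
  splitMean_mono H.sub fun _ _ => hgh _

/-- The comparison principle. -/
theorem nonpos_of_le_offspringMean (H : IsAdmissible s s₀ s₁ ν β) {u : ℕ → ℝ} {n₀ : ℕ}
    (hn₀ : s < n₀) (h0 : ∀ n < n₀, u n ≤ 0)
    (hu : ∀ n, n₀ ≤ n → u n ≤ offspringMean s₀ s₁ ν u n) (n : ℕ) : u n ≤ 0 := by
  induction n using Nat.strong_induction_on with
  | _ n ih =>
  rcases lt_or_ge n n₀ with hn | hn
  · exact h0 n hn
  have hsn := hn₀.trans_le hn
  have h1 := H.trials_add_le hsn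
  have h2 := (hu n hn).trans (splitMean_le_moment_mul H.sub (g := fun j => u (j + s₁))
    fun j hj => ih _ (by omega))
  rcases H.trials_add hsn with h3 | ⟨h3, h4⟩
  · refine h2.trans (mul_nonpos_of_nonneg_of_nonpos ?_ (ih _ h3))
    refine integral_nonneg_of_ae ?_
    filter_upwards [H.sub] with v hv
    exact Finset.sum_nonneg fun i _ => Real.rpow_nonneg (hv.1 i) _
  -- No ball is held back, so u n reappears on the right with a coefficient below 1, which is
  -- incompatible with u n > 0.
  · subst h4
    simp only [add_zero, h3] at h2
    have h5 := H.moment_natCast_lt_one hsn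
    by_contra! h6
    nlinarith

/-- The variance is at most n, and the retained and guaranteed balls shift the mean by at most c =
s₀ + b s₁. Hence the mean squared distance from n p is at most (1 + c²) n, uniformly in p. -/
theorem exists_binomMean_abs_sub_le (H : IsAdmissible s s₀ s₁ ν β) {γ : ℝ} (h0 : 0 < γ)
    (h1 : γ ≤ 1) : ∃ C, 0 ≤ C ∧ ∀ n, s < n → ∀ p : ℝ, 0 ≤ p → p ≤ 1 →
      binomMean (n - s₀ - b * s₁) p (fun j => |((j + s₁ : ℕ) : ℝ) - n * p| ^ γ) ≤
        C * (n : ℝ) ^ (γ / 2) := by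
  set c : ℝ := s₀ + b * s₁ with hc
  have hc0 : 0 ≤ c := by positivity
  refine ⟨(1 + c ^ 2) ^ (γ / 2), by positivity, fun n hn p hp hp1 => ?_⟩
  have hn1 : (1 : ℝ) ≤ n := by exact_mod_cast (by omega : 1 ≤ n)
  rw [← Real.mul_rpow (by positivity) (by positivity)]
  have hs1 : (s₁ : ℝ) ≤ c := by
    have : (2 : ℝ) ≤ b := by exact_mod_cast H.two_le
    have h3 : (0 : ℝ) ≤ s₁ := by positivity
    have h4 : (0 : ℝ) ≤ s₀ := by positivity
    nlinarith
  have h2 := binomMean_abs_sub_rpow_le (m := n - s₀ - b * s₁) (a := n * p - s₁)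
    (y := (1 + c ^ 2) * n) h0 h1 hp hp1 (by positivity) ?_
  · refine (le_of_eq ?_).trans h2
    congr 1; ext j; push_cast; ring_nf
  · rw [H.cast_trials hn, ← hc]
    have h5 : (n : ℝ) - c ≤ n := by linarith
    have h6 : 0 ≤ (n : ℝ) - c := by rw [hc, ← H.cast_trials hn]; positivity
    have h7 : ((n - c) * p - (n * p - s₁)) ^ 2 ≤ c ^ 2 := by
      rw [show (n - c) * p - (n * p - s₁) = s₁ - c * p by ring]
      have h8 : c * p ≤ c := mul_le_of_le_one_right hc0 hp1
      have h9 : 0 ≤ c * p := mul_nonneg hc0 hp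
      have h10 : (0 : ℝ) ≤ s₁ := by positivity
      exact sq_le_sq' (by linarith) (by linarith)
    have h11 : (n - c) * p * (1 - p) ≤ n := by
      have : (n - c) * p ≤ n - c := mul_le_of_le_one_right h6 hp1
      have : (n - c) * p * (1 - p) ≤ (n - c) * p :=
        mul_le_of_le_one_right (mul_nonneg h6 hp) (by linarith)
      linarith
    nlinarith [mul_le_mul_of_nonneg_left hn1 (sq_nonneg c)]

/-- Powers are approximate eigenfunctions with eigenvalue `moment ν γ`: combine the concentration
bound with |x^γ - y^γ| ≤ |x - y|^γ. -/
theorem exists_offspringMean_rpow_bound (H : IsAdmissible s s₀ s₁ ν β) {γ : ℝ} (h0 : 0 < γ)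
    (h1 : γ ≤ 1) : ∃ C, 0 ≤ C ∧ ∀ n, s < n →
      |offspringMean s₀ s₁ ν (fun k => (k : ℝ) ^ γ) n - (n : ℝ) ^ γ * moment ν γ| ≤
        C * (n : ℝ) ^ (γ / 2) := by
  obtain ⟨C, hC, h⟩ := H.exists_binomMean_abs_sub_le h0 h1
  refine ⟨b * C, by positivity, fun n hn => ?_⟩
  rw [offspringMean, splitMean, moment, ← integral_const_mul, ← integral_sub
    (integrable_sum_binomMean H.sub _ _) ((integrable_sum_rpow H.sub h0.le).const_mul _)]
  have h2 := norm_integral_le_of_norm_le_const (μ := ν) (C := b * C * (n : ℝ) ^ (γ / 2))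
    (f := fun v => ∑ i, binomMean (n - s₀ - b * s₁) (v i) (fun j => ((j + s₁ : ℕ) : ℝ) ^ γ) -
      (n : ℝ) ^ γ * ∑ i, v i ^ γ) ?_
  · simpa using h2
  filter_upwards [H.sub] with v hv
  rw [Finset.mul_sum, ← Finset.sum_sub_distrib, Real.norm_eq_abs]
  refine (Finset.abs_sum_le_sum_abs _ _).trans ?_
  have h3 : ∀ i ∈ (Finset.univ : Finset (Fin b)),
      |binomMean (n - s₀ - b * s₁) (v i) (fun j => ((j + s₁ : ℕ) : ℝ) ^ γ) -
        (n : ℝ) ^ γ * v i ^ γ| ≤ C * (n : ℝ) ^ (γ / 2) := by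
    intro i _
    have hv1 := IsSubstochastic.le_one hv i
    refine le_trans ?_ (h n hn (v i) (hv.1 i) hv1)
    rw [← Real.mul_rpow (Nat.cast_nonneg n) (hv.1 i), ← binomMean_const (n - s₀ - b * s₁) (v i)
      ((n * v i) ^ γ), ← binomMean_sub]
    exact (abs_binomMean_le (hv.1 i) hv1).trans (binomMean_mono (hv.1 i) hv1 fun j _ =>
      abs_rpow_sub_rpow_le h0 h1 (Nat.cast_nonneg _) (mul_nonneg (Nat.cast_nonneg n) (hv.1 i)))
  refine (Finset.sum_le_sum h3).trans_eq ?_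
  simp; ring

end IsAdmissible

namespace IsSolution

variable {a a' f f' : ℕ → ℝ}

theorem sub (H : IsAdmissible s s₀ s₁ ν β) (hf : IsSolution s s₀ s₁ ν a f)
    (hf' : IsSolution s s₀ s₁ ν a' f') :
    IsSolution s s₀ s₁ ν (fun n => a n - a' n) (fun n => f n - f' n) where
  zero := by simp [hf.zero, hf'.zero]
  of_le n h1 h2 := by rw [hf.of_le n h1 h2, hf'.of_le n h1 h2]
  of_lt n h := by
    rw [hf.of_lt n h, hf'.of_lt n h, offspringMean, offspringMean, offspringMean,
      splitMean_sub H.sub]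
    ring

theorem const_mul (c : ℝ) (hf : IsSolution s s₀ s₁ ν a f) :
    IsSolution s s₀ s₁ ν (fun n => c * a n) (fun n => c * f n) where
  zero := by simp [hf.zero]
  of_le n h1 h2 := by rw [hf.of_le n h1 h2]
  of_lt n h := by
    rw [hf.of_lt n h, offspringMean, offspringMean, splitMean_const_mul]
    ring

theorem nonpos (H : IsAdmissible s s₀ s₁ ν β) (hf : IsSolution s s₀ s₁ ν a f)
    (ha : ∀ n, 1 ≤ n → a n ≤ 0) (n : ℕ) : f n ≤ 0 := by
  refine H.nonpos_of_le_offspringMean (Nat.lt_succ_self s) (fun n hn => ?_) (fun n hn => ?_) n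
  · rcases Nat.eq_zero_or_pos n with rfl | h1
    · exact hf.zero.le
    · rw [hf.of_le n h1 (by omega)]; exact ha n h1
  · rw [hf.of_lt n hn]
    linarith [ha n (by omega)]

theorem mono (H : IsAdmissible s s₀ s₁ ν β) (hf : IsSolution s s₀ s₁ ν a f)
    (hf' : IsSolution s s₀ s₁ ν a' f') (ha : ∀ n, 1 ≤ n → a n ≤ a' n) (n : ℕ) : f n ≤ f' n :=
  sub_nonpos.1 ((hf.sub H hf').nonpos H (fun n hn => sub_nonpos.2 (ha n hn)) n)

theorem nonneg (H : IsAdmissible s s₀ s₁ ν β) (hf : IsSolution s s₀ s₁ ν a f)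
    (ha : ∀ n, 1 ≤ n → 0 ≤ a n) (n : ℕ) : 0 ≤ f n := by
  have := (hf.const_mul (-1)).nonpos H (fun n hn => by linarith [ha n hn]) n
  linarith

end IsSolution

namespace IsAdmissible

theorem one_lt_moment (H : IsAdmissible s s₀ s₁ ν β) {γ : ℝ} (h0 : 0 < γ) (h : γ < β) :
    1 < moment ν γ := by
  rw [← H.moment_eq]; exact moment_lt H.sub H.nondeg h0 h

/-- A multiple of n^β - n^γ / 2 is a supersolution: since `moment ν γ` > 1, averaging lowers it by a
multiple of n^γ, which pays for the toll. The condition γ > β / 2 makes the concentration error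
n^(β/2) negligible against this gain. -/
theorem exists_solution_rpow_le (H : IsAdmissible s s₀ s₁ ν β) {γ : ℝ} (h0 : β / 2 < γ)
    (h : γ < β) {f : ℕ → ℝ} (hf : IsSolution s s₀ s₁ ν (fun n => (n : ℝ) ^ γ) f) :
    ∃ C, 0 ≤ C ∧ ∀ n, f n ≤ C * (n : ℝ) ^ β := by
  have hβ := H.pos
  have hγ : 0 < γ := by linarith
  obtain ⟨C₁, hC₁, h1⟩ := H.exists_offspringMean_rpow_bound H.pos H.le_one
  obtain ⟨C₂, hC₂, h2⟩ := H.exists_offspringMean_rpow_bound hγ (h.le.trans H.le_one)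
  have hm := H.one_lt_moment hγ h
  -- The gain is 2η n^γ; the two concentration errors cost at most η / 2 each, so a net gain of η
  -- n^γ remains.
  set η := (moment ν γ - 1) / 4 with hη
  have hη0 : 0 < η := by rw [hη]; linarith
  obtain ⟨n₁, hn₁⟩ := ((eventually_mul_rpow_le C₁ h0 (half_pos hη0)).and
    (eventually_mul_rpow_le (C₂ / 2) (half_lt_self hγ) (half_pos hη0))).exists_forall_of_atTop
  set n₀ := max n₁ (s + 1)
  -- The first summand makes the gain exceed the toll; the second dominates f below n₀, where n^β -
  -- n^γ / 2 ≥ 1 / 2 for n ≥ 1.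
  set A := 1 / η + 2 * ∑ k ∈ Finset.range n₀, |f k| with hA
  have hS : 0 ≤ ∑ k ∈ Finset.range n₀, |f k| := Finset.sum_nonneg fun _ _ => abs_nonneg _
  have hA0 : 0 ≤ A := by positivity
  have hAη : 1 ≤ A * η := by
    have : 1 / η * η = 1 := by field_simp
    nlinarith [mul_nonneg hS hη0.le]
  have key := H.nonpos_of_le_offspringMean (n₀ := n₀)
    (u := fun n => f n - A * ((n : ℝ) ^ β - 1 / 2 * (n : ℝ) ^ γ))
    (lt_of_lt_of_le (Nat.lt_succ_self s) (le_max_right _ _)) ?_ ?_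
  · refine ⟨A, hA0, fun n => ?_⟩
    have := key n
    have h3 : 0 ≤ A * (1 / 2 * (n : ℝ) ^ γ) := by positivity
    linarith
  · intro n hn
    rcases Nat.eq_zero_or_pos n with rfl | hpos
    · simp [hf.zero, hβ.ne', hγ.ne']
    have hn1 : (1 : ℝ) ≤ n := by exact_mod_cast hpos
    have h3 : (n : ℝ) ^ γ ≤ (n : ℝ) ^ β := Real.rpow_le_rpow_of_exponent_le hn1 h.le
    have h4 : 1 ≤ (n : ℝ) ^ β := Real.one_le_rpow hn1 hβ.le
    have h5 : |f n| ≤ ∑ k ∈ Finset.range n₀, |f k| :=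
      Finset.single_le_sum (f := fun k => |f k|) (fun _ _ => abs_nonneg _) (Finset.mem_range.2 hn)
    have h6 : 2 * |f n| ≤ A := by
      have : 0 < 1 / η := by positivity
      linarith
    have h7 : A * (1 / 2) ≤ A * ((n : ℝ) ^ β - 1 / 2 * (n : ℝ) ^ γ) :=
      mul_le_mul_of_nonneg_left (by linarith) hA0
    simp only [sub_nonpos]
    linarith [le_abs_self (f n)]
  · intro n hn
    have hsn : s < n := lt_of_lt_of_le (Nat.lt_succ_self s) ((le_max_right _ _).trans hn)
    have h3 : offspringMean s₀ s₁ ν (fun n => f n - A * ((n : ℝ) ^ β - 1 / 2 * (n : ℝ) ^ γ)) n =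
        offspringMean s₀ s₁ ν f n - A * (offspringMean s₀ s₁ ν (fun k => (k : ℝ) ^ β) n -
          1 / 2 * offspringMean s₀ s₁ ν (fun k => (k : ℝ) ^ γ) n) := by
      unfold offspringMean
      rw [splitMean_sub H.sub, splitMean_const_mul, splitMean_sub H.sub, splitMean_const_mul]
    have h4 := (abs_le.1 (h1 n hsn)).2
    have h5 := (abs_le.1 (h2 n hsn)).1
    obtain ⟨h6, h7⟩ := hn₁ n ((le_max_left _ _).trans hn)
    rw [H.moment_eq] at h4
    have h8 : moment ν γ = 1 + 4 * η := by rw [hη]; ring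
    rw [h8] at h5
    have h10 : 0 ≤ (n : ℝ) ^ γ := by positivity
    have h9 : A * (offspringMean s₀ s₁ ν (fun k => (k : ℝ) ^ β) n -
        1 / 2 * offspringMean s₀ s₁ ν (fun k => (k : ℝ) ^ γ) n) ≤
        A * ((n : ℝ) ^ β - 1 / 2 * (n : ℝ) ^ γ - η * (n : ℝ) ^ γ) :=
      mul_le_mul_of_nonneg_left (by nlinarith) hA0
    have h11 : (n : ℝ) ^ γ ≤ A * η * (n : ℝ) ^ γ := le_mul_of_one_le_left h10 hAη
    rw [h3, hf.of_lt n hsn]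
    nlinarith

/-- Comparison with ±D times the solution for the toll n^γ. The constant C does not depend on the
toll, which the later truncation argument relies on. -/
theorem exists_solution_bound (H : IsAdmissible s s₀ s₁ ν β)
    (hex : ∀ a, ∃ f, IsSolution s s₀ s₁ ν a f) {γ : ℝ} (h0 : β / 2 < γ) (h : γ < β) :
    ∃ C, 0 ≤ C ∧ ∀ a f, IsSolution s s₀ s₁ ν a f → ∀ D, (∀ n : ℕ, 1 ≤ n → |a n| ≤ D * (n : ℝ) ^ γ) →
      ∀ n : ℕ, |f n| ≤ C * D * (n : ℝ) ^ β := by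
  obtain ⟨f₀, hf₀⟩ := hex fun n => (n : ℝ) ^ γ
  obtain ⟨C, hC, h1⟩ := H.exists_solution_rpow_le h0 h hf₀
  refine ⟨C, hC, fun a f hf D hD n => ?_⟩
  have hD0 : 0 ≤ D := by simpa using (abs_nonneg _).trans (hD 1 le_rfl)
  have h2 := hf.mono H (hf₀.const_mul D) (fun n hn => (le_abs_self _).trans (hD n hn)) n
  have h3 := (hf₀.const_mul (-D)).mono H hf
    (fun n hn => by linarith [neg_abs_le (a n), hD n hn]) n
  have h4 : D * f₀ n ≤ C * D * (n : ℝ) ^ β := by nlinarith [mul_le_mul_of_nonneg_left (h1 n) hD0]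
  exact abs_le.2 ⟨by linarith, by linarith⟩

end IsAdmissible

end SplitTree

/-! ### Hölder regularity and the lower bound -/

namespace SplitTree

variable {b : ℕ} {s s₀ s₁ : ℕ} {ν : Measure (Fin b → ℝ)} [IsProbabilityMeasure ν] {β : ℝ}

theorem continuous_binomMean_param (m : ℕ) {G : ℕ → ℝ → ℝ} (hG : ∀ j, Continuous (G j)) :
    Continuous fun p => binomMean m p fun j => G j p := by
  induction m generalizing G with
  | zero => exact hG 0
  | succ m ih =>
    simp only [binomMean]
    exact (continuous_id.mul (ih fun j => hG (j + 1))).add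
      ((continuous_const.sub continuous_id).mul (ih hG))

theorem integrable_comp_entry (hν : IsSubstochastic ν) {φ : ℝ → ℝ} (hφ : Continuous φ)
    (i : Fin b) : Integrable (fun v => φ (v i)) ν := by
  obtain ⟨C, hC⟩ := isCompact_Icc.exists_bound_of_continuousOn (hφ.continuousOn (s := Set.Icc 0 1))
  refine Integrable.of_bound (hφ.measurable.comp (measurable_pi_apply i)).aestronglyMeasurable C ?_
  filter_upwards [hν] with v hv
  exact hC _ ⟨hv.1 i, IsSubstochastic.le_one hv i⟩

namespace IsAdmissible

/-- Solutions with finitely supported toll are Hölder continuous, by coupling binomial variables. -/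
theorem exists_holder (H : IsAdmissible s s₀ s₁ ν β) {a f : ℕ → ℝ}
    (hf : IsSolution s s₀ s₁ ν a f) {K : ℕ} (ha : ∀ n, K < n → a n = 0) {C : ℝ} (hC : 0 ≤ C)
    (hfC : ∀ n : ℕ, |f n| ≤ C * (n : ℝ) ^ β) :
    ∃ L, 0 ≤ L ∧ ∀ n k : ℕ, |f (n + k) - f n| ≤ L * (k : ℝ) ^ β := by
  have hβ := H.pos
  set M := max K s
  -- Chosen so that the growth bound alone suffices for n ≤ M: there |f (n + k)| + |f n| ≤ C (2 M^β
  -- + k^β) ≤ L k^β, as k ≥ 1.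
  set L := C * (2 * (M : ℝ) ^ β + 1) with hL
  have hL0 : 0 ≤ L := by positivity
  refine ⟨L, hL0, ?_⟩
  suffices h : ∀ N n k : ℕ, n + k = N → |f (n + k) - f n| - L * (k : ℝ) ^ β ≤ 0 from
    fun n k => sub_nonpos.1 (h _ n k rfl)
  intro N
  induction N using Nat.strong_induction_on with
  | _ N ih =>
  intro n k hnk
  rcases Nat.eq_zero_or_pos k with rfl | hk
  · simp [hβ.ne']
  rcases le_or_gt n M with hn | hn
  · have h1 : ((n + k : ℕ) : ℝ) ^ β ≤ (M : ℝ) ^ β + (k : ℝ) ^ β := by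
      refine le_trans ?_ (Real.rpow_add_le_add_rpow (Nat.cast_nonneg M) (Nat.cast_nonneg k)
        hβ.le H.le_one)
      exact Real.rpow_le_rpow (Nat.cast_nonneg _) (by exact_mod_cast by omega) hβ.le
    have h2 : (n : ℝ) ^ β ≤ (M : ℝ) ^ β :=
      Real.rpow_le_rpow (Nat.cast_nonneg _) (by exact_mod_cast hn) hβ.le
    have h3 : 1 ≤ (k : ℝ) ^ β := Real.one_le_rpow (by exact_mod_cast hk) hβ.le
    have h4 : 0 ≤ (M : ℝ) ^ β := by positivity
    have h5 := abs_sub (f (n + k)) (f n)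
    have h6 : C * (2 * (M : ℝ) ^ β + (k : ℝ) ^ β) ≤ L * (k : ℝ) ^ β := by
      rw [hL, mul_assoc]
      exact mul_le_mul_of_nonneg_left (by nlinarith) hC
    have h7 : C * ((n + k : ℕ) : ℝ) ^ β + C * (n : ℝ) ^ β ≤
        C * (2 * (M : ℝ) ^ β + (k : ℝ) ^ β) := by
      rw [← mul_add]; exact mul_le_mul_of_nonneg_left (by linarith) hC
    linarith [hfC (n + k), hfC n]
  have hsn : s < n := (le_max_right _ _).trans_lt hn
  have hKn : K < n := (le_max_left _ _).trans_lt hn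
  set m := n - s₀ - b * s₁ with hm
  have hm' : n + k - s₀ - b * s₁ = m + k := by
    have := H.le_succ; omega
  have hle := H.trials_add_le hsn
  -- The excess over the claimed bound. It is at most 0 for j + l < N by induction, so the only term
  -- left to control is the diagonal one, as in the comparison principle.
  let U : ℕ → ℕ → ℝ := fun j l => |f (j + l) - f j| - L * (l : ℝ) ^ β
  have hUn : ∀ j l, j + l < N → U j l ≤ 0 := fun j l h => ih _ h j l rfl
  have hint : Integrable
      (fun v => ∑ i, binomMean m (v i) (fun j => binomMean k (v i) (U (j + s₁)))) ν :=
    integrable_finsetSum _ fun i _ => integrable_comp_entry H.sub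
      (continuous_binomMean_param m fun j => continuous_binomMean k (U (j + s₁))) i
  have hbound : |f (n + k) - f n| - L * (k : ℝ) ^ β ≤
      ∫ v, ∑ i, binomMean m (v i) (fun j => binomMean k (v i) (U (j + s₁))) ∂ν := by
    -- The tolls vanish at n and n + k. The two child counts are coupled by adding k further trials,
    -- so their difference l is binomial with k trials.
    have h1 : f (n + k) - f n = ∫ v, ∑ i, binomMean m (v i) (fun j => binomMean k (v i)
        fun l => f (j + s₁ + l) - f (j + s₁)) ∂ν := by
      rw [hf.of_lt n hsn, hf.of_lt (n + k) (by omega), ha n hKn, ha (n + k) (by omega), zero_add,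
        zero_add, offspringMean, offspringMean, hm', splitMean, splitMean, ← integral_sub
          (integrable_sum_binomMean H.sub _ _) (integrable_sum_binomMean H.sub _ _)]
      congr 1 with v
      rw [← Finset.sum_sub_distrib]
      refine Finset.sum_congr rfl fun i _ => ?_
      rw [binomMean_add_trials, ← binomMean_sub]
      congr 1 with j
      rw [binomMean_sub, binomMean_const]
      congr 2 with l
      rw [add_right_comm]
    have h2 : |f (n + k) - f n| ≤ ∫ v, ((∑ i, binomMean m (v i)
        (fun j => binomMean k (v i) (U (j + s₁)))) + L * (k : ℝ) ^ β * ∑ i, v i ^ β) ∂ν := by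
      rw [h1, ← Real.norm_eq_abs]
      refine norm_integral_le_of_norm_le (hint.add ((integrable_sum_rpow H.sub hβ.le).const_mul _))
        ?_
      filter_upwards [H.sub] with v hv
      rw [Finset.mul_sum, ← Finset.sum_add_distrib, Real.norm_eq_abs]
      refine (Finset.abs_sum_le_sum_abs _ _).trans (Finset.sum_le_sum fun i _ => ?_)
      have hv0 := hv.1 i
      have hv1 := IsSubstochastic.le_one hv i
      refine (abs_binomMean_le hv0 hv1).trans ?_
      rw [← binomMean_const m (v i) (L * (k : ℝ) ^ β * v i ^ β), ← binomMean_add]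
      refine binomMean_mono hv0 hv1 fun j _ => ?_
      -- By Jensen the mean of l^β is at most k^β V_i^β; summed over i this has mean k^β, so the
      -- constant L reproduces itself.
      have h3 := mul_le_mul_of_nonneg_left (binomMean_natCast_rpow_le (m := k) hβ H.le_one hv0 hv1)
        hL0
      rw [← mul_assoc, ← binomMean_const_mul] at h3
      refine (abs_binomMean_le hv0 hv1).trans ?_
      have h4 := binomMean_add k (v i) (U (j + s₁)) (fun l => L * (l : ℝ) ^ β)
      simp only [U, sub_add_cancel] at h4
      rw [h4]
      simp only [U]
      gcongr
    rw [integral_add hint ((integrable_sum_rpow H.sub hβ.le).const_mul _), integral_const_mul] at h2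
    have h3 := H.moment_eq
    rw [moment] at h3
    rw [h3] at h2
    linarith
  have hbound2 : |f (n + k) - f n| - L * (k : ℝ) ^ β ≤
      moment ν ((m + k : ℕ) : ℝ) * U (m + s₁) k := by
    refine hbound.trans ?_
    rw [moment, ← integral_mul_const]
    refine integral_mono_ae hint
      ((integrable_sum_rpow H.sub (Nat.cast_nonneg _)).mul_const _) ?_
    filter_upwards [H.sub] with v hv
    simp only [Finset.sum_mul, Real.rpow_natCast]
    refine Finset.sum_le_sum fun i _ => ?_
    have hv0 := hv.1 i
    have hv1 := IsSubstochastic.le_one hv i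
    refine (binomMean_le_pow_mul hv0 hv1 fun j hj => ?_).trans ?_
    · rw [← binomMean_const k (v i) 0]
      exact binomMean_mono hv0 hv1 fun l hl => hUn _ _ (by omega)
    · rw [pow_add, mul_assoc]
      exact mul_le_mul_of_nonneg_left
        (binomMean_le_pow_mul hv0 hv1 fun l hl => hUn _ _ (by omega)) (pow_nonneg hv0 _)
  rcases H.trials_add hsn with h3 | ⟨h3, h4⟩
  · refine hbound2.trans (mul_nonpos_of_nonneg_of_nonpos ?_ (hUn _ _ (by omega)))
    refine integral_nonneg_of_ae ?_
    filter_upwards [H.sub] with v hv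
    exact Finset.sum_nonneg fun i _ => Real.rpow_nonneg (hv.1 i) _
  · subst h4
    rw [← hm] at h3
    simp only [h3, U] at hbound2
    have h5 := H.moment_natCast_lt_one (n := n + k) (by omega)
    simp only [add_zero] at hbound2
    by_contra! h6
    nlinarith

/-- An entry in (0, 1) occurs with positive probability, and then the child count charges every
value from s₁ up to its maximum. -/
theorem offspringMean_pos (H : IsAdmissible s s₀ s₁ ν β) {f : ℕ → ℝ} (hf : ∀ n, 0 ≤ f n)
    {n k : ℕ} (hk : s₁ ≤ k) (hkn : k ≤ n - s₀ - b * s₁ + s₁) (hfk : 0 < f k) :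
    0 < offspringMean s₀ s₁ ν f n := by
  by_contra! h
  refine H.nondeg ?_
  set m := n - s₀ - b * s₁
  have hnn : 0 ≤ᵐ[ν] fun v => ∑ i, binomMean m (v i) fun j => f (j + s₁) := by
    filter_upwards [H.sub] with v hv
    exact Finset.sum_nonneg fun i _ => binomMean_nonneg (hv.1 i) (IsSubstochastic.le_one hv i)
      fun j _ => hf _
  have hz := (integral_eq_zero_iff_of_nonneg_ae hnn (integrable_sum_binomMean H.sub _ _)).1
    (le_antisymm h (integral_nonneg_of_ae hnn))
  filter_upwards [hz, H.sub] with v hv hv' i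
  by_contra! hne
  have h1 := (Finset.sum_eq_zero_iff_of_nonneg fun i _ => binomMean_nonneg (hv'.1 i)
      (IsSubstochastic.le_one hv' i) fun j _ => hf _).1 hv i (Finset.mem_univ i)
  refine (binomMean_pos (m := m) (j := k - s₁) ((hv'.1 i).lt_of_ne' hne.1)
    ((IsSubstochastic.le_one hv' i).lt_of_ne hne.2) (fun j => hf (j + s₁)) (by omega) ?_).ne' h1
  rwa [Nat.sub_add_cancel hk]

/-- A multiple of n^β + n^γ, cut off to 0 below N, is a subsolution: `moment ν γ` > 1 gives a gain
of order n^γ that absorbs the concentration errors and the cutoff. The condition s₁ ≤ n on the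
positive toll ensures that children of large nodes can have that size. -/
theorem exists_lower_bound (H : IsAdmissible s s₀ s₁ ν β) {a f : ℕ → ℝ}
    (hf : IsSolution s s₀ s₁ ν a f) (ha : ∀ n, 1 ≤ n → 0 ≤ a n)
    (hpos : ∃ n, 1 ≤ n ∧ s₁ ≤ n ∧ 0 < a n) :
    ∃ c, 0 < c ∧ ∀ᶠ n : ℕ in atTop, c * (n : ℝ) ^ β ≤ f n := by
  obtain ⟨k, hk1, hk, hak⟩ := hpos
  have hβ := H.pos
  have hf0 := hf.nonneg H ha
  have hfk : 0 < f k := by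
    rcases le_or_gt k s with h | h
    · rwa [hf.of_le k hk1 h]
    · rw [hf.of_lt k h]
      have h1 : offspringMean s₀ s₁ ν (fun _ => 0) k ≤ offspringMean s₀ s₁ ν f k :=
        H.offspringMean_mono hf0
      rw [offspringMean, splitMean_const] at h1
      linarith
  -- From N on, nodes are split and can have a child with exactly k balls, so f is positive there.
  set N := k + s + 1 + s₀ + b * s₁
  have hfN : ∀ n, N ≤ n → 0 < f n := fun n hn => by
    rw [hf.of_lt n (by omega)]
    have h1 := ha n (by omega)
    have h2 := H.offspringMean_pos hf0 (n := n) hk (by omega) hfk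
    linarith
  set γ := 3 / 4 * β with hγ
  have hγ0 : 0 < γ := by positivity
  obtain ⟨C₁, hC₁, h1⟩ := H.exists_offspringMean_rpow_bound H.pos H.le_one
  obtain ⟨C₂, hC₂, h2⟩ := H.exists_offspringMean_rpow_bound hγ0 (by linarith [H.le_one])
  have hm := H.one_lt_moment hγ0 (by linarith)
  set η := (moment ν γ - 1) / 3 with hη
  have hη0 : 0 < η := by rw [hη]; linarith
  -- The largest loss caused by the cutoff. The gain 3η n^γ covers two concentration errors and b D,
  -- each at most η n^γ.
  set D := (N : ℝ) ^ β + (N : ℝ) ^ γ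
  obtain ⟨n₁, hn₁⟩ := ((eventually_mul_rpow_le C₁ (by linarith : β / 2 < γ) hη0).and
    ((eventually_mul_rpow_le C₂ (half_lt_self hγ0) hη0).and
      (eventually_mul_rpow_le (b * D) hγ0 hη0))).exists_forall_of_atTop
  set n₀ := max n₁ N
  set g : ℕ → ℝ := fun n => if n < N then 0 else (n : ℝ) ^ β + (n : ℝ) ^ γ with hg
  -- Below N the minorant is 0 and f ≥ 0; from N on f > 0, so finitely many inequalities are met by
  -- a small c.
  have hc : ∀ n₀, ∃ c, 0 < c ∧ ∀ n < n₀, c * g n ≤ f n := by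
    intro n₀
    induction n₀ with
    | zero => exact ⟨1, one_pos, by simp⟩
    | succ n ih =>
      obtain ⟨c, hc0, hc⟩ := ih
      rcases lt_or_ge n N with hn | hn
      · refine ⟨c, hc0, fun j hj => ?_⟩
        rcases (Nat.lt_succ_iff_lt_or_eq.1 hj) with h | rfl
        · exact hc j h
        · simpa [hg, hn] using hf0 j
      · have hgp : ∀ j, 0 ≤ g j := fun j => by simp only [hg]; split_ifs <;> positivity
        have hgn : 0 < g n := by
          have : (0 : ℝ) < n := by exact_mod_cast (by omega : 0 < n)
          simp only [hg, if_neg hn.not_gt]; positivity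
        refine ⟨min c (f n / g n), lt_min hc0 (div_pos (hfN n hn) hgn), fun j hj => ?_⟩
        rcases (Nat.lt_succ_iff_lt_or_eq.1 hj) with h | rfl
        · exact (mul_le_mul_of_nonneg_right (min_le_left _ _) (hgp j)).trans (hc j h)
        · refine (mul_le_mul_of_nonneg_right (min_le_right _ _) (hgp j)).trans_eq ?_
          field_simp
  obtain ⟨c, hc0, hc⟩ := hc n₀
  refine ⟨c, hc0, ?_⟩
  have key := H.nonpos_of_le_offspringMean (n₀ := n₀) (u := fun n => c * g n - f n)
    (lt_of_lt_of_le (by omega) (le_max_right _ _)) (fun n hn => sub_nonpos.2 (hc n hn)) ?_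
  · filter_upwards [eventually_ge_atTop N] with n hn
    have h3 := key n
    simp only [hg, if_neg hn.not_gt] at h3
    have : 0 ≤ c * (n : ℝ) ^ γ := by positivity
    linarith
  intro n hn
  have hNn : N ≤ n := (le_max_right _ _).trans hn
  have hsn : s < n := by omega
  obtain ⟨h3, h4, h5⟩ := hn₁ n ((le_max_left _ _).trans hn)
  have h6 : offspringMean s₀ s₁ ν (fun n => c * g n - f n) n =
      c * offspringMean s₀ s₁ ν g n - offspringMean s₀ s₁ ν f n := by
    unfold offspringMean
    rw [splitMean_sub H.sub, splitMean_const_mul]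
  have h7 : offspringMean s₀ s₁ ν (fun n => ((n : ℝ) ^ β + (n : ℝ) ^ γ) - D) n ≤
      offspringMean s₀ s₁ ν g n := by
    refine H.offspringMean_mono fun j => ?_
    simp only [hg]
    split_ifs with hj
    · have hj' : (j : ℝ) ≤ N := by exact_mod_cast hj.le
      have := Real.rpow_le_rpow (Nat.cast_nonneg j) hj' hβ.le
      have := Real.rpow_le_rpow (Nat.cast_nonneg j) hj' hγ0.le
      linarith
    · have : 0 ≤ D := by positivity
      linarith
  have h8 : offspringMean s₀ s₁ ν (fun n => ((n : ℝ) ^ β + (n : ℝ) ^ γ) - D) n =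
      offspringMean s₀ s₁ ν (fun n => (n : ℝ) ^ β) n +
        offspringMean s₀ s₁ ν (fun n => (n : ℝ) ^ γ) n - b * D := by
    unfold offspringMean
    rw [splitMean_sub H.sub, splitMean_add H.sub, splitMean_const]
  have h9 := (abs_le.1 (h1 n hsn)).1
  have h10 := (abs_le.1 (h2 n hsn)).1
  have h11 : moment ν γ = 1 + 3 * η := by rw [hη]; ring
  rw [H.moment_eq] at h9
  rw [h11] at h10
  rw [Real.rpow_zero, mul_one] at h5
  have h12 : g n ≤ offspringMean s₀ s₁ ν g n := by
    simp only [hg] at h7 ⊢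
    rw [if_neg hNn.not_gt]
    linarith
  have h13 := mul_le_mul_of_nonneg_left h12 hc0.le
  rw [h6, hf.of_lt n hsn]
  linarith [ha n (by omega)]

end IsAdmissible

end SplitTree

/-! ### Renewal theory: almost harmonic functions have vanishing energy -/

namespace SplitTree

open Topology

section renewal

/-- A nonnegative uniformly continuous function with bounded integrals vanishes at infinity. -/
theorem tendsto_zero_of_integral_le {Q : ℝ → ℝ} (hQ : UniformContinuous Q) (h0 : ∀ x, 0 ≤ Q x)
    {M : ℝ} (hM : ∀ X, 0 ≤ X → ∫ t in (0 : ℝ)..X, Q t ≤ M) : Tendsto Q atTop (𝓝 0) := by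
  have hint : ∀ x y, IntervalIntegrable Q volume x y := fun x y =>
    hQ.continuous.intervalIntegrable x y
  have hmono : Monotone fun X => ∫ t in (0 : ℝ)..X, Q t := by
    intro x y hxy
    have h1 := intervalIntegral.integral_add_adjacent_intervals (hint 0 x) (hint x y)
    have h2 := intervalIntegral.integral_nonneg (μ := volume) hxy fun t _ => h0 t
    simp only
    linarith
  have hbdd : BddAbove (Set.range fun X => ∫ t in (0 : ℝ)..X, Q t) := by
    refine ⟨M, ?_⟩
    rintro _ ⟨X, rfl⟩
    exact (hmono (le_max_left X 0)).trans (hM _ (le_max_right _ _))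
  have hlim := tendsto_atTop_ciSup hmono hbdd
  rw [Metric.tendsto_nhds]
  intro ε hε
  obtain ⟨δ, hδ, h⟩ := Metric.uniformContinuous_iff.1 hQ (ε / 2) (half_pos hε)
  -- The integrals over windows of length δ / 2 tend to 0, while Q X ≥ ε would force such an
  -- integral to be at least δ / 2 · ε / 2.
  have h1 := ((hlim.comp (tendsto_atTop_add_const_right _ (δ / 2) tendsto_id)).sub hlim)
  rw [sub_self] at h1
  filter_upwards [h1.eventually_lt_const (show 0 < δ / 2 * (ε / 2) by positivity)] with X hX
  simp only [Function.comp_apply, id_eq] at hX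
  rw [intervalIntegral.integral_interval_sub_left (hint _ _) (hint _ _)] at hX
  have h2 : ∫ _ in X..(X + δ / 2), (Q X - ε / 2) ≤ ∫ t in X..(X + δ / 2), Q t := by
    refine intervalIntegral.integral_mono_on (by linarith) (by simp) (hint _ _) fun t ht => ?_
    have h3 := h (a := t) (b := X) (by
      rw [Real.dist_eq, abs_of_nonneg (by linarith [ht.1])]; linarith [ht.2])
    rw [Real.dist_eq] at h3
    linarith [(abs_lt.1 h3).1]
  simp only [intervalIntegral.integral_const, add_sub_cancel_left, smul_eq_mul] at h2
  rw [Real.dist_eq, sub_zero, abs_of_nonneg (h0 X)]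
  have h4 := lt_of_mul_lt_mul_left (h2.trans_lt hX) (by positivity)
  linarith

variable {μ : Measure ℝ} [IsProbabilityMeasure μ] {F : ℝ → ℝ} {B : ℝ}

theorem integrable_comp_sub (hF : Continuous F) (hB : ∀ x, |F x| ≤ B) (x : ℝ) :
    Integrable (fun w => F (x - w)) μ :=
  Integrable.of_bound (hF.comp (continuous_const.sub continuous_id)).aestronglyMeasurable B
    (Eventually.of_forall fun _ => hB _)

theorem continuous_convolution (hF : Continuous F) (hB : ∀ x, |F x| ≤ B) :
    Continuous fun x => ∫ w, F (x - w) ∂μ :=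
  continuous_of_dominated (bound := fun _ => B)
    (fun x => (integrable_comp_sub hF hB x).aestronglyMeasurable)
    (fun _ => Eventually.of_forall fun _ => hB _) (integrable_const _)
    (Eventually.of_forall fun _ => hF.comp (continuous_id.sub continuous_const))

theorem abs_intervalIntegral_le (hB : ∀ x, |F x| ≤ B) (x y : ℝ) :
    |∫ t in x..y, F t| ≤ B * |y - x| :=
  intervalIntegral.norm_integral_le_of_norm_le_const (f := F) fun t _ => hB t

theorem integrable_intervalIntegral (hμ : Integrable (fun w : ℝ => w) μ) (hF : Continuous F)
    (hB : ∀ x, |F x| ≤ B) (X : ℝ) : Integrable (fun w => ∫ t in (X - w)..X, F t) μ := by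
  have hc : Continuous fun w => ∫ t in (X - w)..X, F t := by
    have h1 := intervalIntegral.continuous_primitive (μ := volume) (f := F)
      (fun a b => hF.intervalIntegrable a b) X
    have h2 : (fun w => ∫ t in (X - w)..X, F t) = fun w => -∫ t in X..(X - w), F t := by
      ext w; rw [intervalIntegral.integral_symm]
    rw [h2]
    exact (h1.comp (continuous_const.sub continuous_id)).neg
  refine (hμ.abs.const_mul B).mono' hc.aestronglyMeasurable (Eventually.of_forall fun w => ?_)
  simpa using abs_intervalIntegral_le hB (X - w) X

/-- The renewal identity: the mass of a function over the interval covered by one step changes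
according to the defect of harmonicity. -/
theorem integral_intervalIntegral_sub (hμ : Integrable (fun w : ℝ => w) μ) (hF : Continuous F)
    (hB : ∀ x, |F x| ≤ B) {X : ℝ} (hX : 0 ≤ X) :
    (∫ w, (∫ t in (X - w)..X, F t) ∂μ) - ∫ w, (∫ t in (0 - w)..0, F t) ∂μ =
      ∫ t in (0 : ℝ)..X, (F t - ∫ w, F (t - w) ∂μ) := by
  have hint : ∀ x y, IntervalIntegrable F volume x y := fun x y => hF.intervalIntegrable x y
  rw [← integral_sub (integrable_intervalIntegral hμ hF hB X)
    (integrable_intervalIntegral hμ hF hB 0)]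
  have h1 : ∀ w, (∫ t in (X - w)..X, F t) - (∫ t in (0 - w)..0, F t) =
      ∫ t in Set.Ioc 0 X, (F t - F (t - w)) := by
    intro w
    have hFw : Continuous fun t => F (t - w) := hF.comp (continuous_id.sub continuous_const)
    rw [← intervalIntegral.integral_of_le hX, intervalIntegral.integral_sub (hint _ _)
      (hFw.intervalIntegrable _ _),
      intervalIntegral.integral_comp_sub_right (fun t => F t) w]
    have h2 := intervalIntegral.integral_add_adjacent_intervals (hint (0 - w) (X - w))
      (hint (X - w) X)
    have h3 := intervalIntegral.integral_add_adjacent_intervals (hint (0 - w) 0) (hint 0 X)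
    linarith
  simp_rw [h1]
  rw [integral_integral_swap, intervalIntegral.integral_of_le hX]
  · congr 1 with t
    rw [integral_sub (integrable_const _) (integrable_comp_sub hF hB t)]
    simp
  · refine Integrable.of_bound (C := 2 * B) ?_ (Eventually.of_forall fun q => ?_)
    · exact ((hF.comp continuous_snd).sub
        (hF.comp (continuous_snd.sub continuous_fst))).aestronglyMeasurable
    · refine (norm_sub_le _ _).trans ?_
      have := hB q.2
      have := hB (q.2 - q.1)
      simp only [Real.norm_eq_abs]
      linarith

theorem abs_integral_intervalIntegral_le (hμ : Integrable (fun w : ℝ => w) μ)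
    (hB : ∀ x, |F x| ≤ B) (X : ℝ) :
    |∫ w, (∫ t in (X - w)..X, F t) ∂μ| ≤ B * ∫ w, |w| ∂μ := by
  rw [← integral_const_mul, ← Real.norm_eq_abs]
  refine norm_integral_le_of_norm_le (hμ.abs.const_mul B) (Eventually.of_forall fun w => ?_)
  simpa using abs_intervalIntegral_le hB (X - w) X

/-- An almost harmonic function: bounded, uniformly continuous, and with exponentially decaying
defect of harmonicity with respect to the step distribution `μ`. -/
structure IsAlmostHarmonic (μ : Measure ℝ) (F : ℝ → ℝ) (B C ε : ℝ) : Prop where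
  uc : UniformContinuous F
  bdd : ∀ x, |F x| ≤ B
  pos : 0 < ε
  defect : ∀ x, 0 ≤ x → |F x - ∫ w, F (x - w) ∂μ| ≤ C * Real.exp (-ε * x)

namespace IsAlmostHarmonic

variable {C ε : ℝ}

theorem integrableOn_defect (h : IsAlmostHarmonic μ F B C ε) :
    IntegrableOn (fun x => F x - ∫ w, F (x - w) ∂μ) (Set.Ioi 0) := by
  refine Integrable.mono' ((exp_neg_integrableOn_Ioi 0 h.pos).const_mul C)
    (h.uc.continuous.sub (continuous_convolution h.uc.continuous h.bdd)).aestronglyMeasurable ?_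
  exact (ae_restrict_mem measurableSet_Ioi).mono fun x hx => h.defect x (le_of_lt hx)

/-- The mean square of the increments of an almost harmonic function vanishes at infinity. -/
theorem tendsto_energy (h : IsAlmostHarmonic μ F B C ε) (hμ : Integrable (fun w : ℝ => w) μ) :
    Tendsto (fun x => ∫ w, (F x - F (x - w)) ^ 2 ∂μ) atTop (𝓝 0) := by
  have hF := h.uc.continuous
  have hB := h.bdd
  have hB0 : 0 ≤ B := (abs_nonneg _).trans (hB 0)
  have hF2 : Continuous fun x => F x ^ 2 := hF.pow 2
  have hB2 : ∀ x, |F x ^ 2| ≤ B ^ 2 := fun x => by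
    rw [abs_pow]; exact pow_le_pow_left₀ (abs_nonneg _) (hB x) 2
  have hsq : ∀ x, Integrable (fun w => (F x - F (x - w)) ^ 2) μ := fun x => by
    refine Integrable.of_bound (((continuous_const.sub (hF.comp
      (continuous_const.sub continuous_id))).pow 2).aestronglyMeasurable) ((2 * B) ^ 2)
      (Eventually.of_forall fun w => ?_)
    rw [Real.norm_eq_abs, abs_pow]
    refine pow_le_pow_left₀ (abs_nonneg _) ((abs_sub _ _).trans ?_) 2
    linarith [hB x, hB (x - w)]
  refine tendsto_zero_of_integral_le ?_ (fun x => integral_nonneg fun w => sq_nonneg _)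
    (M := 2 * B * (∫ x in Set.Ioi (0 : ℝ), |F x - ∫ w, F (x - w) ∂μ|) +
      2 * (B ^ 2 * ∫ w, |w| ∂μ)) ?_
  -- The energy is uniformly continuous because a difference of squares of increments is at most 4B
  -- times a difference of increments.
  · rw [Metric.uniformContinuous_iff]
    intro η hη
    obtain ⟨δ, hδ, hd⟩ := Metric.uniformContinuous_iff.1 h.uc (η / (8 * B + 1) / 2) (by positivity)
    refine ⟨δ, hδ, fun {x y} hxy => ?_⟩
    rw [Real.dist_eq, ← integral_sub (hsq x) (hsq y)]
    have h1 := norm_integral_le_of_norm_le_const (μ := μ) (C := (4 * B) * (η / (8 * B + 1)))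
      (f := fun w => (F x - F (x - w)) ^ 2 - (F y - F (y - w)) ^ 2)
      (Eventually.of_forall fun w => ?_)
    · rw [Real.norm_eq_abs] at h1
      refine h1.trans_lt ?_
      simp only [measureReal_def, measure_univ, ENNReal.toReal_one, mul_one]
      rw [← mul_div_assoc, div_lt_iff₀ (by positivity)]
      nlinarith
    · have h2 := hd hxy
      have h3 := hd (a := x - w) (b := y - w) (by simpa [Real.dist_eq] using hxy)
      rw [Real.dist_eq] at h2 h3
      rw [Real.norm_eq_abs, show (F x - F (x - w)) ^ 2 - (F y - F (y - w)) ^ 2 =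
        ((F x - F (x - w)) + (F y - F (y - w))) * ((F x - F y) - (F (x - w) - F (y - w))) by ring,
        abs_mul]
      refine mul_le_mul ?_ ?_ (abs_nonneg _) (by positivity)
      · refine (abs_add_le _ _).trans ?_
        have := abs_sub (F x) (F (x - w))
        have := abs_sub (F y) (F (y - w))
        linarith [hB x, hB y, hB (x - w), hB (y - w)]
      · refine (abs_sub _ _).trans ?_
        linarith
  · intro X hX
    -- With P the averaging operator: P-energy = 2F(F - PF) - (F² - PF²). The first term is
    -- integrable by the defect bound; the second telescopes under the renewal identity for F² to
    -- two boundary terms of size B² E|W|.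
    have h1 : ∀ x, ∫ w, (F x - F (x - w)) ^ 2 ∂μ = 2 * (F x * (F x - ∫ w, F (x - w) ∂μ)) -
        (F x ^ 2 - ∫ w, F (x - w) ^ 2 ∂μ) := by
      intro x
      have h2 : ∀ w, (F x - F (x - w)) ^ 2 = F x ^ 2 - 2 * F x * F (x - w) + F (x - w) ^ 2 :=
        fun w => by ring
      simp_rw [h2]
      have h3 : Integrable (fun w => F x ^ 2 - 2 * F x * F (x - w)) μ :=
        (integrable_const _).sub ((integrable_comp_sub hF hB x).const_mul _)
      rw [integral_add h3 (integrable_comp_sub hF2 hB2 x), integral_sub (integrable_const _)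
        ((integrable_comp_sub hF hB x).const_mul _), integral_const_mul]
      simp; ring
    have hz : Continuous fun x => F x - ∫ w, F (x - w) ∂μ :=
      hF.sub (continuous_convolution hF hB)
    have hz2 : Continuous fun x => F x ^ 2 - ∫ w, F (x - w) ^ 2 ∂μ :=
      hF2.sub (continuous_convolution hF2 hB2)
    have hz3 : Continuous fun x => 2 * (F x * (F x - ∫ w, F (x - w) ∂μ)) :=
      continuous_const.mul (hF.mul hz)
    simp_rw [h1]
    rw [intervalIntegral.integral_sub (hz3.intervalIntegrable _ _)
      (hz2.intervalIntegrable _ _), ← integral_intervalIntegral_sub hμ hF2 hB2 hX,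
      intervalIntegral.integral_const_mul]
    have h3 : ∫ x in (0 : ℝ)..X, F x * (F x - ∫ w, F (x - w) ∂μ) ≤
        B * ∫ x in Set.Ioi (0 : ℝ), |F x - ∫ w, F (x - w) ∂μ| := by
      rw [← integral_const_mul, intervalIntegral.integral_of_le hX]
      refine le_trans (integral_mono (g := fun x => B * |F x - ∫ w, F (x - w) ∂μ|)
        ((hF.mul hz).integrableOn_Ioc) ((continuous_const.mul hz.abs).integrableOn_Ioc) fun x => ?_) ?_
      · refine (le_abs_self _).trans ?_
        rw [abs_mul]
        exact mul_le_mul_of_nonneg_right (hB x) (abs_nonneg _)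
      · refine setIntegral_mono_set (h.integrableOn_defect.abs.const_mul B)
          (Eventually.of_forall fun x => by positivity) ?_
        exact (Set.Ioc_subset_Ioi_self).eventuallyLE
    have h4 := abs_le.1 (abs_integral_intervalIntegral_le hμ hB2 X)
    have h5 := abs_le.1 (abs_integral_intervalIntegral_le hμ hB2 0)
    linarith [h4.1, h5.2]

end IsAlmostHarmonic

end renewal

end SplitTree

/-! ### Asymptotic periods and limits of almost harmonic functions -/

namespace SplitTree

open Topology

/-- The asymptotic periods of a function. -/
def asymptoticPeriods (F : ℝ → ℝ) : AddSubgroup ℝ where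
  carrier := {w | Tendsto (fun x => F x - F (x - w)) atTop (𝓝 0)}
  zero_mem' := by simp
  add_mem' {a c} ha hc := by
    have h1 := Tendsto.add ha (hc.comp (tendsto_atTop_add_const_right _ (-a) tendsto_id))
    rw [add_zero] at h1
    refine h1.congr fun x => ?_
    simp only [Function.comp_apply, id_eq, ← sub_eq_add_neg, sub_sub]
    ring
  neg_mem' {a} ha := by
    have h1 := (Tendsto.comp ha (tendsto_atTop_add_const_right _ a tendsto_id)).neg
    rw [neg_zero] at h1
    refine h1.congr fun x => ?_
    simp

theorem mem_asymptoticPeriods {F : ℝ → ℝ} {w : ℝ} :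
    w ∈ asymptoticPeriods F ↔ Tendsto (fun x => F x - F (x - w)) atTop (𝓝 0) := Iff.rfl

theorem isClosed_asymptoticPeriods {F : ℝ → ℝ} (hF : UniformContinuous F) :
    IsClosed (asymptoticPeriods F : Set ℝ) := by
  refine isClosed_of_closure_subset fun w hw => ?_
  rw [SetLike.mem_coe, mem_asymptoticPeriods, Metric.tendsto_nhds]
  intro ε hε
  obtain ⟨δ, hδ, h⟩ := Metric.uniformContinuous_iff.1 hF (ε / 2) (half_pos hε)
  obtain ⟨w', hw', hd⟩ := Metric.mem_closure_iff.1 hw δ hδ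
  filter_upwards [(Metric.tendsto_nhds.1 (mem_asymptoticPeriods.1 hw')) (ε / 2) (half_pos hε)]
    with x hx
  have h1 := h (a := x - w') (b := x - w) (by
    rw [Real.dist_eq] at hd ⊢; convert hd using 2; ring)
  rw [Real.dist_eq] at *
  rw [sub_zero] at *
  calc |F x - F (x - w)| = |(F x - F (x - w')) + (F (x - w') - F (x - w))| := by ring_nf
    _ ≤ _ := abs_add_le _ _
    _ < ε := by linarith

variable {μ : Measure ℝ} [IsProbabilityMeasure μ] {F : ℝ → ℝ} {B C ε : ℝ}

namespace IsAlmostHarmonic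

theorem abs_sub_le (h : IsAlmostHarmonic μ F B C ε) (x y : ℝ) : |F x - F y| ≤ 2 * B := by
  refine (abs_sub _ _).trans ?_
  linarith [h.bdd x, h.bdd y]

/-- An increment of size η at step w persists, with size η / 2, for all steps in a ball around w.
This ball has positive mass, so the energy would stay away from 0. -/
theorem support_subset (h : IsAlmostHarmonic μ F B C ε) (hμ : Integrable (fun w : ℝ => w) μ) :
    μ.support ⊆ asymptoticPeriods F := by
  intro w hw
  rw [SetLike.mem_coe, mem_asymptoticPeriods, Metric.tendsto_nhds]
  intro η hη
  obtain ⟨δ, hδ, hd⟩ := Metric.uniformContinuous_iff.1 h.uc (η / 2) (half_pos hη)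
  have hc : 0 < μ.real (Metric.ball w δ) :=
    ENNReal.toReal_pos ((Measure.mem_support_iff_forall w).1 hw _ (Metric.ball_mem_nhds w hδ)).ne'
      (measure_ne_top _ _)
  filter_upwards [(h.tendsto_energy hμ).eventually_lt_const
    (show 0 < μ.real (Metric.ball w δ) * (η / 2) ^ 2 by positivity)] with x hx
  by_contra! hne
  rw [Real.dist_eq, sub_zero] at hne
  refine hx.not_ge ?_
  have hcont : Continuous fun w => (F x - F (x - w)) ^ 2 :=
    (continuous_const.sub (h.uc.continuous.comp (continuous_const.sub continuous_id))).pow 2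
  have hint : Integrable (fun w => (F x - F (x - w)) ^ 2) μ := by
    refine Integrable.of_bound hcont.aestronglyMeasurable ((2 * B) ^ 2)
      (Eventually.of_forall fun w => ?_)
    rw [Real.norm_eq_abs, abs_pow]
    exact pow_le_pow_left₀ (abs_nonneg _) (h.abs_sub_le _ _) 2
  rw [← smul_eq_mul, ← setIntegral_const]
  refine (setIntegral_mono_on (integrable_const _).integrableOn hint.integrableOn
    measurableSet_ball fun w' hw' => ?_).trans
      (setIntegral_le_integral hint (Eventually.of_forall fun _ => sq_nonneg _))
  have h1 := hd (a := x - w') (b := x - w) (by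
    rw [Metric.mem_ball', Real.dist_eq] at hw'; rw [Real.dist_eq]; convert hw' using 2; ring)
  rw [Real.dist_eq] at h1
  rw [← sq_abs (F x - F (x - w'))]
  refine pow_le_pow_left₀ (by positivity) ?_ 2
  have h2 : |F x - F (x - w)| ≤ |F x - F (x - w')| + |F (x - w') - F (x - w)| := by
    refine le_trans (le_of_eq ?_) (abs_add_le _ _)
    ring_nf
  linarith

/-- An almost harmonic function all of whose increments vanish at infinity converges. -/
theorem exists_tendsto (h : IsAlmostHarmonic μ F B C ε) (hμ : Integrable (fun w : ℝ => w) μ)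
    (hm : 0 < ∫ w, w ∂μ) (hper : ∀ y, y ∈ asymptoticPeriods F) :
    ∃ c, Tendsto F atTop (𝓝 c) := by
  have hF := h.uc.continuous
  have hint : ∀ x y, IntervalIntegrable F volume x y := fun x y => hF.intervalIntegrable x y
  set m := ∫ w, w ∂μ
  -- The conserved quantity: its increments are integrals of the defect, so it converges. Once all
  -- increments of F vanish asymptotically, J is close to m F, hence F converges too.
  set J : ℝ → ℝ := fun X => ∫ w, (∫ t in (X - w)..X, F t) ∂μ with hJ
  have h1 : Tendsto (fun X => J X - J 0) atTop
      (𝓝 (∫ x in Set.Ioi (0 : ℝ), (F x - ∫ w, F (x - w) ∂μ))) := by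
    refine (intervalIntegral_tendsto_integral_Ioi 0 h.integrableOn_defect tendsto_id).congr' ?_
    filter_upwards [eventually_ge_atTop 0] with X hX
    exact (integral_intervalIntegral_sub hμ hF h.bdd hX).symm
  have h2 : Tendsto (fun X => J X - m * F X) atTop (𝓝 0) := by
    have h3 : ∀ X, J X - m * F X = ∫ w, (∫ y in (0 : ℝ)..w, (F (X - y) - F X)) ∂μ := by
      intro X
      rw [← integral_mul_const, ← integral_sub (integrable_intervalIntegral hμ hF h.bdd X)
        (hμ.mul_const _)]
      congr 1 with w
      have hFX : Continuous fun y => F (X - y) := hF.comp (continuous_const.sub continuous_id)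
      rw [intervalIntegral.integral_sub (hFX.intervalIntegrable _ _) (by simp),
        intervalIntegral.integral_comp_sub_left (fun t => F t)]
      simp
    simp_rw [h3]
    have hdom : ∀ X w, |∫ y in (0 : ℝ)..w, (F (X - y) - F X)| ≤ 2 * B * |w| := fun X w => by
      simpa using abs_intervalIntegral_le (F := fun y => F (X - y) - F X)
        (fun y => h.abs_sub_le _ _) 0 w
    suffices h0 : Tendsto _ atTop (𝓝 (∫ _, (0 : ℝ) ∂μ)) by simpa only [integral_zero] using h0
    refine tendsto_integral_filter_of_dominated_convergence (fun w => 2 * B * |w|)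
      (Eventually.of_forall fun X => ?_) (Eventually.of_forall fun X =>
        Eventually.of_forall fun w => hdom X w) (hμ.abs.const_mul _)
      (Eventually.of_forall fun w => ?_)
    · have hFX : Continuous fun y => F (X - y) - F X :=
        (hF.comp (continuous_const.sub continuous_id)).sub continuous_const
      exact (intervalIntegral.continuous_primitive (μ := volume)
        (fun a b => hFX.intervalIntegrable a b) 0).aestronglyMeasurable
    · suffices h0 : Tendsto (fun X => ∫ y in (0 : ℝ)..w, (F (X - y) - F X)) atTop
          (𝓝 (∫ _ in (0 : ℝ)..w, (0 : ℝ))) by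
        simpa only [intervalIntegral.integral_zero] using h0
      refine intervalIntegral.tendsto_integral_filter_of_dominated_convergence (fun _ => 2 * B)
        (Eventually.of_forall fun X => ?_) (Eventually.of_forall fun X =>
          Eventually.of_forall fun y _ => h.abs_sub_le _ _) (by simp)
        (Eventually.of_forall fun y _ => ?_)
      · exact ((hF.comp (continuous_const.sub continuous_id)).sub
          continuous_const).aestronglyMeasurable
      · have h4 := (mem_asymptoticPeriods.1 (hper y)).neg
        rw [neg_zero] at h4
        exact h4.congr fun x => by ring
  refine ⟨((∫ x in Set.Ioi (0 : ℝ), (F x - ∫ w, F (x - w) ∂μ)) + J 0 - 0) / m, ?_⟩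
  refine (((h1.add_const (J 0)).sub h2).div_const m).congr fun X => ?_
  field_simp
  ring

/-- An almost harmonic function for a step distribution on `dℤ` is asymptotically close to a
continuous `d`-periodic function, if `d` is an asymptotic period. -/
theorem exists_periodic (h : IsAlmostHarmonic μ F B C ε) (hμ : Integrable (fun w : ℝ => w) μ)
    (hpos : ∀ᵐ w ∂μ, 0 ≤ w) (hm : 0 < ∫ w, w ∂μ) {d : ℝ} (hd : 0 < d)
    (hlat : ∀ᵐ w ∂μ, ∃ k : ℤ, w = k * d) (hper : d ∈ asymptoticPeriods F) :
    ∃ ϖ : ℝ → ℝ, Continuous ϖ ∧ Function.Periodic ϖ d ∧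
      Tendsto (fun x => F x - ϖ x) atTop (𝓝 0) := by
  have hF := h.uc.continuous
  -- Steps are natural multiples of d, so `⌊w / d⌋₊` is their exact number of units, in a measurable
  -- form.
  have hlat' : ∀ᵐ w ∂μ, ∃ k : ℕ, w = k * d := by
    filter_upwards [hpos, hlat] with w hw ⟨k, hk⟩
    have hk0 : 0 ≤ k := by
      by_contra! hneg
      have : (k : ℝ) < 0 := by exact_mod_cast hneg
      nlinarith
    lift k to ℕ using hk0
    exact ⟨k, by exact_mod_cast hk⟩
  have hfloor : ∀ k : ℕ, ⌊(k * d) / d⌋₊ = k := fun k => by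
    rw [mul_div_cancel_right₀ _ hd.ne', Nat.floor_natCast]
  have hfm : Measurable fun w : ℝ => ⌊w / d⌋₊ := Nat.measurable_floor.comp (measurable_id.div_const d)
  have hfi : Integrable (fun w : ℝ => (⌊w / d⌋₊ : ℝ)) μ := by
    refine (hμ.div_const d).congr ?_
    filter_upwards [hlat'] with w ⟨k, hk⟩
    rw [hk, hfloor]; field_simp
  set m := ∫ w, w ∂μ with hmdef
  have hfint : ∫ w, (⌊w / d⌋₊ : ℝ) ∂μ = m / d := by
    rw [hmdef, ← integral_div]
    refine integral_congr_ae ?_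
    filter_upwards [hlat'] with w ⟨k, hk⟩
    rw [hk, hfloor]; field_simp
  -- The discrete conserved quantity on the coset X + dℤ; moving by d changes it by exactly one
  -- value of the defect.
  set J : ℝ → ℝ := fun X => ∫ w, ∑ i ∈ Finset.range ⌊w / d⌋₊, F (X - i * d) ∂μ with hJ
  have hsm : ∀ G : ℕ → ℝ, AEStronglyMeasurable (fun w : ℝ => ∑ i ∈ Finset.range ⌊w / d⌋₊, G i) μ :=
    fun G => ((measurable_from_nat (f := fun k => ∑ i ∈ Finset.range k, G i)).comp
      hfm).aestronglyMeasurable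
  have hsb : ∀ (G : ℕ → ℝ) (D : ℝ), (∀ i, |G i| ≤ D) → ∀ w : ℝ,
      ‖∑ i ∈ Finset.range ⌊w / d⌋₊, G i‖ ≤ D * ⌊w / d⌋₊ := fun G D hG w => by
    refine (norm_sum_le_of_le _ fun i _ => hG i).trans_eq ?_
    simp [mul_comm]
  have hJi : ∀ X, Integrable (fun w => ∑ i ∈ Finset.range ⌊w / d⌋₊, F (X - i * d)) μ := fun X =>
    (hfi.const_mul B).mono' (hsm _) (Eventually.of_forall fun w => hsb _ _ (fun i => h.bdd _) w)
  have hstep : ∀ X, J (X + d) - J X = F (X + d) - ∫ w, F (X + d - w) ∂μ := by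
    intro X
    have h1 : ∫ w, (F (X + d) - F (X + d - w)) ∂μ = F (X + d) - ∫ w, F (X + d - w) ∂μ := by
      rw [integral_sub (integrable_const _) (integrable_comp_sub hF h.bdd _)]; simp
    rw [← h1, hJ]
    simp only
    rw [← integral_sub (hJi _) (hJi _)]
    refine integral_congr_ae ?_
    filter_upwards [hlat'] with w ⟨k, hk⟩
    rw [hk, hfloor, ← Finset.sum_sub_distrib]
    have h2 := Finset.sum_range_sub' (fun i : ℕ => F (X + d - i * d)) k
    simp only [Nat.cast_zero, zero_mul, sub_zero] at h2
    rw [← h2]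
    refine Finset.sum_congr rfl fun i _ => ?_
    congr 2
    push_cast; ring
  have hE : Tendsto (fun X => J X - m / d * F X) atTop (𝓝 0) := by
    have h3 : ∀ X, J X - m / d * F X =
        ∫ w, ∑ i ∈ Finset.range ⌊w / d⌋₊, (F (X - i * d) - F X) ∂μ := by
      intro X
      rw [← hfint, ← integral_mul_const, ← integral_sub (hJi X) (hfi.mul_const _)]
      congr 1 with w
      simp
    simp_rw [h3]
    suffices h0 : Tendsto _ atTop (𝓝 (∫ _, (0 : ℝ) ∂μ)) by simpa only [integral_zero] using h0
    refine tendsto_integral_filter_of_dominated_convergence (fun w => 2 * B * ⌊w / d⌋₊)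
      (Eventually.of_forall fun X => hsm _) (Eventually.of_forall fun X =>
        Eventually.of_forall fun w => hsb _ _ (fun i => h.abs_sub_le _ _) w) (hfi.const_mul _)
      (Eventually.of_forall fun w => ?_)
    rw [← Finset.sum_const_zero (s := Finset.range ⌊w / d⌋₊)]
    refine tendsto_finsetSum _ fun i _ => ?_
    have h4 := (mem_asymptoticPeriods.1 ((asymptoticPeriods F).nsmul_mem hper i)).neg
    rw [neg_zero] at h4
    exact h4.congr fun x => by simp
  set q := Real.exp (-ε * d) with hq
  have hq0 : 0 < q := Real.exp_pos _
  have hq1 : q < 1 := by rw [hq, Real.exp_lt_one_iff]; nlinarith [h.pos]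
  have hC : 0 ≤ C := by simpa using (abs_nonneg _).trans (h.defect 0 le_rfl)
  have hJk : ∀ X, 0 ≤ X → ∀ k : ℕ, |J (X + k * d) - J X| ≤
      C * Real.exp (-ε * X) * (1 - q)⁻¹ := by
    intro X hX k
    have h1 := Finset.sum_range_sub (fun i : ℕ => J (X + i * d)) k
    simp only [Nat.cast_zero, zero_mul, add_zero] at h1
    rw [← h1]
    refine (Finset.abs_sum_le_sum_abs _ _).trans ?_
    calc _ ≤ ∑ i ∈ Finset.range k, C * Real.exp (-ε * X) * q ^ i := by
          refine Finset.sum_le_sum fun i _ => ?_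
          have h2 := hstep (X + i * d)
          rw [show X + i * d + d = X + (i + 1 : ℕ) * d by push_cast; ring] at h2
          rw [h2]
          refine (h.defect _ (by positivity)).trans ?_
          rw [mul_assoc, hq, ← Real.exp_nat_mul, ← Real.exp_add]
          refine mul_le_mul_of_nonneg_left (Real.exp_le_exp.2 ?_) hC
          push_cast
          nlinarith [mul_pos h.pos hd]
      _ ≤ _ := by
          rw [← Finset.mul_sum]
          refine mul_le_mul_of_nonneg_left ?_ (by positivity)
          rw [← tsum_geometric_of_lt_one hq0.le hq1]
          exact (summable_geometric_of_lt_one hq0.le hq1).sum_le_tsum _ fun i _ => by positivity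
  -- J varies by a geometric tail along the coset, and F is asymptotically J divided by m / d. The
  -- bound is uniform in k and over all X beyond X₀, hence over all cosets.
  have hmain : ∀ η > 0, ∃ X₀, ∀ X, X₀ ≤ X → ∀ k : ℕ, |F (X + k * d) - F X| ≤ η := by
    intro η hη
    have hexp : Tendsto (fun X => C * Real.exp (-ε * X) * (1 - q)⁻¹) atTop (𝓝 0) := by
      have h1 : Tendsto (fun X => Real.exp (-ε * X)) atTop (𝓝 0) :=
        Real.tendsto_exp_atBot.comp (tendsto_id.const_mul_atTop_of_neg (neg_lt_zero.2 h.pos))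
      simpa using (h1.const_mul C).mul_const (1 - q)⁻¹
    set η' := m / d * η / 3 with hη'
    have hη'0 : 0 < η' := by positivity
    have h2 : ∀ᶠ X in atTop, |J X - m / d * F X| < η' := by
      simpa using hE.abs.eventually_lt_const (by simpa using hη'0)
    obtain ⟨X₀, hX₀⟩ := (h2.and ((hexp.eventually_lt_const hη'0).and
      (eventually_ge_atTop 0))).exists_forall_of_atTop
    refine ⟨X₀, fun X hX k => ?_⟩
    obtain ⟨h3, h4, h5⟩ := hX₀ X hX
    obtain ⟨h6, -⟩ := hX₀ (X + k * d) (by nlinarith [mul_nonneg (Nat.cast_nonneg (α := ℝ) k) hd.le])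
    have h7 := (hJk X h5 k).trans h4.le
    have h8 : m / d * |F (X + k * d) - F X| ≤ m / d * η := by
      rw [← abs_of_pos (show 0 < m / d by positivity), ← abs_mul,
        abs_of_pos (show 0 < m / d by positivity)]
      rw [show m / d * η = 3 * η' by rw [hη']; ring]
      rw [abs_lt] at h3 h6
      rw [abs_le] at h7 ⊢
      constructor <;> linarith [h3.1, h3.2, h6.1, h6.2, h7.1, h7.2]
    exact le_of_mul_le_mul_left h8 (by positivity)
  have hcau : ∀ x, CauchySeq fun k : ℕ => F (x + k * d) := by
    intro x
    rw [Metric.cauchySeq_iff']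
    intro η hη
    obtain ⟨X₀, hX₀⟩ := hmain (η / 2) (half_pos hη)
    obtain ⟨N, hN⟩ := exists_nat_ge ((X₀ - x) / d)
    rw [div_le_iff₀ hd] at hN
    refine ⟨N, fun n hn => ?_⟩
    have h1 := hX₀ (x + N * d) (by linarith) (n - N)
    rw [Nat.cast_sub hn, show x + N * d + ((n : ℝ) - N) * d = x + n * d by ring] at h1
    rw [Real.dist_eq]; linarith
  choose ϖ hϖ using fun x => cauchySeq_tendsto_of_complete (hcau x)
  refine ⟨ϖ, ?_, fun x => ?_, ?_⟩
  · refine Metric.continuous_iff.2 fun x η hη => ?_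
    obtain ⟨δ, hδ, hd⟩ := Metric.uniformContinuous_iff.1 h.uc (η / 2) (half_pos hη)
    refine ⟨δ, hδ, fun y hy => ?_⟩
    have h1 := (hϖ y).dist (hϖ x)
    refine (le_of_tendsto h1 (Eventually.of_forall fun k => (hd (a := y + k * d) (b := x + k * d)
      ?_).le)).trans_lt (half_lt_self hη)
    simpa using hy
  · refine tendsto_nhds_unique (hϖ (x + d)) (((tendsto_add_atTop_iff_nat 1).2 (hϖ x)).congr
      fun k => ?_)
    push_cast; ring_nf
  · rw [Metric.tendsto_nhds]
    intro η hη
    obtain ⟨X₀, hX₀⟩ := hmain (η / 2) (half_pos hη)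
    filter_upwards [eventually_ge_atTop X₀] with X hX
    have h1 : |ϖ X - F X| ≤ η / 2 :=
      le_of_tendsto ((hϖ X).sub_const (F X)).abs (Eventually.of_forall fun k => hX₀ X hX k)
    rw [Real.dist_eq, sub_zero, abs_sub_comm]
    linarith

end IsAlmostHarmonic

end SplitTree

/-! ### The step law, its support and the span -/

namespace SplitTree

open Topology

variable {b : ℕ} {s s₀ s₁ : ℕ} {ν : Measure (Fin b → ℝ)} [IsProbabilityMeasure ν] {β : ℝ}

/-- The law of `-ln V_i` under the probability measure with density `V_i ^ β`, summed over `i`. -/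
noncomputable def stepLaw (ν : Measure (Fin b → ℝ)) (β : ℝ) : Measure ℝ :=
  ∑ i, (ν.withDensity fun v => ENNReal.ofReal (v i ^ β)).map fun v => -Real.log (v i)

theorem measurable_entry_rpow (β : ℝ) (i : Fin b) : Measurable fun v : Fin b → ℝ => v i ^ β :=
  (measurable_pi_apply i).pow_const β

theorem measurable_neg_log_entry (i : Fin b) : Measurable fun v : Fin b → ℝ => -Real.log (v i) :=
  (Real.measurable_log.comp (measurable_pi_apply i)).neg

/-- The density V_i^β is positive exactly where V_i is, so vanishing entries are not charged and the
convention ln 0 = 0 is harmless. -/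
theorem ae_stepLaw_iff (hν : IsSubstochastic ν) (hβ : 0 < β) {p : ℝ → Prop} (hp : MeasurableSet {w | p w}) :
    (∀ᵐ w ∂stepLaw ν β, p w) ↔ ∀ i, ∀ᵐ v ∂ν, v i ≠ 0 → p (-Real.log (v i)) := by
  have h1 : (∀ᵐ w ∂stepLaw ν β, p w) ↔ ∀ i, ∀ᵐ w ∂((ν.withDensity fun v =>
      ENNReal.ofReal (v i ^ β)).map fun v => -Real.log (v i)), p w := by
    simp [ae_iff, stepLaw, Measure.finsetSum_apply, Finset.sum_eq_zero_iff]
  rw [h1]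
  refine forall_congr' fun i => ?_
  rw [ae_map_iff (measurable_neg_log_entry i).aemeasurable hp,
    ae_withDensity_iff (measurable_entry_rpow β i).ennreal_ofReal]
  refine eventually_congr ?_
  filter_upwards [hν] with v hv
  rcases (hv.1 i).eq_or_lt with h0 | h0
  · simp [← h0, hβ.ne']
  · simp [h0.ne', Real.rpow_pos_of_pos h0 β]

theorem integral_stepLaw (hν : IsSubstochastic ν) {g : ℝ → ℝ} (hg : Measurable g) {D : ℝ}
    (hD : ∀ x, 0 ≤ x → x ≤ 1 → |x ^ β * g (-Real.log x)| ≤ D) :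
    Integrable g (stepLaw ν β) ∧
      ∫ w, g w ∂stepLaw ν β = ∫ v, ∑ i, v i ^ β * g (-Real.log (v i)) ∂ν := by
  have hm (i : Fin b) : Measurable fun v : Fin b → ℝ => v i ^ β * g (-Real.log (v i)) :=
    (measurable_entry_rpow β i).mul (hg.comp (measurable_neg_log_entry i))
  have hI (i : Fin b) : Integrable (fun v : Fin b → ℝ => v i ^ β * g (-Real.log (v i))) ν := by
    refine Integrable.of_bound (hm i).aestronglyMeasurable D ?_
    filter_upwards [hν] with v hv
    exact hD _ (hv.1 i) (IsSubstochastic.le_one hv i)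
  have hae (i : Fin b) : (fun v : Fin b → ℝ => (ENNReal.ofReal (v i ^ β)).toReal •
      g (-Real.log (v i))) =ᵐ[ν] fun v => v i ^ β * g (-Real.log (v i)) := by
    filter_upwards [hν] with v hv
    rw [ENNReal.toReal_ofReal (Real.rpow_nonneg (hv.1 i) _), smul_eq_mul]
  have h1 (i : Fin b) : Integrable g ((ν.withDensity fun v =>
      ENNReal.ofReal (v i ^ β)).map fun v => -Real.log (v i)) := by
    rw [integrable_map_measure hg.aestronglyMeasurable (measurable_neg_log_entry i).aemeasurable,
      integrable_withDensity_iff_integrable_smul' (measurable_entry_rpow β i).ennreal_ofReal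
        (by simp)]
    exact (integrable_congr (hae i)).2 (hI i)
  refine ⟨integrable_finsetSum_measure.2 fun i _ => h1 i, ?_⟩
  rw [stepLaw, integral_finsetSum_measure fun i _ => h1 i, integral_finsetSum _ fun i _ => hI i]
  refine Finset.sum_congr rfl fun i _ => ?_
  rw [integral_map (measurable_neg_log_entry i).aemeasurable hg.aestronglyMeasurable,
    integral_withDensity_eq_integral_toReal_smul (measurable_entry_rpow β i).ennreal_ofReal
      (by simp)]
  exact integral_congr_ae (hae i)

/-- The functions that describe the fluctuations: continuous, periodic with the span of the split
vector as period, and constant in the nonlattice case. -/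
structure IsFluctuation (ν : Measure (Fin b → ℝ)) (ϖ : ℝ → ℝ) : Prop where
  cont : Continuous ϖ
  periodic : Function.Periodic ϖ (span ν)
  const : ¬ IsLattice ν → ∃ c, ∀ x, ϖ x = c

namespace IsAdmissible

theorem isProbabilityMeasure_stepLaw (H : IsAdmissible s s₀ s₁ ν β) :
    IsProbabilityMeasure (stepLaw ν β) := by
  have h1 := integral_stepLaw (β := β) H.sub (g := fun _ => 1) measurable_const (D := 1)
    fun x h0 h1 => by
      rw [mul_one, abs_of_nonneg (Real.rpow_nonneg h0 _)]
      exact Real.rpow_le_one h0 h1 H.pos.le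
  have hfin : IsFiniteMeasure (stepLaw ν β) := by
    rw [← integrable_const_iff_isFiniteMeasure (one_ne_zero (α := ℝ))]; exact h1.1
  refine ⟨?_⟩
  have h2 := h1.2
  simp only [mul_one] at h2
  rw [show ∫ v, ∑ i, v i ^ β ∂ν = 1 from H.moment_eq] at h2
  simp only [integral_const, smul_eq_mul, mul_one, measureReal_def] at h2
  exact (ENNReal.toReal_eq_one_iff _).1 h2

theorem stepLaw_nonneg (H : IsAdmissible s s₀ s₁ ν β) : ∀ᵐ w ∂stepLaw ν β, 0 ≤ w := by
  refine (ae_stepLaw_iff H.sub H.pos measurableSet_Ici).2 fun i => ?_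
  filter_upwards [H.sub] with v hv _
  exact neg_nonneg.2 (Real.log_nonpos (hv.1 i) (IsSubstochastic.le_one hv i))

theorem abs_rpow_mul_neg_log_le (H : IsAdmissible s s₀ s₁ ν β) (x : ℝ) (h0 : 0 ≤ x) (h1 : x ≤ 1) :
    |x ^ β * -Real.log x| ≤ 1 / β := by
  rcases h0.eq_or_lt with rfl | h0
  · simp [H.pos.le]
  · rw [mul_neg, abs_neg, mul_comm]
    exact (Real.abs_log_mul_self_rpow_lt x β h0 h1 H.pos).le

theorem integrable_stepLaw (H : IsAdmissible s s₀ s₁ ν β) :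
    Integrable (fun w : ℝ => w) (stepLaw ν β) :=
  (integral_stepLaw H.sub measurable_id H.abs_rpow_mul_neg_log_le).1

/-- A mean of 0 would force ln V_i = 0 at all nonzero entries, contradicting nondegeneracy. -/
theorem integral_stepLaw_pos (H : IsAdmissible s s₀ s₁ ν β) : 0 < ∫ w, w ∂stepLaw ν β := by
  by_contra! h
  have h1 := (integral_eq_zero_iff_of_nonneg_ae H.stepLaw_nonneg H.integrable_stepLaw).1
    (le_antisymm h (integral_nonneg_of_ae H.stepLaw_nonneg))
  have h2 := (ae_stepLaw_iff H.sub H.pos (p := fun w => w = 0) (measurableSet_singleton 0)).1 h1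
  refine H.nondeg ?_
  filter_upwards [ae_all_iff.2 h2, H.sub] with v hv hv' i
  by_contra! hne
  have h3 := hv i hne.1
  have h4 := Real.log_neg ((hv'.1 i).lt_of_ne' hne.1)
    ((IsSubstochastic.le_one hv' i).lt_of_ne hne.2)
  linarith

theorem mem_latticeSpans_iff (H : IsAdmissible s s₀ s₁ ν β) {d : ℝ} :
    d ∈ latticeSpans ν ↔ 0 < d ∧ ∀ᵐ w ∂stepLaw ν β, ∃ k : ℤ, w = k * d := by
  have hms : MeasurableSet {w : ℝ | ∃ k : ℤ, w = k * d} := by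
    have : {w : ℝ | ∃ k : ℤ, w = k * d} = Set.range fun k : ℤ => k * d := by
      ext; simp [eq_comm]
    rw [this]; exact (Set.countable_range _).measurableSet
  rw [ae_stepLaw_iff H.sub H.pos hms]
  refine and_congr_right fun _ => forall_congr' fun i => eventually_congr
    (Eventually.of_forall fun v => imp_congr_right fun _ => ?_)
  constructor
  · rintro ⟨k, hk⟩; exact ⟨-k, by rw [hk]; push_cast; ring⟩
  · rintro ⟨k, hk⟩; exact ⟨-k, by push_cast; linarith⟩

theorem mem_zmultiples_iff {d w : ℝ} : w ∈ AddSubgroup.zmultiples d ↔ ∃ k : ℤ, w = k * d := by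
  simp [AddSubgroup.mem_zmultiples_iff, eq_comm]

/-- In the lattice case, the span generates the group generated by the support of the step law;
in the nonlattice case, this group is dense. -/
theorem closure_support (H : IsAdmissible s s₀ s₁ ν β) :
    (IsLattice ν → AddSubgroup.closure (stepLaw ν β).support = AddSubgroup.zmultiples (span ν) ∧
      span ν ∈ latticeSpans ν) ∧
    (¬ IsLattice ν → Dense (AddSubgroup.closure (stepLaw ν β).support : Set ℝ)) := by
  have hP := H.isProbabilityMeasure_stepLaw
  set μ := stepLaw ν β
  set Γ := AddSubgroup.closure μ.support with hΓ
  have hsupp : ∀ᵐ w ∂μ, w ∈ Γ := by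
    filter_upwards [Measure.support_mem_ae (μ := μ)] with w hw using AddSubgroup.subset_closure hw
  have hle : ∀ d ∈ latticeSpans ν, Γ ≤ AddSubgroup.zmultiples d := by
    intro d hd
    rw [hΓ, AddSubgroup.closure_le]
    refine Measure.support_subset_of_isClosed (AddSubgroup.isClosed_of_discrete) ?_
    filter_upwards [(H.mem_latticeSpans_iff.1 hd).2] with w hw
    exact mem_zmultiples_iff.2 hw
  -- The generator is nonzero because the step law has positive mean.
  have hcyc : ∀ a, Γ = AddSubgroup.zmultiples a → |a| ∈ latticeSpans ν := by
    intro a ha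
    refine H.mem_latticeSpans_iff.2 ⟨abs_pos.2 ?_, ?_⟩
    · rintro rfl
      refine H.integral_stepLaw_pos.ne' (integral_eq_zero_of_ae ?_)
      filter_upwards [hsupp] with w hw
      rw [ha] at hw
      simpa using hw
    · filter_upwards [hsupp] with w hw
      rw [ha, mem_zmultiples_iff] at hw
      obtain ⟨k, hk⟩ := hw
      rcases abs_choice a with h | h
      · exact ⟨k, by rw [h, hk]⟩
      · exact ⟨-k, by rw [h, hk]; push_cast; ring⟩
  constructor
  · rintro ⟨d, hd⟩
    have hnd : ¬ Dense (Γ : Set ℝ) := by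
      intro hden
      have h1 : Dense (AddSubgroup.zmultiples d : Set ℝ) := hden.mono (hle d hd)
      have h2 : IsClosed (AddSubgroup.zmultiples d : Set ℝ) := AddSubgroup.isClosed_of_discrete
      have h3 : d / 2 ∈ (AddSubgroup.zmultiples d : Set ℝ) := by
        rw [h2.closure_eq.symm.trans h1.closure_eq]; trivial
      obtain ⟨k, hk⟩ := mem_zmultiples_iff.1 h3
      have hd0 := hd.1
      have h4 : (k : ℝ) * 2 = 1 := by
        field_simp at hk; linarith
      have h5 : k * 2 = 1 := by exact_mod_cast h4
      omega
    obtain ⟨a, ha⟩ := Γ.dense_or_cyclic.resolve_left hnd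
    rw [← AddSubgroup.zmultiples_eq_closure] at ha
    have hmem := hcyc a ha
    -- Every lattice span e contains a in its group, so a is a nonzero multiple of e and e ≤ |a|.
    have hgr : IsGreatest (latticeSpans ν) |a| := by
      refine ⟨hmem, fun e he => ?_⟩
      have h1 : a ∈ AddSubgroup.zmultiples e :=
        hle e he (ha ▸ AddSubgroup.mem_zmultiples a)
      obtain ⟨k, hk⟩ := mem_zmultiples_iff.1 h1
      have hk0 : k ≠ 0 := by
        rintro rfl
        have := hmem.1
        rw [hk] at this; simp at this
      rw [hk, abs_mul, abs_of_pos he.1]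
      have : (1 : ℝ) ≤ |(k : ℝ)| := by exact_mod_cast Int.one_le_abs hk0
      exact le_mul_of_one_le_left he.1.le this
    have hspan : span ν = |a| := hgr.csSup_eq
    rw [hspan, ha]
    refine ⟨?_, hmem⟩
    rcases abs_choice a with h | h <;> rw [h]
    exact AddSubgroup.zmultiples_neg.symm
  · intro hnl
    refine Γ.dense_or_cyclic.resolve_right ?_
    rintro ⟨a, ha⟩
    rw [← AddSubgroup.zmultiples_eq_closure] at ha
    exact hnl ⟨_, hcyc a ha⟩

theorem exists_isFluctuation (H : IsAdmissible s s₀ s₁ ν β) {F : ℝ → ℝ} {B C ε : ℝ}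
    (h : IsAlmostHarmonic (stepLaw ν β) F B C ε) :
    ∃ ϖ, IsFluctuation ν ϖ ∧ Tendsto (fun x => F x - ϖ x) atTop (𝓝 0) := by
  have hP := H.isProbabilityMeasure_stepLaw
  have hsub : AddSubgroup.closure (stepLaw ν β).support ≤ asymptoticPeriods F :=
    (AddSubgroup.closure_le _).2 (h.support_subset H.integrable_stepLaw)
  by_cases hl : IsLattice ν
  · obtain ⟨h1, h2⟩ := H.closure_support.1 hl
    obtain ⟨ϖ, hc, hp, ht⟩ := h.exists_periodic H.integrable_stepLaw H.stepLaw_nonneg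
      H.integral_stepLaw_pos h2.1 (H.mem_latticeSpans_iff.1 h2).2
      (hsub (h1 ▸ AddSubgroup.mem_zmultiples _))
    exact ⟨ϖ, ⟨hc, hp, fun h => absurd hl h⟩, ht⟩
  · have hd := H.closure_support.2 hl
    have hall : ∀ y, y ∈ asymptoticPeriods F := fun y => by
      have := (isClosed_asymptoticPeriods h.uc).closure_subset_iff.2 hsub
      exact this (hd y)
    obtain ⟨c, hc⟩ := h.exists_tendsto H.integrable_stepLaw H.integral_stepLaw_pos hall
    refine ⟨fun _ => c, ⟨continuous_const, fun _ => rfl, fun _ => ⟨c, fun _ => rfl⟩⟩, ?_⟩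
    simpa using hc.sub_const c

/-- In the nonlattice case `span ν` is 0 and carries no information, but a constant has every
period. -/
theorem _root_.SplitTree.IsFluctuation.exists_pos_periodic (H : IsAdmissible s s₀ s₁ ν β)
    {ϖ : ℝ → ℝ} (h : IsFluctuation ν ϖ) : ∃ d, 0 < d ∧ Function.Periodic ϖ d := by
  by_cases hl : IsLattice ν
  · exact ⟨span ν, (H.closure_support.1 hl).2.1, h.periodic⟩
  · obtain ⟨c, hc⟩ := h.const hl
    exact ⟨1, one_pos, fun x => by rw [hc, hc]⟩

end IsAdmissible

end SplitTree

/-! ### Extension to the line and finitely supported tolls -/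

namespace SplitTree

open Topology

section holder

variable {f : ℕ → ℝ} {L β : ℝ}

/-- The McShane extension of a Hölder continuous sequence to the real line. -/
noncomputable def holderExtension (f : ℕ → ℝ) (L β t : ℝ) : ℝ :=
  ⨅ n : ℕ, f n + L * |t - n| ^ β

/-- A Hölder continuous sequence starting at `0`. -/
structure IsHolderSeq (f : ℕ → ℝ) (L β : ℝ) : Prop where
  zero : f 0 = 0
  nonneg : 0 ≤ L
  pos : 0 < β
  le_one : β ≤ 1
  holder : ∀ n k : ℕ, |f (n + k) - f n| ≤ L * (k : ℝ) ^ β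

namespace IsHolderSeq

theorem abs_sub_le (h : IsHolderSeq f L β) (n k : ℕ) :
    |f n - f k| ≤ L * |(n : ℝ) - k| ^ β := by
  rcases le_total k n with hkn | hkn
  · obtain ⟨j, rfl⟩ := Nat.exists_eq_add_of_le hkn
    simpa using h.holder k j
  · obtain ⟨j, rfl⟩ := Nat.exists_eq_add_of_le hkn
    rw [abs_sub_comm, abs_sub_comm (n : ℝ)]
    simpa using h.holder n j

theorem abs_add_rpow_le (h : IsHolderSeq f L β) (x y : ℝ) :
    |x + y| ^ β ≤ |x| ^ β + |y| ^ β :=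
  (Real.rpow_le_rpow (abs_nonneg _) (abs_add_le x y) h.pos.le).trans
    (Real.rpow_add_le_add_rpow (abs_nonneg _) (abs_nonneg _) h.pos.le h.le_one)

theorem bddBelow (h : IsHolderSeq f L β) (t : ℝ) :
    BddBelow (Set.range fun n : ℕ => f n + L * |t - n| ^ β) := by
  refine ⟨-(L * |t| ^ β), ?_⟩
  rintro _ ⟨n, rfl⟩
  have h1 := (abs_le.1 (h.abs_sub_le n 0)).1
  have h2 := mul_le_mul_of_nonneg_left (h.abs_add_rpow_le (n - t) t) h.nonneg
  rw [sub_add_cancel, abs_sub_comm] at h2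
  simp only [h.zero, sub_zero, Nat.cast_zero] at h1
  simp only
  linarith

theorem extension_natCast (h : IsHolderSeq f L β) (n : ℕ) : holderExtension f L β n = f n := by
  refine le_antisymm ?_ (le_ciInf fun k => ?_)
  · refine (ciInf_le (h.bddBelow n) n).trans_eq ?_
    simp [h.pos.ne']
  · linarith [(abs_le.1 (h.abs_sub_le n k)).2]

theorem extension_sub_le (h : IsHolderSeq f L β) (t u : ℝ) :
    holderExtension f L β t - holderExtension f L β u ≤ L * |t - u| ^ β := by
  rw [sub_le_iff_le_add, ← sub_le_iff_le_add']
  refine le_ciInf fun n => ?_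
  have h1 := ciInf_le (h.bddBelow t) n
  have h2 := mul_le_mul_of_nonneg_left (h.abs_add_rpow_le (t - u) (u - n)) h.nonneg
  rw [sub_add_sub_cancel] at h2
  rw [holderExtension]
  linarith

theorem abs_extension_sub_le (h : IsHolderSeq f L β) (t u : ℝ) :
    |holderExtension f L β t - holderExtension f L β u| ≤ L * |t - u| ^ β := by
  refine abs_le.2 ⟨?_, h.extension_sub_le t u⟩
  have := h.extension_sub_le u t
  rw [abs_sub_comm] at this
  linarith

theorem abs_extension_le (h : IsHolderSeq f L β) {t : ℝ} (ht : 0 ≤ t) :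
    |holderExtension f L β t| ≤ L * t ^ β := by
  have h1 := h.abs_extension_sub_le t 0
  have h2 := h.extension_natCast 0
  rw [Nat.cast_zero] at h2
  rwa [h2, h.zero, sub_zero, sub_zero, abs_of_nonneg ht] at h1

theorem continuous_extension (h : IsHolderSeq f L β) : Continuous (holderExtension f L β) := by
  refine continuous_iff_continuousAt.2 fun u => tendsto_iff_dist_tendsto_zero.2 ?_
  refine squeeze_zero (fun _ => dist_nonneg) (fun t => h.abs_extension_sub_le t u) ?_
  have h1 : Continuous fun t : ℝ => L * |t - u| ^ β :=
    continuous_const.mul ((continuous_id.sub continuous_const).abs.rpow_const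
      fun _ => Or.inr h.pos.le)
  simpa [h.pos.ne'] using h1.tendsto u

/-- The extension, normalized and on a logarithmic scale. -/
theorem bdd_profile (h : IsHolderSeq f L β) (x : ℝ) :
    |Real.exp (-β * x) * holderExtension f L β (Real.exp x)| ≤ L := by
  rw [abs_mul, abs_of_pos (Real.exp_pos _)]
  have h1 := mul_le_mul_of_nonneg_left (h.abs_extension_le (Real.exp_pos x).le)
    (Real.exp_pos (-β * x)).le
  refine h1.trans_eq ?_
  rw [← Real.exp_mul, mul_left_comm, ← Real.exp_add]
  ring_nf; simp

/-- The growth of exp(x) cancels: for x ≤ y, exp(-βy) (exp y - exp x)^β = (1 - exp(x - y))^β ≤ (y -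
x)^β. The change of the prefactor adds a Lipschitz term, since the profile is bounded by L. -/
theorem uniformContinuous_profile (h : IsHolderSeq f L β) :
    UniformContinuous fun x => Real.exp (-β * x) * holderExtension f L β (Real.exp x) := by
  have hβ := h.pos
  have hL := h.nonneg
  set F := fun x => Real.exp (-β * x) * holderExtension f L β (Real.exp x) with hF
  have key : ∀ x y, x ≤ y → |F y - F x| ≤ L * (y - x) ^ β + L * (β * (y - x)) := by
    intro x y hxy
    have h1 : F y - F x = Real.exp (-β * y) *
        (holderExtension f L β (Real.exp y) - holderExtension f L β (Real.exp x)) +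
        (Real.exp (-β * (y - x)) - 1) * F x := by
      simp only [hF]
      rw [sub_mul, ← mul_assoc (Real.exp (-β * (y - x))), ← Real.exp_add]
      ring_nf
    rw [h1]
    refine (abs_add_le _ _).trans (add_le_add ?_ ?_)
    · rw [abs_mul, abs_of_pos (Real.exp_pos _)]
      refine (mul_le_mul_of_nonneg_left (h.abs_extension_sub_le _ _) (Real.exp_pos _).le).trans ?_
      rw [mul_left_comm]
      refine mul_le_mul_of_nonneg_left ?_ hL
      rw [show -β * y = (-y) * β by ring, Real.exp_mul, ← Real.mul_rpow (Real.exp_pos _).le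
        (abs_nonneg _)]
      refine Real.rpow_le_rpow (by positivity) ?_ hβ.le
      rw [abs_of_nonneg (sub_nonneg.2 (Real.exp_le_exp.2 hxy)), mul_sub, ← Real.exp_add,
        ← Real.exp_add]
      have := Real.add_one_le_exp (-y + x)
      simp only [neg_add_cancel, Real.exp_zero]
      linarith
    · rw [abs_mul, mul_comm]
      refine mul_le_mul (h.bdd_profile x) ?_ (abs_nonneg _) hL
      have h2 : 0 ≤ β * (y - x) := mul_nonneg hβ.le (sub_nonneg.2 hxy)
      rw [abs_of_nonpos (by rw [sub_nonpos, Real.exp_le_one_iff]; linarith)]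
      have := Real.add_one_le_exp (-β * (y - x))
      linarith
  have key' : ∀ x y, |F x - F y| ≤ L * |x - y| ^ β + L * (β * |x - y|) := by
    intro x y
    rcases le_total x y with hxy | hxy
    · rw [abs_sub_comm, abs_sub_comm x, abs_of_nonneg (sub_nonneg.2 hxy)]; exact key x y hxy
    · rw [abs_of_nonneg (sub_nonneg.2 hxy)]; exact key y x hxy
  have hω : Tendsto (fun r : ℝ => L * |r| ^ β + L * (β * |r|)) (𝓝 0) (𝓝 0) := by
    have h1 : Continuous fun r : ℝ => L * |r| ^ β + L * (β * |r|) :=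
      (continuous_const.mul (continuous_abs.rpow_const fun _ => Or.inr hβ.le)).add
        (continuous_const.mul (continuous_const.mul continuous_abs))
    simpa [hβ.ne'] using h1.tendsto 0
  refine Metric.uniformContinuous_iff.2 fun ε hε => ?_
  obtain ⟨δ, hδ, hd⟩ := Metric.eventually_nhds_iff.1 (hω.eventually_lt_const hε)
  refine ⟨δ, hδ, fun {x y} hxy => ?_⟩
  rw [Real.dist_eq] at *
  have h1 := hd (y := x - y) (by simpa [Real.dist_eq] using hxy)
  exact (key' x y).trans_lt h1

end IsHolderSeq

end holder

variable {b : ℕ} {s s₀ s₁ : ℕ} {ν : Measure (Fin b → ℝ)} [IsProbabilityMeasure ν] {β : ℝ}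

namespace IsAdmissible

/-- At large integers this is the recursion without toll, with each child count replaced by n V_i at
a cost controlled by Hölder continuity and concentration. Small integers are absorbed into the
constant. -/
theorem exists_extension_defect (H : IsAdmissible s s₀ s₁ ν β) {a f : ℕ → ℝ}
    (hf : IsSolution s s₀ s₁ ν a f) {K : ℕ} (ha : ∀ n, K < n → a n = 0) {L : ℝ}
    (hL : IsHolderSeq f L β) : ∃ C, 0 ≤ C ∧ ∀ t : ℝ, 1 ≤ t →
      |holderExtension f L β t - ∫ v, ∑ i, holderExtension f L β (t * v i) ∂ν| ≤
        C * t ^ (β / 2) := by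
  have hβ := H.pos
  have hL0 := hL.nonneg
  set G := holderExtension f L β with hG
  have hGi (t : ℝ) (i : Fin b) : Integrable (fun v => G (t * v i)) ν :=
    integrable_comp_entry H.sub
      (hL.continuous_extension.comp (continuous_const.mul continuous_id)) i
  have hGs (t : ℝ) : Integrable (fun v => ∑ i, G (t * v i)) ν :=
    integrable_finsetSum _ fun i _ => hGi t i
  have hsum : ∀ (g : (Fin b → ℝ) → ℝ) (D : ℝ), (∀ᵐ v ∂ν, |g v| ≤ D) → |∫ v, g v ∂ν| ≤ D := by
    intro g D hg
    simpa using norm_integral_le_of_norm_le_const (μ := ν) (f := g) (C := D) hg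
  obtain ⟨C, hC, hb⟩ := H.exists_binomMean_abs_sub_le H.pos H.le_one
  set M := max K s
  have hnat : ∀ n : ℕ, 1 ≤ n → |G n - ∫ v, ∑ i, G (n * v i) ∂ν| ≤
      (L * (1 + b) * (M : ℝ) ^ β + b * (L * C)) * (n : ℝ) ^ (β / 2) := by
    intro n hn
    have hn1 : 1 ≤ (n : ℝ) ^ (β / 2) := Real.one_le_rpow (by exact_mod_cast hn) (by linarith)
    rw [hG, hL.extension_natCast, ← hG]
    rcases le_or_gt n M with hnM | hnM
    · have h1 : |f n| ≤ L * (M : ℝ) ^ β := by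
        have h2 := hL.abs_sub_le n 0
        rw [hL.zero, sub_zero, Nat.cast_zero, sub_zero, Nat.abs_cast] at h2
        exact h2.trans (mul_le_mul_of_nonneg_left (Real.rpow_le_rpow (Nat.cast_nonneg _)
          (by exact_mod_cast hnM) hβ.le) hL0)
      have h2 : |∫ v, ∑ i, G (n * v i) ∂ν| ≤ b * (L * (M : ℝ) ^ β) := by
        refine hsum _ _ ?_
        filter_upwards [H.sub] with v hv
        refine (Finset.abs_sum_le_sum_abs _ _).trans
          ((Finset.sum_le_card_nsmul _ _ (L * (M : ℝ) ^ β) fun i _ => ?_).trans_eq (by simp))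
        have h3 : 0 ≤ (n : ℝ) * v i := mul_nonneg (Nat.cast_nonneg n) (hv.1 i)
        refine (hL.abs_extension_le h3).trans
          (mul_le_mul_of_nonneg_left (Real.rpow_le_rpow h3 ?_ hβ.le) hL0)
        exact (mul_le_of_le_one_right (Nat.cast_nonneg n) (IsSubstochastic.le_one hv i)).trans
          (by exact_mod_cast hnM)
      have h3 : 0 ≤ L * (1 + b) * (M : ℝ) ^ β + b * (L * C) := by positivity
      have h4 : 0 ≤ b * (L * C) := by positivity
      refine (abs_sub _ _).trans ?_
      nlinarith
    · have hsn : s < n := (le_max_right _ _).trans_lt hnM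
      have h1 : |f n - ∫ v, ∑ i, G (n * v i) ∂ν| ≤ b * (L * C * (n : ℝ) ^ (β / 2)) := by
        rw [hf.of_lt n hsn, ha n ((le_max_left _ _).trans_lt hnM), zero_add, offspringMean,
          splitMean, ← integral_sub (integrable_sum_binomMean H.sub _ _) (hGs _)]
        refine hsum _ _ ?_
        filter_upwards [H.sub] with v hv
        rw [← Finset.sum_sub_distrib]
        refine (Finset.abs_sum_le_sum_abs _ _).trans
          ((Finset.sum_le_card_nsmul _ _ (L * C * (n : ℝ) ^ (β / 2)) fun i _ => ?_).trans_eq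
            (by simp))
        have hv0 := hv.1 i
        have hv1 := IsSubstochastic.le_one hv i
        rw [← binomMean_const (n - s₀ - b * s₁) (v i) (G (n * v i)), ← binomMean_sub, mul_assoc]
        refine (abs_binomMean_le hv0 hv1).trans (le_trans ?_
          (mul_le_mul_of_nonneg_left (hb n hsn (v i) hv0 hv1) hL0))
        rw [← binomMean_const_mul]
        refine binomMean_mono hv0 hv1 fun j _ => ?_
        rw [← hL.extension_natCast]
        exact hL.abs_extension_sub_le _ _
      have h2 : 0 ≤ L * (1 + b) * (M : ℝ) ^ β := by positivity
      nlinarith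
  refine ⟨(L * (1 + b) * (M : ℝ) ^ β + b * (L * C)) + L + b * L, by positivity, fun t ht => ?_⟩
  have ht0 : 0 ≤ t := by linarith
  -- Passing from t to its integer part moves every argument by at most 1, which costs L at t and b
  -- L in the sum.
  set n := ⌊t⌋₊
  have hn1 : 1 ≤ n := Nat.le_floor (by simpa using ht)
  have hnt : (n : ℝ) ≤ t := Nat.floor_le ht0
  have htn : t < n + 1 := Nat.lt_floor_add_one t
  have habs : |t - n| ≤ 1 := abs_le.2 ⟨by linarith, by linarith⟩
  have h1 : |G t - G n| ≤ L := (hL.abs_extension_sub_le _ _).trans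
    (mul_le_of_le_one_right hL0 (Real.rpow_le_one (abs_nonneg _) habs hβ.le))
  have h2 : |∫ v, ∑ i, G (n * v i) ∂ν - ∫ v, ∑ i, G (t * v i) ∂ν| ≤ b * L := by
    rw [← integral_sub (hGs _) (hGs _)]
    refine hsum _ _ ?_
    filter_upwards [H.sub] with v hv
    rw [← Finset.sum_sub_distrib]
    refine (Finset.abs_sum_le_sum_abs _ _).trans
      ((Finset.sum_le_card_nsmul _ _ L fun i _ => ?_).trans_eq (by simp))
    refine (hL.abs_extension_sub_le _ _).trans
      (mul_le_of_le_one_right hL0 (Real.rpow_le_one (abs_nonneg _) ?_ hβ.le))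
    rw [← sub_mul, abs_mul, abs_sub_comm, abs_of_nonneg (hv.1 i)]
    exact mul_le_one₀ habs (hv.1 i) (IsSubstochastic.le_one hv i)
  have h3 : (n : ℝ) ^ (β / 2) ≤ t ^ (β / 2) :=
    Real.rpow_le_rpow (Nat.cast_nonneg _) hnt (by linarith)
  have h4 : 1 ≤ t ^ (β / 2) := Real.one_le_rpow ht (by linarith)
  have h5 := (hnat n hn1).trans (mul_le_mul_of_nonneg_left h3 (by positivity))
  calc _ = |(G t - G n) + (G n - ∫ v, ∑ i, G (n * v i) ∂ν) +
        (∫ v, ∑ i, G (n * v i) ∂ν - ∫ v, ∑ i, G (t * v i) ∂ν)| := by ring_nf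
    _ ≤ _ := abs_add_three _ _ _
    _ ≤ L + (L * (1 + b) * (M : ℝ) ^ β + b * (L * C)) * t ^ (β / 2) + b * L :=
      add_le_add (add_le_add h1 h5) h2
    _ ≤ _ := by
      have h6 : 0 ≤ b * L := by positivity
      nlinarith

/-- Multiplying by exp(-βx) turns the sum over children into a mean under `stepLaw`, and the defect
t^(β/2) into exp(-βx/2). -/
theorem exists_isAlmostHarmonic (H : IsAdmissible s s₀ s₁ ν β) {a f : ℕ → ℝ}
    (hf : IsSolution s s₀ s₁ ν a f) {K : ℕ} (ha : ∀ n, K < n → a n = 0) {L : ℝ}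
    (hL : IsHolderSeq f L β) : ∃ C, IsAlmostHarmonic (stepLaw ν β)
      (fun x => Real.exp (-β * x) * holderExtension f L β (Real.exp x)) L C (β / 2) := by
  obtain ⟨C, hC, h⟩ := H.exists_extension_defect hf ha hL
  have hβ := H.pos
  refine ⟨C, hL.uniformContinuous_profile, hL.bdd_profile, half_pos hβ, fun x hx => ?_⟩
  set G := holderExtension f L β with hG
  have hGc : Continuous G := hL.continuous_extension
  have hmeas : Measurable fun w => Real.exp (-β * (x - w)) * G (Real.exp (x - w)) := by
    have : Continuous fun w => Real.exp (-β * (x - w)) * G (Real.exp (x - w)) := by fun_prop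
    exact this.measurable
  have h1 := (integral_stepLaw (β := β) H.sub hmeas (D := L) fun y h0 h1 => by
    rw [abs_mul, abs_of_nonneg (Real.rpow_nonneg h0 _)]
    exact (mul_le_of_le_one_left (abs_nonneg _) (Real.rpow_le_one h0 h1 hβ.le)).trans
      (hL.bdd_profile _)).2
  have h2 : ∫ v, ∑ i, v i ^ β * (Real.exp (-β * (x - -Real.log (v i))) *
      G (Real.exp (x - -Real.log (v i)))) ∂ν =
      Real.exp (-β * x) * ∫ v, ∑ i, G (Real.exp x * v i) ∂ν := by
    rw [← integral_const_mul]
    refine integral_congr_ae ?_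
    filter_upwards [H.sub] with v hv
    rw [Finset.mul_sum]
    refine Finset.sum_congr rfl fun i _ => ?_
    rcases (hv.1 i).eq_or_lt with h0 | h0
    -- Vanishing entries contribute nothing on either side: the weight V_i^β is 0, and the extension
    -- is 0 at 0.
    · have h3 := hL.extension_natCast 0
      rw [Nat.cast_zero, hL.zero] at h3
      rw [← h0, mul_zero, hG, h3, Real.zero_rpow hβ.ne']; simp
    · rw [sub_neg_eq_add, Real.exp_add, Real.exp_log h0, ← mul_assoc, Real.rpow_def_of_pos h0,
        ← Real.exp_add]
      congr 2; ring
  rw [h1, h2, ← mul_sub, abs_mul, abs_of_pos (Real.exp_pos _)]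
  refine (mul_le_mul_of_nonneg_left (h (Real.exp x) (Real.one_le_exp hx))
    (Real.exp_pos _).le).trans_eq ?_
  rw [← Real.exp_mul, mul_left_comm, ← Real.exp_add]
  congr 2; ring

/-- The asymptotics for finitely supported tolls. -/
theorem exists_fluctuation_of_finite_support (H : IsAdmissible s s₀ s₁ ν β)
    (hex : ∀ a, ∃ f, IsSolution s s₀ s₁ ν a f) {a f : ℕ → ℝ}
    (hf : IsSolution s s₀ s₁ ν a f) {K : ℕ} (ha : ∀ n, K < n → a n = 0) :
    ∃ ϖ, IsFluctuation ν ϖ ∧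
      Tendsto (fun n : ℕ => f n / (n : ℝ) ^ β - ϖ (Real.log n)) atTop (𝓝 0) := by
  have hβ := H.pos
  obtain ⟨C, hC, hbound⟩ := H.exists_solution_bound hex (γ := 3 / 4 * β) (by linarith) (by linarith)
  obtain ⟨L, hL0, hL⟩ := H.exists_holder hf ha
    (C := C * ∑ k ∈ Finset.range (K + 1), |a k|) (by positivity) (hbound a f hf _ fun n hn => by
      have h1 : 1 ≤ (n : ℝ) ^ (3 / 4 * β) := Real.one_le_rpow (by exact_mod_cast hn) (by positivity)
      have h2 : 0 ≤ ∑ k ∈ Finset.range (K + 1), |a k| := Finset.sum_nonneg fun _ _ => abs_nonneg _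
      refine le_trans ?_ (le_mul_of_one_le_right h2 h1)
      rcases le_or_gt n K with h | h
      · exact Finset.single_le_sum (f := fun k => |a k|) (fun _ _ => abs_nonneg _)
          (Finset.mem_range.2 (by omega))
      · rw [ha n h, abs_zero]; exact h2)
  have hS : IsHolderSeq f L β := ⟨hf.zero, hL0, H.pos, H.le_one, hL⟩
  obtain ⟨D, hD⟩ := H.exists_isAlmostHarmonic hf ha hS
  obtain ⟨ϖ, h1, h2⟩ := H.exists_isFluctuation hD
  refine ⟨ϖ, h1, ?_⟩
  refine (h2.comp (Real.tendsto_log_atTop.comp tendsto_natCast_atTop_atTop)).congr' ?_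
  filter_upwards [eventually_ge_atTop 1] with n hn
  have hn0 : (0 : ℝ) < n := by exact_mod_cast hn
  simp only [Function.comp_apply]
  rw [Real.exp_log hn0, hS.extension_natCast, Real.rpow_def_of_pos hn0, neg_mul, Real.exp_neg,
    mul_comm β, div_eq_inv_mul]

end IsAdmissible

end SplitTree

/-! ### Uniform limits and general small tolls -/

namespace SplitTree

open Topology

variable {b : ℕ} {s s₀ s₁ : ℕ} {ν : Measure (Fin b → ℝ)} [IsProbabilityMeasure ν] {β : ℝ}

namespace IsFluctuation

variable {ϖ ϖ' : ℝ → ℝ}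

theorem sub (h : IsFluctuation ν ϖ) (h' : IsFluctuation ν ϖ') :
    IsFluctuation ν fun x => ϖ x - ϖ' x where
  cont := h.cont.sub h'.cont
  periodic x := by simp only [h.periodic x, h'.periodic x]
  const hl := by
    obtain ⟨c, hc⟩ := h.const hl
    obtain ⟨c', hc'⟩ := h'.const hl
    exact ⟨c - c', fun x => by rw [hc, hc']⟩

theorem neg (h : IsFluctuation ν ϖ) : IsFluctuation ν fun x => -ϖ x where
  cont := h.cont.neg
  periodic x := by simp only [h.periodic x]
  const hl := by
    obtain ⟨c, hc⟩ := h.const hl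
    exact ⟨-c, fun x => by rw [hc]⟩

/-- A fluctuation is determined by its values at `ln n` for large `n`. -/
theorem le_of_eventually_le (H : IsAdmissible s s₀ s₁ ν β) (h : IsFluctuation ν ϖ) {A : ℝ}
    (hA : ∀ᶠ n : ℕ in atTop, ϖ (Real.log n) ≤ A) (x : ℝ) : ϖ x ≤ A := by
  obtain ⟨d, hd, hp⟩ := h.exists_pos_periodic H
  have hy : Tendsto (fun k : ℕ => Real.exp (x + k * d)) atTop atTop :=
    Real.tendsto_exp_atTop.comp (tendsto_atTop_add_const_left _ _
      (tendsto_natCast_atTop_atTop.atTop_mul_const hd))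
  -- The points ln n come arbitrarily close to x modulo d: take for n the integer part of exp(x + k
  -- d).
  have h1 : Tendsto (fun k : ℕ => Real.log ⌊Real.exp (x + k * d)⌋₊ - k * d) atTop (𝓝 x) := by
    have h2 := ((Real.continuousAt_log one_ne_zero).tendsto.comp
      ((tendsto_nat_floor_div_atTop (R := ℝ)).comp hy)).add_const x
    rw [Real.log_one, zero_add] at h2
    refine h2.congr' ?_
    filter_upwards [hy.eventually_ge_atTop 1] with k hk
    have h3 : (0 : ℝ) < ⌊Real.exp (x + k * d)⌋₊ := by
      exact_mod_cast Nat.floor_pos.2 hk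
    simp only [Function.comp_apply]
    rw [Real.log_div h3.ne' (Real.exp_pos _).ne', Real.log_exp]
    ring
  refine le_of_tendsto ((h.cont.tendsto x).comp h1) ?_
  filter_upwards [((tendsto_nat_floor_atTop (α := ℝ)).comp hy).eventually hA] with k hk
  simp only [Function.comp_apply] at hk ⊢
  rwa [hp.sub_nat_mul_eq]

theorem abs_le_of_eventually_le (H : IsAdmissible s s₀ s₁ ν β) (h : IsFluctuation ν ϖ) {A : ℝ}
    (hA : ∀ᶠ n : ℕ in atTop, |ϖ (Real.log n)| ≤ A) (x : ℝ) : |ϖ x| ≤ A :=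
  abs_le'.2 ⟨h.le_of_eventually_le H (hA.mono fun _ h => (abs_le'.1 h).1) x,
    h.neg.le_of_eventually_le H (hA.mono fun _ h => (abs_le'.1 h).2) x⟩

theorem of_uniform_limit {ϖs : ℕ → ℝ → ℝ} (h : ∀ K, IsFluctuation ν (ϖs K))
    (hlim : TendstoUniformly ϖs ϖ atTop) : IsFluctuation ν ϖ where
  cont := hlim.continuous (Frequently.of_forall fun K => (h K).cont)
  periodic x := tendsto_nhds_unique (hlim.tendsto_at (x + span ν))
    ((hlim.tendsto_at x).congr fun K => ((h K).periodic x).symm)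
  const hl := ⟨ϖ 0, fun x => tendsto_nhds_unique (hlim.tendsto_at x)
    ((hlim.tendsto_at 0).congr fun K => by
      obtain ⟨c, hc⟩ := (h K).const hl
      rw [hc, hc])⟩

end IsFluctuation

namespace IsAdmissible

/-- The asymptotics of solutions of the recursion with small toll. -/
theorem exists_fluctuation (H : IsAdmissible s s₀ s₁ ν β)
    (hex : ∀ a, ∃ f, IsSolution s s₀ s₁ ν a f) {a f : ℕ → ℝ} (hf : IsSolution s s₀ s₁ ν a f)
    {γ D : ℝ} (h0 : β / 2 < γ) (hγ : γ < β)
    (ha : ∀ n : ℕ, 1 ≤ n → |a n| ≤ D * (n : ℝ) ^ γ) :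
    (∃ C, ∀ n : ℕ, |f n| ≤ C * (n : ℝ) ^ β) ∧ ∃ ϖ, IsFluctuation ν ϖ ∧
      Tendsto (fun n : ℕ => f n / (n : ℝ) ^ β - ϖ (Real.log n)) atTop (𝓝 0) := by
  have hβ := H.pos
  have hD : 0 ≤ D := by simpa using (abs_nonneg _).trans (ha 1 le_rfl)
  obtain ⟨C₀, hC₀, hbound₀⟩ := H.exists_solution_bound hex h0 hγ
  refine ⟨⟨_, hbound₀ a f hf D ha⟩, ?_⟩
  -- Room between γ and β: beyond K, n^γ ≤ (K + 1)^(γ - γ') n^γ', and the growth bound at exponent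
  -- γ' turns this small factor into the error e K.
  set γ' := (γ + β) / 2 with hγ'
  obtain ⟨C, hC, hbound⟩ := H.exists_solution_bound hex (γ := γ') (by linarith) (by linarith)
  set aK : ℕ → ℕ → ℝ := fun K n => if n ≤ K then a n else 0
  choose fK hfK using fun K => hex (aK K)
  set e : ℕ → ℝ := fun K => C * (D * ((K : ℝ) + 1) ^ (γ - γ')) with he
  have he0 : ∀ K, 0 ≤ e K := fun K => by positivity
  have helim : Tendsto e atTop (𝓝 0) := by
    have h1 := ((tendsto_rpow_neg_atTop (show 0 < γ' - γ by linarith)).comp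
      (tendsto_atTop_add_const_right _ 1 (tendsto_natCast_atTop_atTop (R := ℝ))))
    simpa [he, neg_sub] using (h1.const_mul D).const_mul C
  have happ : ∀ K n, |f n - fK K n| ≤ e K * (n : ℝ) ^ β := by
    intro K
    refine hbound _ _ (hf.sub H (hfK K)) _ fun n hn => ?_
    simp only [aK]
    have hn0 : (0 : ℝ) < n := by exact_mod_cast hn
    split_ifs with hnK
    · rw [sub_self, abs_zero]; positivity
    · rw [sub_zero, mul_assoc]
      refine (ha n hn).trans (mul_le_mul_of_nonneg_left ?_ hD)
      have h1 : (n : ℝ) ^ γ = (n : ℝ) ^ (γ - γ') * (n : ℝ) ^ γ' := by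
        rw [← Real.rpow_add hn0]; ring_nf
      rw [h1]
      refine mul_le_mul_of_nonneg_right ?_ (by positivity)
      refine Real.rpow_le_rpow_of_nonpos (by positivity) ?_ (by linarith)
      exact_mod_cast (by omega : K + 1 ≤ n)
  have happ' : ∀ K, ∀ n : ℕ, 1 ≤ n → |f n / (n : ℝ) ^ β - fK K n / (n : ℝ) ^ β| ≤ e K := by
    intro K n hn
    have hn0 : (0 : ℝ) < (n : ℝ) ^ β := Real.rpow_pos_of_pos (by exact_mod_cast hn) _
    rw [← sub_div, abs_div, abs_of_pos hn0, div_le_iff₀ hn0]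
    exact happ K n
  choose ϖK hϖ hlim using fun K => H.exists_fluctuation_of_finite_support hex (hfK K) (K := K)
    fun n hn => by simp [aK, hn.not_ge]
  -- At x = ln n both fluctuations approximate f n / n^β up to e K and e J and a vanishing error;
  -- periodicity carries the bound to all x, uniformly.
  have hcau : ∀ K J x, |ϖK K x - ϖK J x| ≤ e K + e J := by
    intro K J x
    refine le_of_forall_pos_le_add fun η hη => ?_
    refine ((hϖ K).sub (hϖ J)).abs_le_of_eventually_le H ?_ x
    have h1 := (hlim K).abs.eventually_lt_const (show |(0 : ℝ)| < η / 2 by simpa using hη)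
    have h2 := (hlim J).abs.eventually_lt_const (show |(0 : ℝ)| < η / 2 by simpa using hη)
    filter_upwards [h1, h2, eventually_ge_atTop 1] with n h1 h2 hn
    have h3 := happ' K n hn
    have h4 := happ' J n hn
    rw [abs_lt] at h1 h2
    rw [abs_le] at h3 h4 ⊢
    constructor <;> linarith [h1.1, h1.2, h2.1, h2.2, h3.1, h3.2, h4.1, h4.2]
  have hcs : ∀ x, CauchySeq fun K => ϖK K x := by
    intro x
    refine Metric.cauchySeq_iff'.2 fun η hη => ?_
    obtain ⟨N, hN⟩ := (helim.eventually_lt_const (half_pos hη)).exists_forall_of_atTop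
    refine ⟨N, fun n hn => ?_⟩
    rw [Real.dist_eq]
    exact (hcau n N x).trans_lt (by linarith [hN n hn, hN N le_rfl])
  choose ϖ hϖlim using fun x => cauchySeq_tendsto_of_complete (hcs x)
  have hle : ∀ K x, |ϖK K x - ϖ x| ≤ e K := by
    intro K x
    refine le_of_tendsto_of_tendsto' ((tendsto_const_nhds (x := ϖK K x)).sub (hϖlim x)).abs
      ((tendsto_const_nhds (x := e K)).add helim) (fun J => hcau K J x) |>.trans_eq (add_zero _)
  have hunif : TendstoUniformly ϖK ϖ atTop := by
    refine Metric.tendstoUniformly_iff.2 fun η hη => ?_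
    filter_upwards [helim.eventually_lt_const hη] with K hK x
    rw [dist_comm, Real.dist_eq]
    exact (hle K x).trans_lt hK
  refine ⟨ϖ, IsFluctuation.of_uniform_limit hϖ hunif, ?_⟩
  refine Metric.tendsto_nhds.2 fun η hη => ?_
  obtain ⟨K, hK⟩ := (helim.eventually_lt_const (show 0 < η / 3 by positivity)).exists
  have h1 := (hlim K).abs.eventually_lt_const (show |(0 : ℝ)| < η / 3 by simpa using hη)
  filter_upwards [h1, eventually_ge_atTop 1] with n h1 hn
  have h2 := happ' K n hn
  have h3 := hle K (Real.log n)
  rw [Real.dist_eq, sub_zero]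
  rw [abs_lt] at h1 ⊢
  rw [abs_le] at h2 h3
  constructor <;> linarith [h1.1, h1.2, h2.1, h2.2, h3.1, h3.2]

theorem fluctuation_asymptotics (H : IsAdmissible s s₀ s₁ ν β)
    (hex : ∀ a, ∃ f, IsSolution s s₀ s₁ ν a f) {a f : ℕ → ℝ} (hf : IsSolution s s₀ s₁ ν a f)
    {δ : ℝ} (hδ : 0 < δ) (ha : a =O[atTop] fun n : ℕ => (n : ℝ) ^ (β - δ)) :
    ∃ ϖ : ℝ → ℝ, (∃ C : ℝ, ∀ x, |ϖ x| ≤ C) ∧ IsFluctuation ν ϖ ∧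
      (fun n : ℕ => f n - ϖ (Real.log n) * (n : ℝ) ^ β) =o[atTop] (fun n : ℕ => (n : ℝ) ^ β) ∧
      ((∀ n, 1 ≤ n → 0 ≤ a n) → (∃ n, 1 ≤ n ∧ s₁ ≤ n ∧ 0 < a n) →
        ∃ c : ℝ, 0 < c ∧ ∀ x, c ≤ ϖ x) := by
  have hβ := H.pos
  -- The lower cutoff 3β / 4 keeps the exponent above β / 2 when δ is large.
  set γ := max (β - δ) (3 / 4 * β) with hγ
  obtain ⟨C, hC⟩ := ha.bound
  obtain ⟨N, hN⟩ := hC.exists_forall_of_atTop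
  have hS : 0 ≤ ∑ k ∈ Finset.range N, |a k| := Finset.sum_nonneg fun _ _ => abs_nonneg _
  have ha' : ∀ n : ℕ, 1 ≤ n → |a n| ≤ (|C| + ∑ k ∈ Finset.range N, |a k|) * (n : ℝ) ^ γ := by
    intro n hn
    have hn1 : (1 : ℝ) ≤ n := by exact_mod_cast hn
    have h1 : 1 ≤ (n : ℝ) ^ γ := Real.one_le_rpow hn1 (by
      refine le_trans ?_ (le_max_right _ _); positivity)
    rcases lt_or_ge n N with h | h
    · have h2 := Finset.single_le_sum (f := fun k => |a k|) (fun _ _ => abs_nonneg _)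
        (Finset.mem_range.2 h)
      have h3 := abs_nonneg C
      exact (by linarith : |a n| ≤ |C| + ∑ k ∈ Finset.range N, |a k|).trans
        (le_mul_of_one_le_right (by positivity) h1)
    · have h2 := hN n h
      rw [Real.norm_eq_abs, Real.norm_of_nonneg (by positivity)] at h2
      refine h2.trans (mul_le_mul (by linarith [le_abs_self C])
        (Real.rpow_le_rpow_of_exponent_le hn1 (le_max_left _ _)) (by positivity) (by positivity))
  obtain ⟨⟨B, hB⟩, ϖ, hϖ, hlim⟩ := H.exists_fluctuation hex hf (γ := γ)
    ((by linarith : β / 2 < 3 / 4 * β).trans_le (le_max_right _ _))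
    (max_lt (by linarith) (by linarith)) ha'
  refine ⟨ϖ, ⟨B + 1, hϖ.abs_le_of_eventually_le H ?_⟩, hϖ, ?_, fun hnn hpos => ?_⟩
  · filter_upwards [hlim.abs.eventually_lt_const (show |(0 : ℝ)| < 1 by simp),
      eventually_ge_atTop 1] with n h1 hn
    have hn0 : (0 : ℝ) < (n : ℝ) ^ β := Real.rpow_pos_of_pos (by exact_mod_cast hn) _
    have h2 : |f n / (n : ℝ) ^ β| ≤ B := by
      rw [abs_div, abs_of_pos hn0, div_le_iff₀ hn0]; exact hB n
    rw [abs_lt] at h1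
    rw [abs_le] at h2 ⊢
    constructor <;> linarith [h1.1, h1.2, h2.1, h2.2]
  · rw [isLittleO_iff_tendsto']
    · refine hlim.congr' ?_
      filter_upwards [eventually_ge_atTop 1] with n hn
      have hn0 : (0 : ℝ) < (n : ℝ) ^ β := Real.rpow_pos_of_pos (by exact_mod_cast hn) _
      field_simp
    · filter_upwards [eventually_ge_atTop 1] with n hn h
      have hn0 : (0 : ℝ) < (n : ℝ) ^ β := Real.rpow_pos_of_pos (by exact_mod_cast hn) _
      exact absurd h hn0.ne'
  · obtain ⟨c, hc0, hc⟩ := H.exists_lower_bound hf hnn hpos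
    refine ⟨c / 2, half_pos hc0, fun x => ?_⟩
    have h1 := hϖ.neg.le_of_eventually_le H (A := -(c / 2)) ?_ x
    · linarith
    filter_upwards [hlim.abs.eventually_lt_const (show |(0 : ℝ)| < c / 2 by simpa using hc0), hc,
      eventually_ge_atTop 1] with n h1 h2 hn
    have hn0 : (0 : ℝ) < (n : ℝ) ^ β := Real.rpow_pos_of_pos (by exact_mod_cast hn) _
    rw [← le_div_iff₀ hn0] at h2
    linarith [(abs_lt.1 h1).2]

end IsAdmissible

end SplitTree

/-! ### Conditioning on the root -/

namespace SplitTree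

section words

variable {b : ℕ}

/-- The words of length less than `h`. -/
def words (b : ℕ) : ℕ → Finset (List (Fin b))
  | 0 => ∅
  | h + 1 => insert [] (Finset.univ.biUnion fun i =>
      (words b h).map ⟨List.cons i, List.cons_injective⟩)

theorem mem_words {h : ℕ} {v : List (Fin b)} : v ∈ words b h ↔ v.length < h := by
  induction h generalizing v with
  | zero => simp [words]
  | succ h ih => cases v <;> simp [words, ih]

theorem sum_words_succ (f : List (Fin b) → ℝ) (h : ℕ) :
    ∑ v ∈ words b (h + 1), f v = f [] + ∑ i, ∑ v ∈ words b h, f (i :: v) := by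
  rw [words, Finset.sum_insert (by simp), Finset.sum_biUnion]
  · simp
  · intro i _ j _ hij
    rw [Function.onFun, Finset.disjoint_left]
    simp only [Finset.mem_map, Function.Embedding.coeFn_mk]
    rintro _ ⟨v, _, rfl⟩ ⟨w, _, h⟩
    exact hij (by simpa using (List.cons.inj h).1.symm)

theorem tendsto_words : Tendsto (words b) atTop atTop :=
  tendsto_atTop_finset_of_monotone
    (fun _ _ h _ hv => mem_words.2 ((mem_words.1 hv).trans_le h))
    fun _ => ⟨_, mem_words.2 (Nat.lt_succ_self _)⟩

end words

variable {b : ℕ} {s s₀ s₁ : ℕ} {ν : Measure (Fin b → ℝ)} [IsProbabilityMeasure ν] {β : ℝ}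
  {n : ℕ} {φ : BallTree b → ℝ}

/-- The law of the randomness attached to one node. -/
noncomputable def nodeLaw (ν : Measure (Fin b → ℝ)) [IsProbabilityMeasure ν] :
    Measure (NodeData b) :=
  ν.prod (Measure.infinitePi fun _ : ℕ => (volume : Measure unitInterval))

instance : IsProbabilityMeasure (nodeLaw ν) := by unfold nodeLaw; infer_instance

instance : IsProbabilityMeasure (driving ν) := by unfold driving; infer_instance

/-- The mean of `g` over the number of balls of child `i` of a node with `n` balls. -/
noncomputable def childMean (s s₀ s₁ : ℕ) (ν : Measure (Fin b → ℝ)) [IsProbabilityMeasure ν]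
    (n : ℕ) (i : Fin b) (g : ℕ → ℝ) : ℝ :=
  ∫ q, g (childCount s s₀ s₁ n q i) ∂(nodeLaw ν)

/-- The contribution of the node `v` to the additive functional of `φ`. -/
noncomputable def nodeTerm (φ : BallTree b → ℝ) (t : BallTree b) (v : List (Fin b)) : ℝ :=
  if 0 < t v then φ (fringe t v) else 0

theorem nodeTerm_tree_nil (ω : List (Fin b) → NodeData b) :
    nodeTerm φ (tree s s₀ s₁ n ω) [] = if 0 < n then φ (tree s s₀ s₁ n ω) else 0 := rfl

theorem nodeTerm_tree_cons (ω : List (Fin b) → NodeData b) (i : Fin b) (v : List (Fin b)) :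
    nodeTerm φ (tree s s₀ s₁ n ω) (i :: v) =
      nodeTerm φ (tree s s₀ s₁ (childCount s s₀ s₁ n (ω []) i) fun w => ω (i :: w)) v := rfl

theorem tree_zero (ω : List (Fin b) → NodeData b) (v : List (Fin b)) :
    tree s s₀ s₁ 0 ω v = 0 := by
  induction v generalizing ω with
  | nil => rfl
  | cons i v ih => rw [tree, childCount_of_le (Nat.zero_le s)]; exact ih _

theorem nodeTerm_tree_zero (ω : List (Fin b) → NodeData b) (v : List (Fin b)) :
    nodeTerm φ (tree s s₀ s₁ 0 ω) v = 0 := by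
  simp [nodeTerm, tree_zero]

theorem measurePreserving_cons (i : Fin b) :
    MeasurePreserving (fun ω : List (Fin b) → NodeData b => (ω [], fun w => ω (i :: w)))
      (driving ν) ((nodeLaw ν).prod (driving ν)) :=
  measurePreserving_infinitePi_prodMk _ [] (List.cons i) List.cons_injective (by simp)

namespace IsAdmissible

theorem childCount_le (H : IsAdmissible s s₀ s₁ ν β) (n : ℕ) (q : NodeData b) (i : Fin b) :
    childCount s s₀ s₁ n q i ≤ n := by
  rcases le_or_gt n s with h | h
  · simp [childCount_of_le h]
  · rw [childCount_of_lt h]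
    exact (Nat.add_le_add_right (sentCount_le _ q i) _).trans (H.trials_add_le h)

theorem integrable_comp_childCount (H : IsAdmissible s s₀ s₁ ν β) (n : ℕ) (i : Fin b)
    (g : ℕ → ℝ) : Integrable (fun q => g (childCount s s₀ s₁ n q i)) (nodeLaw ν) :=
  integrable_comp_nat_of_le (measurable_childCount s s₀ s₁ n i) (fun q => H.childCount_le n q i) g

theorem childMean_mono (H : IsAdmissible s s₀ s₁ ν β) {i : Fin b} {g h : ℕ → ℝ}
    (hgh : ∀ k ≤ n, g k ≤ h k) : childMean s s₀ s₁ ν n i g ≤ childMean s s₀ s₁ ν n i h :=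
  integral_mono (H.integrable_comp_childCount n i g) (H.integrable_comp_childCount n i h)
    fun q => hgh _ (H.childCount_le n q i)

theorem childMean_add_mul (H : IsAdmissible s s₀ s₁ ν β) (i : Fin b) (g h : ℕ → ℝ) (c : ℝ) :
    childMean s s₀ s₁ ν n i (fun k => g k + c * h k) =
      childMean s s₀ s₁ ν n i g + c * childMean s s₀ s₁ ν n i h := by
  rw [childMean, integral_add (H.integrable_comp_childCount n i g)
    ((H.integrable_comp_childCount n i h).const_mul c), integral_const_mul]
  rfl

theorem childMean_sum (H : IsAdmissible s s₀ s₁ ν β) {ι : Type*} (S : Finset ι) (i : Fin b)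
    (g : ι → ℕ → ℝ) :
    childMean s s₀ s₁ ν n i (fun k => ∑ v ∈ S, g v k) =
      ∑ v ∈ S, childMean s s₀ s₁ ν n i (g v) :=
  integral_finsetSum S fun v _ => H.integrable_comp_childCount n i (g v)

/-- A child count takes only the values 0, …, n, so `childMean` is a finite combination of point
values and pointwise convergence suffices. -/
theorem tendsto_childMean (H : IsAdmissible s s₀ s₁ ν β) (i : Fin b) {F : ℕ → ℕ → ℝ} {g : ℕ → ℝ}
    (hF : ∀ k, Tendsto (fun h => F h k) atTop (nhds (g k))) :
    Tendsto (fun h => childMean s s₀ s₁ ν n i (F h)) atTop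
      (nhds (childMean s s₀ s₁ ν n i g)) := by
  have h1 (u : ℕ → ℝ) : childMean s s₀ s₁ ν n i u = ∑ k ∈ Finset.range (n + 1),
      u k * childMean s s₀ s₁ ν n i (fun j => if j = k then 1 else 0) := by
    calc childMean s s₀ s₁ ν n i u
        = childMean s s₀ s₁ ν n i (fun j => ∑ k ∈ Finset.range (n + 1),
            (0 + u k * if j = k then 1 else 0)) := by
          refine integral_congr_ae (Eventually.of_forall fun q => ?_)
          have := H.childCount_le n q i
          simp [Nat.lt_succ_of_le this]
      _ = _ := by
          rw [H.childMean_sum _ _ fun k j => 0 + u k * if j = k then 1 else 0]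
          refine Finset.sum_congr rfl fun k _ => ?_
          rw [H.childMean_add_mul]
          simp [childMean]
  rw [h1 g]
  simp_rw [h1 (F _)]
  exact tendsto_finsetSum _ fun k _ => (hF k).mul_const _

theorem sum_childMean_eq_offspringMean (H : IsAdmissible s s₀ s₁ ν β) (hn : s < n) (g : ℕ → ℝ) :
    ∑ i, childMean s s₀ s₁ ν n i g = offspringMean s₀ s₁ ν g n := by
  rw [offspringMean, splitMean, integral_finsetSum _ fun i _ => integrable_binomMean H.sub _ _ i]
  exact Finset.sum_congr rfl fun i _ => integral_childCount H.sub hn i g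

/-- The expected number of children that inherit all n balls; this makes the induction for
integrability contract. -/
theorem sum_childMean_stay_lt_one (H : IsAdmissible s s₀ s₁ ν β) (hn : 1 ≤ n) :
    ∑ i, childMean s s₀ s₁ ν n i (fun k => if k = n then 1 else 0) < 1 := by
  rcases le_or_gt n s with h | h
  · have h0 : (0 : ℕ) ≠ n := by omega
    simp [childMean, childCount_of_le h, h0]
  · rw [H.sum_childMean_eq_offspringMean h, offspringMean]
    have h1 := H.trials_add_le h
    refine (splitMean_le_moment_mul H.sub fun j hj => ?_).trans_lt ?_
    · rw [if_neg (by omega)]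
    · rcases H.trials_add h with h2 | ⟨h2, h3⟩
      · rw [if_neg (by omega)]; simp
      · rw [if_pos (by omega), mul_one, h2]
        exact H.moment_natCast_lt_one h

/-- Conditioning on the randomness at the root. -/
theorem integrable_and_integral_comp_cons (H : IsAdmissible s s₀ s₁ ν β) (n : ℕ) (i : Fin b)
    {F : ℕ → (List (Fin b) → NodeData b) → ℝ} (hF : ∀ k, Integrable (F k) (driving ν)) :
    Integrable (fun ω => F (childCount s s₀ s₁ n (ω []) i) fun w => ω (i :: w)) (driving ν) ∧
      ∫ ω, F (childCount s s₀ s₁ n (ω []) i) (fun w => ω (i :: w)) ∂(driving ν) =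
        childMean s s₀ s₁ ν n i (fun k => ∫ ω, F k ω ∂(driving ν)) := by
  have hmp := measurePreserving_cons (ν := ν) i
  have hG : Integrable (fun p : NodeData b × (List (Fin b) → NodeData b) =>
      F (childCount s s₀ s₁ n p.1 i) p.2) ((nodeLaw ν).prod (driving ν)) := by
    -- Splitting by the value of the child count gives a finite sum of products of functions of
    -- independent variables; no joint measurability of F is needed.
    have h1 : (fun p : NodeData b × (List (Fin b) → NodeData b) =>
        F (childCount s s₀ s₁ n p.1 i) p.2) = fun p => ∑ k ∈ Finset.range (n + 1),
          (if childCount s s₀ s₁ n p.1 i = k then 1 else 0) * F k p.2 := by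
      ext p
      have := H.childCount_le n p.1 i
      simp [Nat.lt_succ_of_le this]
    rw [h1]
    exact integrable_finsetSum _ fun k _ =>
      (H.integrable_comp_childCount n i fun j => if j = k then 1 else 0).mul_prod (hF k)
  refine ⟨hmp.integrable_comp_of_integrable hG, ?_⟩
  rw [childMean, ← integral_prod _ hG, ← hmp.map_eq, integral_map hmp.measurable.aemeasurable]
  rw [hmp.map_eq]
  exact hG.aestronglyMeasurable

theorem integrable_nodeTerm (H : IsAdmissible s s₀ s₁ ν β)
    (hφ : ∀ n, 1 ≤ n → Integrable (fun ω => φ (tree s s₀ s₁ n ω)) (driving ν)) (n : ℕ)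
    (v : List (Fin b)) :
    Integrable (fun ω => nodeTerm φ (tree s s₀ s₁ n ω) v) (driving ν) := by
  induction v generalizing n with
  | nil =>
    simp_rw [nodeTerm_tree_nil]
    split_ifs with h
    · exact hφ n h
    · exact integrable_zero _ _ _
  | cons i v ih =>
    simp_rw [nodeTerm_tree_cons]
    exact (H.integrable_and_integral_comp_cons n i
      (F := fun k ω => nodeTerm φ (tree s s₀ s₁ k ω) v) fun k => ih k).1

end IsAdmissible

end SplitTree

/-! ### Integrability, the recursion for the means, and the example tolls -/

namespace SplitTree

variable {b : ℕ} {s s₀ s₁ : ℕ} {ν : Measure (Fin b → ℝ)} [IsProbabilityMeasure ν] {β : ℝ}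
  {n : ℕ} {φ : BallTree b → ℝ}

namespace IsAdmissible

theorem integral_nodeTerm_cons (H : IsAdmissible s s₀ s₁ ν β)
    (hφ : ∀ n, 1 ≤ n → Integrable (fun ω => φ (tree s s₀ s₁ n ω)) (driving ν)) (n : ℕ)
    (i : Fin b) (v : List (Fin b)) :
    ∫ ω, nodeTerm φ (tree s s₀ s₁ n ω) (i :: v) ∂(driving ν) = childMean s s₀ s₁ ν n i
      fun k => ∫ ω, nodeTerm φ (tree s s₀ s₁ k ω) v ∂(driving ν) :=
  (H.integrable_and_integral_comp_cons n i
    (F := fun k ω => nodeTerm φ (tree s s₀ s₁ k ω) v) fun k => H.integrable_nodeTerm hφ k v).2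

theorem integral_norm_nodeTerm_cons (H : IsAdmissible s s₀ s₁ ν β)
    (hφ : ∀ n, 1 ≤ n → Integrable (fun ω => φ (tree s s₀ s₁ n ω)) (driving ν)) (n : ℕ)
    (i : Fin b) (v : List (Fin b)) :
    ∫ ω, ‖nodeTerm φ (tree s s₀ s₁ n ω) (i :: v)‖ ∂(driving ν) = childMean s s₀ s₁ ν n i
      fun k => ∫ ω, ‖nodeTerm φ (tree s s₀ s₁ k ω) v‖ ∂(driving ν) :=
  (H.integrable_and_integral_comp_cons n i
    (F := fun k ω => ‖nodeTerm φ (tree s s₀ s₁ k ω) v‖)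
    fun k => (H.integrable_nodeTerm hφ k v).norm).2

/-- Induction on n, and for fixed n on the depth h. Children with fewer balls contribute at most K;
those that keep all n balls have expected number q < 1 and satisfy the bound already proved at depth
h. -/
theorem exists_sum_words_le (H : IsAdmissible s s₀ s₁ ν β)
    (hφ : ∀ n, 1 ≤ n → Integrable (fun ω => φ (tree s s₀ s₁ n ω)) (driving ν)) (n : ℕ) :
    ∃ X : ℝ, ∀ h, ∑ v ∈ words b h, ∫ ω, ‖nodeTerm φ (tree s s₀ s₁ n ω) v‖ ∂(driving ν) ≤ X := by
  induction n using Nat.strong_induction_on with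
  | _ n ih =>
  rcases Nat.eq_zero_or_pos n with rfl | hn
  · exact ⟨0, fun h => by simp [nodeTerm_tree_zero]⟩
  choose! X hX using ih
  set g : ℕ → ℝ := fun k => if k < n then X k else 0 with hg
  set e : ℕ → ℝ := fun k => if k = n then 1 else 0 with he
  set c := ∫ ω, ‖nodeTerm φ (tree s s₀ s₁ n ω) []‖ ∂(driving ν)
  set K := ∑ i, childMean s s₀ s₁ ν n i g with hK
  set q := ∑ i, childMean s s₀ s₁ ν n i e with hq
  have hq1 : q < 1 := H.sum_childMean_stay_lt_one hn
  have hc : 0 ≤ c := integral_nonneg fun _ => norm_nonneg _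
  have hg0 (k : ℕ) : 0 ≤ g k := by
    simp only [hg]; split_ifs with hk
    · exact (Finset.sum_nonneg fun v _ => integral_nonneg fun _ => norm_nonneg _).trans (hX k hk 0)
    · exact le_rfl
  have hK0 : 0 ≤ K := Finset.sum_nonneg fun i _ => integral_nonneg fun _ => hg0 _
  have h1q : 0 < 1 - q := sub_pos.2 hq1
  -- The fixed point of y ↦ c + K + q y, hence a bound that survives each increase of the depth.
  set Y := (c + K) / (1 - q) with hY
  have hYeq : c + (K + Y * q) = Y := by rw [hY]; field_simp; ring
  refine ⟨Y, fun h => ?_⟩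
  induction h with
  | zero => simpa [words] using by positivity
  | succ h ihh =>
    rw [sum_words_succ, ← hYeq, hK, hq, Finset.mul_sum, ← Finset.sum_add_distrib]
    refine add_le_add_right (Finset.sum_le_sum fun i _ => ?_) _
    simp_rw [H.integral_norm_nodeTerm_cons hφ]
    rw [← H.childMean_sum (words b h) i
      fun v k => ∫ ω, ‖nodeTerm φ (tree s s₀ s₁ k ω) v‖ ∂(driving ν), ← H.childMean_add_mul]
    refine H.childMean_mono fun k hk => ?_
    rcases hk.lt_or_eq with hk | rfl
    · simpa [hg, he, hk, hk.ne] using hX k hk h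
    · simpa [hg, he] using ihh

theorem summable_integral_norm_nodeTerm (H : IsAdmissible s s₀ s₁ ν β)
    (hφ : ∀ n, 1 ≤ n → Integrable (fun ω => φ (tree s s₀ s₁ n ω)) (driving ν)) (n : ℕ) :
    Summable fun v => ∫ ω, ‖nodeTerm φ (tree s s₀ s₁ n ω) v‖ ∂(driving ν) := by
  obtain ⟨X, hX⟩ := H.exists_sum_words_le hφ n
  have h0 (v : List (Fin b)) : 0 ≤ ∫ ω, ‖nodeTerm φ (tree s s₀ s₁ n ω) v‖ ∂(driving ν) :=
    integral_nonneg fun _ => norm_nonneg _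
  refine summable_of_sum_le h0 (c := X) fun S => ?_
  obtain ⟨h, hS⟩ := (tendsto_words.eventually_ge_atTop S).exists
  exact (Finset.sum_le_sum_of_subset_of_nonneg hS fun v _ _ => h0 v).trans (hX h)

theorem integrable_additive (H : IsAdmissible s s₀ s₁ ν β)
    (hφ : ∀ n, 1 ≤ n → Integrable (fun ω => φ (tree s s₀ s₁ n ω)) (driving ν)) (n : ℕ) :
    Integrable (fun ω => additive φ (tree s s₀ s₁ n ω)) (driving ν) := by
  have hint := H.integrable_nodeTerm hφ n
  have hsum := H.summable_integral_norm_nodeTerm hφ n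
  refine ⟨(AEMeasurable.tsum fun v => (hint v).aemeasurable).aestronglyMeasurable, ?_⟩
  refine (lintegral_mono fun ω => enorm_tsum_le_tsum_enorm).trans_lt ?_
  refine (lintegral_tsum fun v => (hint v).aestronglyMeasurable.enorm).trans_lt ?_
  have h1 (v : List (Fin b)) : ∫⁻ ω, ‖nodeTerm φ (tree s s₀ s₁ n ω) v‖ₑ ∂(driving ν) =
      ENNReal.ofReal (∫ ω, ‖nodeTerm φ (tree s s₀ s₁ n ω) v‖ ∂(driving ν)) :=
    (ofReal_integral_norm_eq_lintegral_enorm (hint v)).symm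
  refine (tsum_congr h1).trans_lt ?_
  exact hsum.tsum_ofReal_lt_top

theorem tendsto_sum_words (H : IsAdmissible s s₀ s₁ ν β)
    (hφ : ∀ n, 1 ≤ n → Integrable (fun ω => φ (tree s s₀ s₁ n ω)) (driving ν)) (n : ℕ) :
    Tendsto (fun h => ∑ v ∈ words b h, ∫ ω, nodeTerm φ (tree s s₀ s₁ n ω) v ∂(driving ν)) atTop
      (nhds (additiveMean s s₀ s₁ ν φ n)) :=
  (hasSum_integral_of_summable_integral_norm (H.integrable_nodeTerm hφ n)
    (H.summable_integral_norm_nodeTerm hφ n)).comp tendsto_words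

/-- The means of an additive functional satisfy the recursion driven by the toll means. -/
theorem isSolution_additiveMean (H : IsAdmissible s s₀ s₁ ν β)
    (hφ : ∀ n, 1 ≤ n → Integrable (fun ω => φ (tree s s₀ s₁ n ω)) (driving ν)) :
    IsSolution s s₀ s₁ ν (tollMean s s₀ s₁ ν φ) (additiveMean s s₀ s₁ ν φ) := by
  have h0 : additiveMean s s₀ s₁ ν φ 0 = 0 := by
    have h1 (ω : List (Fin b) → NodeData b) : additive φ (tree s s₀ s₁ 0 ω) = 0 :=
      (tsum_congr fun v => nodeTerm_tree_zero (φ := φ) ω v).trans tsum_zero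
    simp [additiveMean, h1]
  have hrec (n : ℕ) (hn : 1 ≤ n) : additiveMean s s₀ s₁ ν φ n = tollMean s s₀ s₁ ν φ n +
      ∑ i, childMean s s₀ s₁ ν n i (additiveMean s s₀ s₁ ν φ) := by
    -- Both sides are limits of the sums over words of length at most h, split at the root into the
    -- empty word and the words below each child.
    refine tendsto_nhds_unique ((H.tendsto_sum_words hφ n).comp (tendsto_add_atTop_nat 1)) ?_
    refine Tendsto.congr (fun h => ?_) (tendsto_const_nhds.add (tendsto_finsetSum Finset.univ
      fun i _ => H.tendsto_childMean i (H.tendsto_sum_words hφ)))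
    rw [Function.comp_apply, sum_words_succ]
    simp_rw [H.integral_nodeTerm_cons hφ, H.childMean_sum (words b h), nodeTerm_tree_nil]
    simp only [tollMean, if_pos (Nat.lt_of_succ_le hn)]
  refine ⟨h0, fun n h1 h2 => ?_, fun n h1 => ?_⟩
  · rw [hrec n h1]
    simp [childMean, childCount_of_le h2, h0]
  · rw [hrec n (by omega), H.sum_childMean_eq_offspringMean h1]

/-- Because of the possible diagonal term, a solution is obtained probabilistically, from the toll
that depends only on the number of balls. -/
theorem exists_isSolution (H : IsAdmissible s s₀ s₁ ν β) (a : ℕ → ℝ) :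
    ∃ f, IsSolution s s₀ s₁ ν a f := by
  have h := H.isSolution_additiveMean (φ := fun t => a (t [])) fun n _ => by simp [tree]
  have h1 : tollMean s s₀ s₁ ν (fun t => a (t [])) = a := by ext n; simp [tollMean, tree]
  rw [h1] at h
  exact ⟨_, h⟩

end IsAdmissible

theorem measurable_tree_apply (s s₀ s₁ n : ℕ) (u : List (Fin b)) :
    Measurable fun ω : List (Fin b) → NodeData b => tree s s₀ s₁ n ω u := by
  induction u using List.reverseRecOn with
  | nil => exact measurable_const
  | append_singleton u i ih =>
    simp_rw [tree_append_singleton]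
    have h1 : Measurable fun p : NodeData b × ℕ => childCount s s₀ s₁ p.2 p.1 i :=
      measurable_from_prod_countable_left fun k => measurable_childCount s s₀ s₁ k i
    exact h1.comp ((measurable_pi_apply u).prodMk ih)

/-- Bounded toll means are covered by δ = β. -/
theorem isSmallToll_of_abs_le_one (hβ : 0 < β)
    (hm : ∀ n, Measurable fun ω : List (Fin b) → NodeData b => φ (tree s s₀ s₁ n ω))
    (hφ : ∀ t, |φ t| ≤ 1) : IsSmallToll s s₀ s₁ ν β φ := by
  have h1 (n : ℕ) : ∀ᵐ ω ∂(driving ν), ‖φ (tree s s₀ s₁ n ω)‖ ≤ 1 :=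
    Eventually.of_forall fun ω => hφ _
  refine ⟨fun n _ => Integrable.of_bound (hm n).aestronglyMeasurable 1 (h1 n), β, hβ, ?_⟩
  simp only [sub_self, Real.rpow_zero]
  refine IsBigO.of_bound 1 (Eventually.of_forall fun n => ?_)
  simpa [tollMean] using norm_integral_le_of_norm_le_const (h1 n)

theorem isSmallToll_leafToll (hβ : 0 < β) : IsSmallToll s s₀ s₁ ν β leafToll := by
  refine isSmallToll_of_abs_le_one hβ (fun n => ?_) fun t => ?_
  · refine Measurable.ite ?_ measurable_const measurable_const
    have h1 (u : List (Fin b)) := measurable_tree_apply s s₀ s₁ n u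
    have h2 : MeasurableSet {ω : List (Fin b) → NodeData b | 0 < tree s s₀ s₁ n ω []} :=
      measurableSet_lt measurable_const (h1 [])
    refine h2.inter ?_
    have h3 : {ω : List (Fin b) → NodeData b | ∀ u, u ≠ [] → tree s s₀ s₁ n ω u = 0} =
        ⋂ u, ⋂ (_ : u ≠ []), (fun ω => tree s s₀ s₁ n ω u) ⁻¹' {0} := by ext; simp
    change MeasurableSet {ω : List (Fin b) → NodeData b | ∀ u, u ≠ [] → tree s s₀ s₁ n ω u = 0}
    rw [h3]
    exact MeasurableSet.iInter fun u => MeasurableSet.iInter fun _ =>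
      h1 u (measurableSet_singleton 0)
  · unfold leafToll; split_ifs <;> simp

theorem isSmallToll_nodeToll (hβ : 0 < β) : IsSmallToll s s₀ s₁ ν β nodeToll :=
  isSmallToll_of_abs_le_one hβ (fun _ => measurable_const) fun t => by simp [nodeToll]

theorem isSmallToll_sizeToll (hβ : 0 < β) (k : ℕ) : IsSmallToll s s₀ s₁ ν β (sizeToll k) :=
  isSmallToll_of_abs_le_one hβ (fun n => by
    by_cases h : n = k <;> simp [sizeToll, tree, h]) fun t => by
    unfold sizeToll; split_ifs <;> simp

/-- For a split vector the moment at 1 is 1, and moments decrease strictly. -/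
theorem IsSplitVector.malthusian_eq_one (hν : IsSplitVector ν) (hβ : IsMalthusian ν β) :
    β = 1 := by
  refine hβ.2.1.antisymm (not_lt.1 fun h => ?_)
  have h1 := moment_lt hν.1 hν.isNondegenerate hβ.1 h
  have h2 : moment ν 1 = 1 := by
    have h3 : moment ν 1 = ∫ _, (1 : ℝ) ∂ν := by
      refine integral_congr_ae ?_
      filter_upwards [hν.2.1] with v hv
      simpa using hv
    simpa using h3
  have h4 : moment ν β = 1 := hβ.2.2
  linarith

end SplitTree

theorem theorem1 {b : ℕ} (hb : 2 ≤ b) (s s₀ s₁ : ℕ) (hs : 1 ≤ s) (hs₁ : b * s₁ + s₀ ≤ s + 1)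
    (ν : Measure (Fin b → ℝ)) [IsProbabilityMeasure ν]
    (hν : SplitTree.IsSplitVector ν ∨ SplitTree.IsFractionalSplitVector ν)
    (β : ℝ) (hβ : SplitTree.IsMalthusian ν β) :
    (∀ φ : SplitTree.BallTree b → ℝ, SplitTree.IsSmallToll s s₀ s₁ ν β φ →
      (∀ n : ℕ, Integrable (fun ω => SplitTree.additive φ (SplitTree.tree s s₀ s₁ n ω))
        (SplitTree.driving ν)) ∧
      ∃ ϖ : ℝ → ℝ,
        (∃ C : ℝ, ∀ x, |ϖ x| ≤ C) ∧
        Continuous ϖ ∧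
        Function.Periodic ϖ (SplitTree.span ν) ∧
        (fun n : ℕ => SplitTree.additiveMean s s₀ s₁ ν φ n - ϖ (Real.log n) * (n : ℝ) ^ β)
          =o[atTop] (fun n : ℕ => (n : ℝ) ^ β) ∧
        (¬ SplitTree.IsLattice ν → ∃ c : ℝ, ∀ x, ϖ x = c) ∧
        ((∀ n : ℕ, 1 ≤ n → 0 ≤ SplitTree.tollMean s s₀ s₁ ν φ n) →
          (∃ n : ℕ, 1 ≤ n ∧ s₁ ≤ n ∧ 0 < SplitTree.tollMean s s₀ s₁ ν φ n) →
          ∃ c : ℝ, 0 < c ∧ ∀ x, c ≤ ϖ x)) ∧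
    SplitTree.IsSmallToll s s₀ s₁ ν β SplitTree.leafToll ∧
    SplitTree.IsSmallToll s s₀ s₁ ν β SplitTree.nodeToll ∧
    (∀ k : ℕ, SplitTree.IsSmallToll s s₀ s₁ ν β (SplitTree.sizeToll k)) ∧
    (SplitTree.IsSplitVector ν → β = 1) := by
  have H : SplitTree.IsAdmissible s s₀ s₁ ν β :=
    { two_le := hb
      one_le := hs
      le_succ := hs₁
      sub := hν.elim (fun h => h.1) fun h => h.1
      nondeg := hν.elim (fun h => h.isNondegenerate) fun h => h.isNondegenerate
      pos := hβ.1
      le_one := hβ.2.1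
      moment_eq := hβ.2.2 }
  refine ⟨fun φ hφ => ⟨H.integrable_additive hφ.1, ?_⟩, SplitTree.isSmallToll_leafToll hβ.1,
    SplitTree.isSmallToll_nodeToll hβ.1, SplitTree.isSmallToll_sizeToll hβ.1,
    fun h => h.malthusian_eq_one hβ⟩
  obtain ⟨hint, δ, hδ, ha⟩ := hφ
  obtain ⟨ϖ, hbd, hϖ, hasymp, hpos⟩ := H.fluctuation_asymptotics H.exists_isSolution
    (H.isSolution_additiveMean hint) hδ ha
  exact ⟨ϖ, hbd, hϖ.cont, hϖ.periodic, hasymp, hϖ.const, hpos⟩
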